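/- Let $N\ge 3$ be an integer and, for $\alpha>0$, put $C(\alpha)=(N+\alpha)(N-2)$, $p_\alpha=\frac{N+2+2\alpha}{N-2}$, and $$U_\alpha(x)=\frac{1}{(1+|x|^{2+\alpha})^{\frac{N-2}{2+\alpha}}},\qquad x\in\mathbb R^N,$$ which is the radial solution with $U_\alpha(0)=1$ of $-\Delta u=C(\alpha)|x|^\alpha u^{p_\alpha}$, $u>0$ in $\mathbb R^N$, $u\in D^{1,2}(\mathbb R^N)$. Here $D^{1,2}(\mathbb R^N)$ is the space of all $u\in L^{2N/(N-2)}(\mathbb R^N)$ with weak gradient $\nabla u\in L^2(\mathbb R^N)$. The Morse index $m(\alpha)$ of $U_\alpha$ is the supremum of the dimensions of the subspaces of $D^{1,2}(\mathbb R^N)$ on which the quadratic form $$v\longmapsto \int_{\mathbb R^N}|\nabla v|^2\,dx-\int_{\mathbb R^N}C(\alpha)\,p_\alpha\,|x|^\alpha\,U_\alpha^{p_\alpha-1}\,v^2\,dx$$ is negative definite. Then, for every $\alpha>0$, the Morse index $m(\alpha)$ is finite and $$m(\alpha)=\sum_{\substack{k\in\mathbb Z\\ 0\le k<\frac{\alpha+2}{2}}}\frac{(N+2k-2)\,(N+k-3)!}{(N-2)!\,k!}.$$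 In particular, $m(\alpha)$ jumps as $\alpha$ crosses each positive even integer, that is, $m(\alpha)<m(\beta)$ whenever $j\ge 1$ is an integer and $0<\alpha\le 2j<\beta$; and $m(\alpha)\to+\infty$ as $\alpha\to+\infty$. -/

import Mathlib

open MeasureTheory Filter Topology
open scoped ContDiff

namespace Henon

/-- The space `ℝ^N` with its Euclidean norm and Lebesgue measure. -/
abbrev Space (N : ℕ) : Type := EuclideanSpace ℝ (Fin N)

/-- `g` is the weak (distributional) gradient of `u` on `ℝ^N`: both are locally integrable and
`∫ u ∂ᵢφ = - ∫ gᵢ φ` for every test function `φ ∈ C_c^∞(ℝ^N)` and every coordinate `i`. -/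
def HasWeakGradient {N : ℕ} (u : Space N → ℝ) (g : Space N → Space N) : Prop :=
  LocallyIntegrable u volume ∧ LocallyIntegrable g volume ∧
    ∀ φ : Space N → ℝ, ContDiff ℝ ∞ φ → HasCompactSupport φ → ∀ i : Fin N,
      ∫ x, u x * fderiv ℝ φ x (EuclideanSpace.single i 1) = - ∫ x, g x i * φ x

open Classical in
/-- The weak gradient of `u` (unique up to a null set), and `0` if there is none. -/
noncomputable def weakGradient {N : ℕ} (u : Space N → ℝ) : Space N → Space N :=
  if h : ∃ g, HasWeakGradient u g then h.choose else 0

/-- The critical Sobolev exponent `2^* = 2N / (N - 2)`, for `N ≥ 3`. -/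
noncomputable def criticalExponent (N : ℕ) : ENNReal :=
  ENNReal.ofReal (2 * (N : ℝ) / ((N : ℝ) - 2))

/-- `u ∈ D^{1,2}(ℝ^N)`: `u ∈ L^{2^*}` has a weak gradient, and this gradient lies in `L^2`. -/
def MemD12 {N : ℕ} (u : Space N → ℝ) : Prop :=
  MemLp u (criticalExponent N) volume ∧ ∃ g, HasWeakGradient u g ∧ MemLp g 2 volume

/-- `C(α) = (N + α)(N - 2)`. -/
noncomputable def coeff (N : ℕ) (α : ℝ) : ℝ := ((N : ℝ) + α) * ((N : ℝ) - 2)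

/-- `p_α = (N + 2 + 2α) / (N - 2)`. -/
noncomputable def exponent (N : ℕ) (α : ℝ) : ℝ := ((N : ℝ) + 2 + 2 * α) / ((N : ℝ) - 2)

/-- `U_α(x) = 1 / (1 + |x|^{2+α})^{(N-2)/(2+α)}`, the radial solution of
`-Δu = C(α) |x|^α u^{p_α}` in `ℝ^N` with `u > 0`, `u ∈ D^{1,2}(ℝ^N)` and `u(0) = 1`. -/
noncomputable def U (N : ℕ) (α : ℝ) (x : Space N) : ℝ :=
  1 / (1 + ‖x‖ ^ (2 + α)) ^ (((N : ℝ) - 2) / (2 + α))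

/-- The quadratic form of the equation `-Δu = C(α) |x|^α u^{p_α}` linearized at a positive
function `u`, that is, the second variation at `u` of the energy
`½ ∫ |∇u|² - C(α) / (p_α + 1) ∫ |x|^α u^{p_α + 1}`, in the direction `v`:
`∫ |∇v|² - ∫ C(α) p_α |x|^α u^{p_α - 1} v²`. -/
noncomputable def secondVariation (N : ℕ) (α : ℝ) (u v : Space N → ℝ) : ℝ :=
  (∫ x, ‖weakGradient v x‖ ^ 2) -
    ∫ x, coeff N α * exponent N α * ‖x‖ ^ α * u x ^ (exponent N α - 1) * v x ^ 2

/-- `V` is a finite-dimensional subspace of `D^{1,2}(ℝ^N)` on which the second variation at `u` is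
negative definite. The elements of `V` are functions rather than classes of functions up to null
sets; this makes no difference to the dimension, because the second variation vanishes at a
function which is zero almost everywhere, so that negative definiteness leaves no such function in
`V` except `0`. -/
def IsNegativeSubspace (N : ℕ) (α : ℝ) (u : Space N → ℝ)
    (V : Submodule ℝ (Space N → ℝ)) : Prop :=
  FiniteDimensional ℝ V ∧ (∀ v ∈ V, MemD12 v) ∧
    ∀ v ∈ V, v ≠ 0 → secondVariation N α u v < 0

/-- The Morse index of `u`: the supremum (possibly `⊤`) of the dimensions of the subspaces of
`D^{1,2}(ℝ^N)` on which the second variation at `u` is negative definite. -/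
noncomputable def morseIndex (N : ℕ) (α : ℝ) (u : Space N → ℝ) : ℕ∞ :=
  ⨆ (V : Submodule ℝ (Space N → ℝ)) (_ : IsNegativeSubspace N α u V),
    (Module.finrank ℝ V : ℕ∞)

/-- The number `(N + 2k - 2) (N + k - 3)! / ((N - 2)! k!)`, for `N ≥ 3`. -/
noncomputable def multiplicity (N k : ℕ) : ℝ :=
  ((N : ℝ) + 2 * (k : ℝ) - 2) * (Nat.factorial (N + k - 3) : ℝ) /
    ((Nat.factorial (N - 2) : ℝ) * (Nat.factorial k : ℝ))

/-- The finite set of the integers `k` with `0 ≤ k < (α + 2) / 2`. -/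
noncomputable def indexSet (α : ℝ) : Finset ℕ := Finset.range ⌈(α + 2) / 2⌉₊

theorem mem_indexSet (α : ℝ) (k : ℕ) : k ∈ indexSet α ↔ (k : ℝ) < (α + 2) / 2 := by
  simp [indexSet, Nat.lt_ceil]

end Henon

/-! Put $\beta=(N-2)/2$, $\kappa=(2+\alpha)/2$ and $x=e^t\theta$ with $|\theta|=1$. Up to the factor
$e^{-2t}$, the potential of the linearized operator becomes the Pöschl–Teller well
$(\beta+\kappa)(\beta+2\kappa)/\cosh^2(\kappa t)$ (`exp_mul_pot`), whose ground state is explicit.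
Writing $v=$ `profile` $\cdot\, w$ with this ground state turns the second variation into
$$\int\!\!\int \rho(t)\,\bigl(w_t^2+|\nabla_\theta w|^2-\kappa(\kappa+N-2)\,w^2\bigr)\,d\theta\,dt$$
(`integral_density`). The Laplacian of the sphere has the eigenvalues $k(k+N-2)$, so the form is
governed by the comparison of $k$ with $\kappa$.

Lower bound. If $w$ is a spherical harmonic of degree $k<\kappa$, constant in $t$, the integrand
integrates over the sphere to something negative. Cutoffs in $t$ of small weighted energy
(`exists_cutoff`) make such $w$ admissible, and a sum of harmonics of different degrees stays
negative by orthogonality (`exists_isNegativeSubspace`).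

Upper bound. The weighted problem in $t$ has the eigenfunction $\sinh(\kappa t)$, again with
eigenvalue exactly $\kappa(\kappa+N-2)$, and it vanishes only at $t=0$. Hence a function of $t$
which vanishes at $0$ satisfies a Poincaré inequality with this very constant (`weighted_poincare`).
If $v$ is orthogonal on the unit sphere to all harmonics of degree below $\kappa$, this inequality
treats the low components and the spectral gap of the sphere (`sphere_gap`) treats the others, so
the form is nonnegative (`integral_density_nonneg`). The number of conditions is at most the total
multiplicity of the degrees below $\kappa$.

These conditions are imposed only on smooth functions supported away from the origin, and nothing is
claimed about their continuity in the energy. `energyMap_mem_closure` shows that such functions are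
dense in $D^{1,2}$ for the energy, and `finrank_le_of_negative` carries the dimension bound to the
closure by compactness of the coefficients.

The multiplicities are dimensions of spaces of harmonic polynomials, computed from the surjectivity
of the Laplacian on homogeneous polynomials, which follows from the Fischer inner product
(`lapHom_comp_normSqHom_bijective`). -/

namespace Henon

/-! ### A weighted one-dimensional Poincaré inequality -/

/-- The weight `cosh(κ t)^(-2(β+κ)/κ)` of the linearized operator in logarithmic coordinates. -/
noncomputable def rho (β κ t : ℝ) : ℝ := Real.cosh (κ * t) ^ (-(2 * (β + κ) / κ))

theorem rho_pos (β κ t : ℝ) : 0 < rho β κ t := Real.rpow_pos_of_pos (Real.cosh_pos _) _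

theorem rho_neg (β κ t : ℝ) : rho β κ (-t) = rho β κ t := by
  simp [rho, Real.cosh_neg]

theorem contDiff_rho (β κ : ℝ) : ContDiff ℝ ∞ (rho β κ) := by
  unfold rho
  exact (Real.contDiff_cosh.comp (contDiff_const.mul contDiff_id)).rpow_const_of_ne
    fun t => (Real.cosh_pos _).ne'

theorem hasDerivAt_cosh_rpow {κ : ℝ} (hκ : κ ≠ 0) (q t : ℝ) :
    HasDerivAt (fun t => Real.cosh (κ * t) ^ (-(q / κ)))
      (-q * (Real.sinh (κ * t) / Real.cosh (κ * t)) * Real.cosh (κ * t) ^ (-(q / κ))) t := by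
  have hc := Real.cosh_pos (κ * t)
  have h1 : HasDerivAt (fun t => Real.cosh (κ * t)) (Real.sinh (κ * t) * κ) t := by
    have := ((hasDerivAt_id t).const_mul κ).cosh
    simpa using this
  have h2 := h1.rpow_const (p := -(q / κ)) (Or.inl hc.ne')
  convert h2 using 1
  rw [Real.rpow_sub_one hc.ne']
  field_simp

theorem hasDerivAt_rho {κ : ℝ} (hκ : κ ≠ 0) (β t : ℝ) :
    HasDerivAt (rho β κ)
      (-(2 * (β + κ)) * (Real.sinh (κ * t) / Real.cosh (κ * t)) * rho β κ t) t :=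
  hasDerivAt_cosh_rpow hκ _ _

theorem continuous_dslope_of_contDiff {a : ℝ → ℝ} (ha : ContDiff ℝ 1 a) (x : ℝ) :
    Continuous (dslope a x) := by
  rw [← continuousOn_univ, continuousOn_dslope Filter.univ_mem]
  exact ⟨ha.continuous.continuousOn, (ha.differentiable one_ne_zero) x⟩

/-- Jacobi's argument: $s=\sinh(\kappa t)$ is positive on the half line and solves $(\rho
s')'+\kappa(\kappa+2\beta)\rho s=0$. Subtracting the derivative of $\rho\,(s'/s)\,a^2$ from the
integrand leaves the square $\rho\,(a'-(s'/s)a)^2$. -/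
theorem half_line_ground_state {β κ : ℝ} (hκ : 0 < κ) {a : ℝ → ℝ} (ha : ContDiff ℝ 1 a)
    (h0 : a 0 = 0) {b : ℝ} (hb : 0 < b) (hab : a b = 0) :
    0 ≤ ∫ t in (0 : ℝ)..b, rho β κ t * (deriv a t ^ 2 - κ * (κ + 2 * β) * a t ^ 2) := by
  -- The boundary term $\rho\,(s'/s)\,a^2$. Its quotient is singular at $0$, but $a^2$ vanishes
  -- there to second order.
  set B : ℝ → ℝ := fun t =>
    rho β κ t * κ * (Real.cosh (κ * t) / Real.sinh (κ * t)) * a t ^ 2 with hB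
  set e : ℝ → ℝ := dslope (fun t => Real.sinh (κ * t)) 0 with he
  set d : ℝ → ℝ := dslope a 0 with hd
  have hs1 : ContDiff ℝ 1 (fun t => Real.sinh (κ * t)) :=
    Real.contDiff_sinh.comp (contDiff_const.mul contDiff_id)
  have hec : Continuous e := continuous_dslope_of_contDiff hs1 0
  have hdc : Continuous d := continuous_dslope_of_contDiff ha 0
  have hse : ∀ t, Real.sinh (κ * t) = t * e t := fun t => by
    have := sub_smul_dslope (fun t => Real.sinh (κ * t)) 0 t
    simpa using this.symm
  have had : ∀ t, a t = t * d t := fun t => by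
    have := sub_smul_dslope a 0 t
    simpa [h0] using this.symm
  have he0 : ∀ t, e t ≠ 0 := by
    intro t
    by_cases ht : t = 0
    · subst ht
      have h1 : HasDerivAt (fun t => Real.sinh (κ * t)) κ 0 := by
        have := ((hasDerivAt_id (0 : ℝ)).const_mul κ).sinh
        simpa using this
      rw [he, dslope_same, h1.deriv]
      exact hκ.ne'
    · intro h
      have := hse t
      rw [h, mul_zero, Real.sinh_eq_zero] at this
      simp [hκ.ne', ht] at this
  -- Factoring one $t$ out of $\sinh(\kappa t)$ and out of $a$ by difference quotients exhibits the
  -- continuity of $B$ at $0$.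
  have hBe : B = fun t => rho β κ t * κ * Real.cosh (κ * t) * (t * d t ^ 2 / e t) := by
    funext t
    simp only [hB]
    rw [hse, had]
    by_cases ht : t = 0
    · simp [ht]
    · have := he0 t
      field_simp
  have hBc : Continuous B := by
    rw [hBe]
    have h1 := (contDiff_rho β κ).continuous
    have h2 : Continuous fun t => t * d t ^ 2 / e t :=
      (continuous_id.mul (hdc.pow 2)).div hec he0
    exact ((h1.mul continuous_const).mul
      (Real.continuous_cosh.comp (continuous_const.mul continuous_id))).mul h2
  have hcont : Continuous fun t =>
      rho β κ t * (deriv a t ^ 2 - κ * (κ + 2 * β) * a t ^ 2) := by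
    have h1 := (contDiff_rho β κ).continuous
    have h2 := ha.continuous_deriv le_rfl
    have h3 := ha.continuous
    fun_prop
  have key := intervalIntegral.sub_le_integral_of_hasDeriv_right_of_le (g := B)
    (g' := fun t => rho β κ t * (-(2 * (β + κ) * κ) * a t ^ 2
      - κ ^ 2 * a t ^ 2 / Real.sinh (κ * t) ^ 2
      + 2 * κ * (Real.cosh (κ * t) / Real.sinh (κ * t)) * a t * deriv a t))
    (φ := fun t => rho β κ t * (deriv a t ^ 2 - κ * (κ + 2 * β) * a t ^ 2))
    hb.le hBc.continuousOn ?_ hcont.continuousOn.integrableOn_Icc ?_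
  · have e1 : B b = 0 := by simp [hB, hab]
    have e2 : B 0 = 0 := by simp [hB, h0]
    simpa [e1, e2] using key
  · intro t ht
    refine HasDerivAt.hasDerivWithinAt ?_
    have hs : Real.sinh (κ * t) ≠ 0 := (Real.sinh_pos_iff.2 (mul_pos hκ ht.1)).ne'
    have hc := (Real.cosh_pos (κ * t)).ne'
    have h1 : HasDerivAt (fun t => Real.cosh (κ * t)) (Real.sinh (κ * t) * κ) t := by
      have := ((hasDerivAt_id t).const_mul κ).cosh
      simpa using this
    have h2 : HasDerivAt (fun t => Real.sinh (κ * t)) (Real.cosh (κ * t) * κ) t := by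
      have := ((hasDerivAt_id t).const_mul κ).sinh
      simpa using this
    have h3 := (ha.differentiable one_ne_zero t).hasDerivAt
    have h4 := (((hasDerivAt_rho hκ.ne' β t).mul_const κ).mul (h1.div h2 hs)).mul (h3.pow 2)
    refine h4.congr_deriv ?_
    have hsq : Real.cosh (κ * t) ^ 2 = Real.sinh (κ * t) ^ 2 + 1 := Real.cosh_sq _
    simp only [Pi.mul_apply, Pi.div_apply, Pi.pow_apply]
    field_simp
    push_cast
    linear_combination (-(rho β κ t * κ * a t ^ 2)) * hsq
  · intro t ht
    have hs : Real.sinh (κ * t) ≠ 0 := (Real.sinh_pos_iff.2 (mul_pos hκ ht.1)).ne'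
    refine mul_le_mul_of_nonneg_left ?_ (rho_pos β κ t).le
    have hsq : Real.cosh (κ * t) ^ 2 = Real.sinh (κ * t) ^ 2 + 1 := Real.cosh_sq _
    -- Completing the square; the surplus is what makes the derivative of $B$ a lower bound for the
    -- integrand.
    have h : deriv a t ^ 2 - κ * (κ + 2 * β) * a t ^ 2 - (-(2 * (β + κ) * κ) * a t ^ 2
      - κ ^ 2 * a t ^ 2 / Real.sinh (κ * t) ^ 2
      + 2 * κ * (Real.cosh (κ * t) / Real.sinh (κ * t)) * a t * deriv a t)
      = (deriv a t - κ * (Real.cosh (κ * t) / Real.sinh (κ * t)) * a t) ^ 2 := by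
      field_simp
      linear_combination (-(κ ^ 2) * (a t) ^ 2) * hsq
    nlinarith [sq_nonneg (deriv a t - κ * (Real.cosh (κ * t) / Real.sinh (κ * t)) * a t)]

/-- A weighted Poincaré inequality for functions vanishing at the origin. -/
theorem weighted_poincare {β κ : ℝ} (hκ : 0 < κ) {a : ℝ → ℝ} (ha : ContDiff ℝ 1 a)
    (h0 : a 0 = 0) (hs : HasCompactSupport a) :
    0 ≤ ∫ t, rho β κ t * (deriv a t ^ 2 - κ * (κ + 2 * β) * a t ^ 2) := by
  obtain ⟨R, hR⟩ := hs.isCompact.isBounded.subset_ball 0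
  set b := max R 1 with hb
  have hb0 : 0 < b := lt_of_lt_of_le one_pos (le_max_right _ _)
  have hz : ∀ t, b ≤ |t| → a t = 0 := fun t ht => by
    by_contra h
    have := hR (subset_tsupport a h)
    simp only [Metric.mem_ball, dist_zero_right, Real.norm_eq_abs] at this
    exact absurd (lt_of_lt_of_le this (le_max_left R 1)) (not_lt.2 ht)
  set F : ℝ → ℝ := fun t => rho β κ t * (deriv a t ^ 2 - κ * (κ + 2 * β) * a t ^ 2) with hF
  have hFc : Continuous F := by
    have h1 := (contDiff_rho β κ).continuous
    have h2 := ha.continuous_deriv le_rfl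
    have h3 := ha.continuous
    fun_prop
  have hsupp : Function.support F ⊆ Set.Ioc (-b) b := by
    intro t ht
    have hmem : t ∈ tsupport a := by
      by_contra h
      apply ht
      have h1 : a t = 0 := image_eq_zero_of_notMem_tsupport h
      have h2 : deriv a t = 0 := by
        by_contra h'
        exact h (support_deriv_subset (Function.mem_support.2 h'))
      simp [hF, h1, h2]
    have := hR hmem
    simp only [Metric.mem_ball, dist_zero_right, Real.norm_eq_abs] at this
    have := abs_lt.1 (lt_of_lt_of_le this (le_max_left R 1))
    exact ⟨this.1, this.2.le⟩
  rw [← intervalIntegral.integral_eq_integral_of_support_subset hsupp,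
    ← intervalIntegral.integral_add_adjacent_intervals (b := 0)
      (hFc.intervalIntegrable _ _) (hFc.intervalIntegrable _ _)]
  refine add_nonneg ?_ (half_line_ground_state hκ ha h0 hb0 (hz b (le_abs_self b)))
  -- The weight is even, so the negative half line reduces to the positive one by reflection.
  have hr := half_line_ground_state (β := β) (a := fun t => a (-t)) hκ (ha.comp contDiff_neg)
    (by simpa using h0) hb0 (hz (-b) (by simp [le_abs_self]))
  have : ∫ t in (-b)..0, F t = ∫ t in (0 : ℝ)..b, F (-t) := by
    rw [intervalIntegral.integral_comp_neg]; simp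
  rw [this]
  refine hr.trans_eq (intervalIntegral.integral_congr fun t _ => ?_)
  simp only [hF, rho_neg, deriv_comp_neg, even_two.neg_pow]

end Henon

/-! ### Logarithmic polar coordinates and radial functions -/

namespace Henon

/-- The unit sphere of `ℝ^N`. -/
abbrev Sph (N : ℕ) : Type := Metric.sphere (0 : Space N) 1

/-- The surface measure of the unit sphere. -/
noncomputable abbrev sphMeasure (N : ℕ) : Measure (Sph N) := (volume : Measure (Space N)).toSphere

/-- Smooth functions with compact support in `ℝ^N ∖ {0}`. -/
structure IsPuncturedTest {N : ℕ} (w : Space N → ℝ) : Prop where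
  contDiff : ContDiff ℝ ∞ w
  hasCompactSupport : HasCompactSupport w
  zero_notMem : (0 : Space N) ∉ tsupport w

theorem norm_exp_smul {N : ℕ} (t : ℝ) (θ : Sph N) : ‖Real.exp t • (θ : Space N)‖ = Real.exp t := by
  rw [norm_smul, norm_eq_of_mem_sphere, mul_one, Real.norm_eq_abs, Real.abs_exp]

theorem exp_smul_ne_zero {N : ℕ} (t : ℝ) (θ : Sph N) : Real.exp t • (θ : Space N) ≠ 0 := by
  rw [← norm_ne_zero_iff, norm_exp_smul]
  exact (Real.exp_pos t).ne'

/-- A compact set missing the origin lies in an annulus, so in the variable $t=\log|x|$ the support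
is compact, uniformly in the direction. -/
theorem exists_support_annulus {N : ℕ} {F : Space N → ℝ} (hF : HasCompactSupport F)
    (h0 : (0 : Space N) ∉ tsupport F) :
    ∃ T : ℝ, ∀ (θ : Sph N) (t : ℝ), t ∉ Set.Icc (-T) T → Real.exp t • (θ : Space N) ∉ tsupport F := by
  obtain ⟨R, hR⟩ := hF.isCompact.isBounded.subset_closedBall 0
  obtain ⟨ε, hε, hεs⟩ := Metric.isOpen_iff.1 (isClosed_tsupport F).isOpen_compl 0 h0
  refine ⟨max (Real.log (max R 1)) (-Real.log ε), fun θ t ht hmem => ht ⟨?_, ?_⟩⟩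
  · by_contra h
    refine hεs ?_ hmem
    rw [Metric.mem_ball, dist_zero_right, norm_exp_smul]
    rw [← Real.lt_log_iff_exp_lt hε]
    have := le_max_right (Real.log (max R 1)) (-Real.log ε)
    linarith
  · have := hR hmem
    rw [Metric.mem_closedBall, dist_zero_right, norm_exp_smul] at this
    refine le_trans ?_ (le_max_left _ _)
    rw [Real.le_log_iff_exp_le (lt_of_lt_of_le one_pos (le_max_right _ _))]
    exact this.trans (le_max_left _ _)

theorem continuous_polar {N : ℕ} :
    Continuous fun p : Sph N × ℝ => Real.exp p.2 • (p.1 : Space N) :=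
  (Real.continuous_exp.comp continuous_snd).smul (continuous_subtype_val.comp continuous_fst)

theorem hasCompactSupport_polar {N : ℕ} {F : Space N → ℝ} (hF : HasCompactSupport F)
    (h0 : (0 : Space N) ∉ tsupport F) :
    HasCompactSupport fun p : Sph N × ℝ => F (Real.exp p.2 • (p.1 : Space N)) := by
  obtain ⟨T, hT⟩ := exists_support_annulus hF h0
  refine HasCompactSupport.intro (K := Set.univ ×ˢ Set.Icc (-T) T)
    (isCompact_univ.prod isCompact_Icc) fun p hp => ?_
  refine image_eq_zero_of_notMem_tsupport (hT p.1 p.2 fun h => hp ⟨trivial, h⟩)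

theorem integrable_polar {N : ℕ} {F : Space N → ℝ} (hc : Continuous F) (hF : HasCompactSupport F)
    (h0 : (0 : Space N) ∉ tsupport F) {g : ℝ → ℝ} (hg : Continuous g) :
    Integrable (fun p : Sph N × ℝ => g p.2 * F (Real.exp p.2 • (p.1 : Space N)))
      ((sphMeasure N).prod volume) :=
  ((hg.comp continuous_snd).mul (hc.comp continuous_polar)).integrable_of_hasCompactSupport
    (hasCompactSupport_polar hF h0).mul_left

theorem integral_Ioi_eq_integral_exp (f : ℝ → ℝ) :
    ∫ r in Set.Ioi (0 : ℝ), f r = ∫ t, Real.exp t * f (Real.exp t) := by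
  have := integral_image_eq_integral_abs_deriv_smul (s := Set.univ) MeasurableSet.univ
    (fun x _ => (Real.hasDerivAt_exp x).hasDerivWithinAt) (Real.exp_injective.injOn) f
  rw [Set.image_univ, Real.range_exp] at this
  simpa [abs_of_pos (Real.exp_pos _)] using this

/-- Integration in logarithmic polar coordinates. -/
theorem integral_eq_integral_polar {N : ℕ} (hN : 0 < N) {F : Space N → ℝ} (hc : Continuous F)
    (hF : HasCompactSupport F) (h0 : (0 : Space N) ∉ tsupport F) :
    ∫ x, F x = ∫ p : Sph N × ℝ, Real.exp (N * p.2) * F (Real.exp p.2 • (p.1 : Space N))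
      ∂((sphMeasure N).prod volume) := by
  have : Nontrivial (Space N) := by
    apply Module.nontrivial_of_finrank_pos (R := ℝ); simpa using hN
  have hdim : Module.finrank ℝ (Space N) = N := by simp
  have hint : Integrable F := hc.integrable_of_hasCompactSupport hF
  have mp := (volume : Measure (Space N)).measurePreserving_homeomorphUnitSphereProd
  rw [hdim] at mp
  set G : Sph N × Set.Ioi (0 : ℝ) → ℝ := fun p => F (p.2.1 • (p.1 : Space N)) with hG
  have hGF : ∀ x : ({(0)}ᶜ : Set (Space N)), G (homeomorphUnitSphereProd (Space N) x) = F x := by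
    intro x
    have : (x : Space N) ≠ 0 := x.2
    simp [hG, smul_smul, this]
  have e1 : ∫ x, F x = ∫ p, G p ∂((sphMeasure N).prod (Measure.volumeIoiPow (N - 1))) := by
    rw [← mp.integral_comp (Homeomorph.measurableEmbedding _) G]
    simp_rw [hGF]
    rw [integral_subtype_comap (measurableSet_singleton _).compl F, restrict_compl_singleton]
  have hGi : Integrable G ((sphMeasure N).prod (Measure.volumeIoiPow (N - 1))) := by
    rw [← mp.integrable_comp_emb (Homeomorph.measurableEmbedding _)]
    have : G ∘ homeomorphUnitSphereProd (Space N) = F ∘ Subtype.val := by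
      funext x; exact hGF x
    rw [this, ← integrableOn_iff_comap_subtypeVal (measurableSet_singleton _).compl]
    exact hint.integrableOn
  rw [e1, integral_prod _ hGi,
    integral_prod _ (integrable_polar hc hF h0 (g := fun t => Real.exp (N * t)) (by fun_prop))]
  refine integral_congr_ae (Eventually.of_forall fun θ => ?_)
  simp only [Measure.volumeIoiPow, ENNReal.ofReal, hG]
  rw [integral_withDensity_eq_integral_smul,
    integral_subtype_comap measurableSet_Ioi
      fun a => Real.toNNReal (a ^ (N - 1)) • F (a • (θ : Space N)),
    integral_Ioi_eq_integral_exp]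
  · refine integral_congr_ae (Eventually.of_forall fun t => ?_)
    simp only [NNReal.smul_def, smul_eq_mul]
    -- The Jacobian $e^t$ of $r=e^t$ combines with $r^{N-1}$ to give $e^{Nt}$.
    rw [Real.coe_toNNReal _ (by positivity), ← mul_assoc, ← Real.exp_nat_mul, ← Real.exp_add]
    congr 2
    rw [Nat.cast_sub hN]; push_cast; ring
  · exact (measurable_subtype_coe.pow_const _).real_toNNReal

/-- The integral of a product of a function of the radius and a homogeneous function. -/
theorem integral_polar_mul {N : ℕ} (g : ℝ → ℝ) (f : Sph N → ℝ) :
    ∫ p : Sph N × ℝ, g p.2 * f p.1 ∂((sphMeasure N).prod volume)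
      = (∫ t, g t) * ∫ θ, f θ ∂(sphMeasure N) := by
  rw [mul_comm, ← integral_prod_mul]
  simp_rw [mul_comm]

theorem hasFDerivAt_log_norm {N : ℕ} {x : Space N} (hx : x ≠ 0) :
    HasFDerivAt (fun x : Space N => Real.log ‖x‖) ((‖x‖ ^ 2)⁻¹ • innerSL ℝ x) x := by
  have h1 : HasFDerivAt (fun x : Space N => ‖x‖ ^ 2) (2 • innerSL ℝ x) x :=
    (hasStrictFDerivAt_norm_sq x).hasFDerivAt
  have hx2 : ‖x‖ ^ 2 ≠ 0 := by simpa using hx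
  have h2 := (h1.log hx2).const_mul (1 / 2)
  have h3 : (fun x : Space N => Real.log ‖x‖) = fun x => 1 / 2 * Real.log (‖x‖ ^ 2) := by
    funext y; rw [Real.log_pow]; push_cast; ring
  rw [h3]
  refine h2.congr_fderiv ?_
  ext y
  simp
  ring

theorem contDiffAt_log_norm {N : ℕ} {x : Space N} (hx : x ≠ 0) :
    ContDiffAt ℝ ∞ (fun x : Space N => Real.log ‖x‖) x :=
  (contDiffAt_norm ℝ hx).log (norm_ne_zero_iff.2 hx)

/-- The radial function `χ(log |x|)`, with the value `0` at the origin. -/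
noncomputable def radial {N : ℕ} (χ : ℝ → ℝ) (x : Space N) : ℝ :=
  open Classical in if x = 0 then 0 else χ (Real.log ‖x‖)

theorem radial_exp_smul {N : ℕ} (χ : ℝ → ℝ) (t : ℝ) (θ : Sph N) :
    radial χ (Real.exp t • (θ : Space N)) = χ t := by
  rw [radial, if_neg (exp_smul_ne_zero t θ), norm_exp_smul, Real.log_exp]

theorem radial_of_ne {N : ℕ} (χ : ℝ → ℝ) {x : Space N} (hx : x ≠ 0) :
    radial χ x = χ (Real.log ‖x‖) := if_neg hx

theorem radial_eventuallyEq {N : ℕ} (χ : ℝ → ℝ) {x : Space N} (hx : x ≠ 0) :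
    radial χ =ᶠ[𝓝 x] fun x => χ (Real.log ‖x‖) := by
  filter_upwards [isOpen_ne.mem_nhds hx] with y hy using radial_of_ne χ hy

theorem hasFDerivAt_radial {N : ℕ} {χ : ℝ → ℝ} {χ' : ℝ} {x : Space N} (hx : x ≠ 0)
    (h : HasDerivAt χ χ' (Real.log ‖x‖)) :
    HasFDerivAt (radial χ) (χ' • (‖x‖ ^ 2)⁻¹ • innerSL ℝ x) x :=
  (h.comp_hasFDerivAt x (hasFDerivAt_log_norm hx)).congr_of_eventuallyEq (radial_eventuallyEq χ hx)

theorem contDiffAt_radial {N : ℕ} {χ : ℝ → ℝ} (hχ : ContDiff ℝ ∞ χ) {x : Space N} (hx : x ≠ 0) :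
    ContDiffAt ℝ ∞ (radial χ) x :=
  (hχ.contDiffAt.comp x (contDiffAt_log_norm hx)).congr_of_eventuallyEq (radial_eventuallyEq χ hx)

/-- The second factor need only be smooth off the origin, since the radial factor vanishes near it.
This permits factors that depend on $x/|x|$. -/
theorem isPuncturedTest_radial_mul {N : ℕ} {χ : ℝ → ℝ} (hχ : ContDiff ℝ ∞ χ)
    (hs : HasCompactSupport χ) {h : Space N → ℝ} (hh : ∀ x ≠ 0, ContDiffAt ℝ ∞ h x) :
    IsPuncturedTest fun x => radial χ x * h x := by
  obtain ⟨R, hR⟩ := hs.isCompact.isBounded.subset_closedBall 0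
  have hz : ∀ x : Space N, x ∉ {x : Space N | Real.exp (-R) ≤ ‖x‖} ∩ Metric.closedBall 0 (Real.exp R) →
      radial χ x * h x = 0 := by
    intro x hx
    by_cases hx0 : x = 0
    · simp [radial, hx0]
    rw [radial_of_ne χ hx0]
    have hn : 0 < ‖x‖ := norm_pos_iff.2 hx0
    have : χ (Real.log ‖x‖) = 0 := by
      by_contra hne
      have := hR (subset_tsupport χ hne)
      rw [Metric.mem_closedBall, dist_zero_right, Real.norm_eq_abs, abs_le] at this
      apply hx
      refine ⟨(Real.le_log_iff_exp_le hn).1 this.1, ?_⟩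
      rw [Metric.mem_closedBall, dist_zero_right]
      exact (Real.log_le_iff_le_exp hn).1 this.2
    rw [this, zero_mul]
  have hcl : IsClosed ({x : Space N | Real.exp (-R) ≤ ‖x‖} ∩ Metric.closedBall 0 (Real.exp R)) :=
    (isClosed_le continuous_const continuous_norm).inter Metric.isClosed_closedBall
  have hsub : tsupport (fun x => radial χ x * h x) ⊆
      {x : Space N | Real.exp (-R) ≤ ‖x‖} ∩ Metric.closedBall 0 (Real.exp R) := by
    refine closure_minimal (fun x hx => ?_) hcl
    by_contra hxn
    exact hx (hz x hxn)
  have h0 : (0 : Space N) ∉ tsupport (fun x => radial χ x * h x) := by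
    intro hmem
    have := (hsub hmem).1
    simp only [Set.mem_ofPred_eq, norm_zero] at this
    exact absurd (Real.exp_pos (-R)) (not_lt.2 this)
  refine ⟨?_, ?_, h0⟩
  · rw [contDiff_iff_contDiffAt]
    intro x
    by_cases hx : x = 0
    · subst hx
      refine (contDiffAt_const (c := (0 : ℝ))).congr_of_eventuallyEq ?_
      exact notMem_tsupport_iff_eventuallyEq.1 h0
    · exact (contDiffAt_radial hχ hx).mul (hh x hx)
  · exact (isCompact_closedBall (0 : Space N) (Real.exp R)).of_isClosed_subset (isClosed_tsupport _)
      (hsub.trans Set.inter_subset_right)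

/-! ### Rotation fields and integration by parts on the sphere -/

/-- The vector field `x_i e_j - x_j e_i`, which generates the rotations in a coordinate plane. -/
noncomputable def rot {N : ℕ} (i j : Fin N) (x : Space N) : Space N :=
  x i • EuclideanSpace.single j 1 - x j • EuclideanSpace.single i 1

theorem rot_smul {N : ℕ} (i j : Fin N) (c : ℝ) (x : Space N) : rot i j (c • x) = c • rot i j x := by
  simp [rot, smul_sub, smul_smul]

theorem inner_rot {N : ℕ} (i j : Fin N) (x : Space N) : inner ℝ x (rot i j x) = 0 := by
  simp [rot, inner_sub_right, inner_smul_right, EuclideanSpace.inner_single_right, mul_comm]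

/-- Rotation fields are divergence free: for $i\ne j$ the coefficient $x_i$ does not depend on
$x_j$, so an integration by parts leaves no term. -/
theorem integral_fderiv_rot {N : ℕ} (i j : Fin N) {G : Space N → ℝ} (hG : ContDiff ℝ 1 G)
    (hs : HasCompactSupport G) : ∫ x, fderiv ℝ G x (rot i j x) = 0 := by
  by_cases hij : i = j
  · subst hij
    simp [rot]
  have hd : Continuous (fderiv ℝ G) := hG.continuous_fderiv one_ne_zero
  have hds : HasCompactSupport (fderiv ℝ G) := hs.fderiv ℝ
  have key : ∀ i j : Fin N, i ≠ j → Integrable (fun x : Space N =>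
      x i * fderiv ℝ G x (EuclideanSpace.single j 1)) ∧
      ∫ x : Space N, x i * fderiv ℝ G x (EuclideanSpace.single j 1) = 0 := by
    intro i j hij
    have hp : ∀ x : Space N, HasFDerivAt (fun x : Space N => x i)
        (EuclideanSpace.proj i : Space N →L[ℝ] ℝ) x :=
      fun x => (EuclideanSpace.proj i : Space N →L[ℝ] ℝ).hasFDerivAt
    have hf' : ∀ x : Space N, fderiv ℝ (fun x : Space N => x i) x (EuclideanSpace.single j 1) = 0 := by
      intro x
      rw [(hp x).fderiv]
      simp [hij]
    have hc : Continuous fun x : Space N => x i := (EuclideanSpace.proj i : Space N →L[ℝ] ℝ).continuous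
    have hi : Integrable (fun x : Space N => x i * fderiv ℝ G x (EuclideanSpace.single j 1)) := by
      refine (hc.mul (hd.clm_apply continuous_const)).integrable_of_hasCompactSupport ?_
      refine HasCompactSupport.mul_left ?_
      exact hds.comp_left (g := fun L : Space N →L[ℝ] ℝ => L (EuclideanSpace.single j 1)) rfl
    refine ⟨hi, ?_⟩
    rw [integral_mul_fderiv_eq_neg_fderiv_mul_of_integrable _ hi _
      (fun x _ => (hp x).differentiableAt) (fun x _ => hG.differentiable one_ne_zero x)]
    · simp [hf']
    · simp [hf']
    · exact (hc.mul hG.continuous).integrable_of_hasCompactSupport hs.mul_left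
  have h1 := key i j hij
  have h2 := key j i (Ne.symm hij)
  simp only [rot, map_sub, map_smul, smul_eq_mul]
  rw [integral_sub h1.1 h2.1, h1.2, h2.2, sub_zero]

theorem inv_norm_smul_exp_smul {N : ℕ} (t : ℝ) (θ : Sph N) :
    ‖Real.exp t • (θ : Space N)‖⁻¹ • (Real.exp t • (θ : Space N)) = θ := by
  rw [norm_exp_smul, smul_smul, inv_mul_cancel₀ (Real.exp_pos t).ne', one_smul]

theorem contDiffAt_comp_normalize {N : ℕ} {F : Space N → ℝ} (hF : ContDiff ℝ ∞ F) {x : Space N}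
    (hx : x ≠ 0) : ContDiffAt ℝ ∞ (fun x : Space N => F (‖x‖⁻¹ • x)) x :=
  hF.contDiffAt.comp x (((contDiffAt_norm ℝ hx).inv (norm_ne_zero_iff.2 hx)).smul contDiffAt_id)

/-- Rotational derivatives commute with dilations and ignore radial factors. -/
theorem fderiv_radial_mul_normalize_rot {N : ℕ} {η : ℝ → ℝ} (hη : Differentiable ℝ η)
    {F : Space N → ℝ} (hF : Differentiable ℝ F) (i j : Fin N) (t : ℝ) (θ : Sph N) :
    fderiv ℝ (fun y : Space N => radial η y * F (‖y‖⁻¹ • y)) (Real.exp t • (θ : Space N))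
      (rot i j (Real.exp t • (θ : Space N))) = η t * fderiv ℝ F θ (rot i j (θ : Space N)) := by
  set x := Real.exp t • (θ : Space N) with hx
  have hx0 : x ≠ 0 := exp_smul_ne_zero t θ
  have hr : HasFDerivAt (radial η) _ x :=
    hasFDerivAt_radial hx0 (hη (Real.log ‖x‖)).hasDerivAt
  have hE : HasDerivAt (fun s => Real.exp (-s)) (-Real.exp (-Real.log ‖x‖)) (Real.log ‖x‖) := by
    simpa using (hasDerivAt_id (Real.log ‖x‖)).neg.exp
  have hi : HasFDerivAt (radial fun s => Real.exp (-s)) _ x := hasFDerivAt_radial hx0 hE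
  have hin : (fun x : Space N => ‖x‖⁻¹ • x) =ᶠ[𝓝 x]
      fun x => (radial fun s => Real.exp (-s)) x • x := by
    filter_upwards [isOpen_ne.mem_nhds hx0] with y hy
    rw [radial_of_ne _ hy, Real.exp_neg, Real.exp_log (norm_pos_iff.2 hy)]
  have hn := (hi.smul (hasFDerivAt_id x)).congr_of_eventuallyEq hin
  have hnx : ‖x‖⁻¹ • x = θ := inv_norm_smul_exp_smul t θ
  have hFx : HasFDerivAt F (fderiv ℝ F θ) (‖x‖⁻¹ • x) := by
    rw [hnx]; exact (hF _).hasFDerivAt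
  have hcomp := HasFDerivAt.comp (f := fun x : Space N => ‖x‖⁻¹ • x) x hFx hn
  have hprod : HasFDerivAt (fun y : Space N => radial η y * F (‖y‖⁻¹ • y)) _ x := hr.fun_mul hcomp
  rw [hprod.fderiv]
  have e : radial (fun s => Real.exp (-s)) x = (Real.exp t)⁻¹ := by
    rw [hx, radial_exp_smul, Real.exp_neg]
  have hrr : rot i j x = Real.exp t • rot i j (θ : Space N) := rot_smul _ _ _ _
  have hz : inner ℝ x (rot i j x) = 0 := inner_rot i j x
  simp [hz, e]
  rw [hrr, map_smul, smul_eq_mul, hx, radial_exp_smul]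
  field_simp

/-- Rotational derivatives have mean value zero on the sphere. -/
theorem integral_sphere_fderiv_rot {N : ℕ} (hN : 0 < N) (i j : Fin N) {F : Space N → ℝ}
    (hF : ContDiff ℝ ∞ F) :
    ∫ θ : Sph N, fderiv ℝ F θ (rot i j (θ : Space N)) ∂(sphMeasure N) = 0 := by
  -- Extending $F$ from the sphere as a function of $x/|x|$ times a radial bump turns the integral
  -- over the sphere into one over $\mathbb R^N$, where integration by parts is available.
  let η : ContDiffBump (0 : ℝ) := ⟨1, 2, one_pos, one_lt_two⟩
  have hη : ContDiff ℝ ∞ η := η.contDiff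
  have hηs : HasCompactSupport η := η.hasCompactSupport
  set h : Space N → ℝ := fun x => F (‖x‖⁻¹ • x) with hh
  have hhs : ∀ x ≠ 0, ContDiffAt ℝ ∞ h x := fun x hx => contDiffAt_comp_normalize hF hx
  have hG := isPuncturedTest_radial_mul hη hηs hhs
  set G := fun x => radial η x * h x with hGdef
  have hrot : ∀ (θ : Sph N) (t : ℝ), fderiv ℝ G (Real.exp t • (θ : Space N))
      (rot i j (Real.exp t • (θ : Space N))) = η t * fderiv ℝ F θ (rot i j (θ : Space N)) := by
    intro θ t
    exact fderiv_radial_mul_normalize_rot (hη.differentiable (by simp)) (hF.differentiable (by simp))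
      i j t θ
  set K : Space N → ℝ := fun x => fderiv ℝ G x (rot i j x) with hK
  have hKc : Continuous K := by
    have h1 : Continuous (fderiv ℝ G) := hG.contDiff.continuous_fderiv (by simp)
    have h2 : Continuous (rot i j : Space N → Space N) := by
      unfold rot; fun_prop
    exact h1.clm_apply h2
  have hKt : tsupport K ⊆ tsupport G := by
    refine closure_minimal (fun x hx => ?_) (isClosed_tsupport G)
    by_contra hxn
    apply hx
    have : fderiv ℝ G x = 0 := by
      by_contra h
      exact hxn (support_fderiv_subset ℝ h)
    simp [hK, this]
  have hKs : HasCompactSupport K := hG.hasCompactSupport.of_isClosed_subset (isClosed_tsupport _) hKt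
  have hpol := integral_eq_integral_polar hN hKc hKs fun h => hG.zero_notMem (hKt h)
  rw [integral_fderiv_rot i j (hG.contDiff.of_le (by exact_mod_cast le_top)) hG.hasCompactSupport]
    at hpol
  have e : ∀ p : Sph N × ℝ, Real.exp (N * p.2) * K (Real.exp p.2 • (p.1 : Space N)) =
      (Real.exp (N * p.2) * η p.2) * fderiv ℝ F p.1 (rot i j (p.1 : Space N)) := by
    intro p
    rw [hK]; simp only [hrot]; ring
  simp_rw [e] at hpol
  rw [integral_polar_mul (fun t => Real.exp (N * t) * η t)
    (fun θ : Sph N => fderiv ℝ F θ (rot i j (θ : Space N)))] at hpol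
  -- The integral has factored into a radial and a spherical part, and the radial part is positive.
  refine (mul_eq_zero.1 hpol.symm).resolve_left ?_
  refine (Continuous.integral_pos_of_hasCompactSupport_nonneg_nonzero (x := 0) ?_ ?_ ?_ ?_).ne'
  · exact (by fun_prop : Continuous fun t : ℝ => Real.exp (N * t)).mul η.continuous
  · exact hηs.mul_left
  · exact fun t => mul_nonneg (Real.exp_pos _).le η.nonneg
  · have : η 0 = 1 := η.one_of_mem_closedBall (by simp [η])
    simp [this]

end Henon

/-! ### Harmonic polynomials and their dimension -/

namespace Henon

section Polynomials

open MvPolynomial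

variable {N : ℕ}

theorem pderiv_comm (i j : Fin N) (p : MvPolynomial (Fin N) ℝ) :
    pderiv i (pderiv j p) = pderiv j (pderiv i p) := by
  by_cases hij : i = j
  · rw [hij]
  ext m
  simp only [coeff_pderiv, Finsupp.add_apply, Finsupp.single_apply, hij, Ne.symm hij, if_false]
  rw [add_right_comm]
  simp
  ring

/-- The Laplacian of polynomials. -/
noncomputable def lap : MvPolynomial (Fin N) ℝ →ₗ[ℝ] MvPolynomial (Fin N) ℝ :=
  ∑ i, (pderiv i).toLinearMap ∘ₗ (pderiv i).toLinearMap

theorem lap_apply (p : MvPolynomial (Fin N) ℝ) : lap p = ∑ i, pderiv i (pderiv i p) := by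
  simp [lap]

/-- The polynomial `|x|²`. -/
noncomputable def normSqPoly (N : ℕ) : MvPolynomial (Fin N) ℝ := ∑ i, X i ^ 2

theorem isHomogeneous_normSqPoly : (normSqPoly N).IsHomogeneous 2 :=
  IsHomogeneous.sum _ _ _ fun i _ => by simpa using (isHomogeneous_X ℝ i).pow 2

theorem isHomogeneous_lap {k : ℕ} {p : MvPolynomial (Fin N) ℝ} (hp : p.IsHomogeneous k) :
    (lap p).IsHomogeneous (k - 2) := by
  rw [lap_apply]
  exact IsHomogeneous.sum _ _ _ fun i _ => hp.pderiv.pderiv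

/-- The Fischer inner product, for which multiplication by `X i` is adjoint to `pderiv i`. -/
noncomputable def fischer : MvPolynomial (Fin N) ℝ →ₗ[ℝ] MvPolynomial (Fin N) ℝ →ₗ[ℝ] ℝ :=
  (basisMonomials (Fin N) ℝ).constr ℝ fun a => (∏ i, ((a i).factorial : ℝ)) • lcoeff ℝ a

theorem fischer_monomial (a : Fin N →₀ ℕ) (q : MvPolynomial (Fin N) ℝ) :
    fischer (monomial a 1) q = (∏ i, ((a i).factorial : ℝ)) * MvPolynomial.coeff a q := by
  have := (basisMonomials (Fin N) ℝ).constr_basis ℝ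
    (fun a => (∏ i, ((a i).factorial : ℝ)) • lcoeff ℝ a) a
  rw [coe_basisMonomials] at this
  rw [fischer, this]
  simp

/-- On monomials, the factor $a_i+1$ by which the factorial weight grows is exactly the factor
produced by differentiation. -/
theorem fischer_X_mul (i : Fin N) (p q : MvPolynomial (Fin N) ℝ) :
    fischer (X i * p) q = fischer p (pderiv i q) := by
  have key : fischer ∘ₗ LinearMap.mulLeft ℝ (X i : MvPolynomial (Fin N) ℝ)
      = (LinearMap.lcomp ℝ ℝ (pderiv i).toLinearMap) ∘ₗ fischer := by
    refine (basisMonomials (Fin N) ℝ).ext fun a => ?_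
    refine LinearMap.ext fun q => ?_
    simp only [coe_basisMonomials, LinearMap.comp_apply, LinearMap.mulLeft_apply,
      LinearMap.lcomp_apply, Derivation.coeFn_coe]
    rw [X, monomial_mul, one_mul, fischer_monomial, fischer_monomial, coeff_pderiv, add_comm a]
    have : ∏ j, (((Finsupp.single i 1 + a : Fin N →₀ ℕ) j).factorial : ℝ)
        = (a i + 1) * ∏ j, ((a j).factorial : ℝ) := by
      rw [← Finset.mul_prod_erase _ _ (Finset.mem_univ i),
        ← Finset.mul_prod_erase (a := i) Finset.univ (fun j => ((a j).factorial : ℝ))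
          (Finset.mem_univ i), ← mul_assoc]
      congr 1
      · simp [add_comm 1, Nat.factorial_succ]
      · refine Finset.prod_congr rfl fun j hj => ?_
        simp [(Finset.ne_of_mem_erase hj).symm]
    rw [this]
    ring
  have := LinearMap.congr_fun (LinearMap.congr_fun key p) q
  simpa using this

theorem fischer_normSq_mul (p q : MvPolynomial (Fin N) ℝ) :
    fischer (normSqPoly N * p) q = fischer p (lap q) := by
  rw [normSqPoly, Finset.sum_mul, map_sum, LinearMap.sum_apply, lap_apply, map_sum]
  refine Finset.sum_congr rfl fun i _ => ?_
  rw [pow_two, mul_assoc, fischer_X_mul, fischer_X_mul]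

/-- Monomials are orthogonal with positive square norms $\prod_i a_i!$, so the self-product is a
positively weighted sum of squares of coefficients. -/
theorem eq_zero_of_fischer_self {p : MvPolynomial (Fin N) ℝ} (h : fischer p p = 0) : p = 0 := by
  have e : ∀ q : MvPolynomial (Fin N) ℝ,
      fischer p q = ∑ a ∈ p.support, MvPolynomial.coeff a p * ((∏ i, ((a i).factorial : ℝ)) * MvPolynomial.coeff a q) := by
    intro q
    conv_lhs => rw [p.as_sum]
    rw [map_sum, LinearMap.sum_apply]
    refine Finset.sum_congr rfl fun a _ => ?_
    rw [← fischer_monomial, ← smul_eq_mul, ← LinearMap.smul_apply, ← map_smul, smul_monomial,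
      smul_eq_mul, mul_one]
  rw [e, Finset.sum_eq_zero_iff_of_nonneg] at h
  · ext a
    by_contra hne
    have hmem : a ∈ p.support := mem_support_iff.2 hne
    have hz := h a hmem
    have hpos : 0 < ∏ i, ((a i).factorial : ℝ) :=
      Finset.prod_pos fun i _ => by exact_mod_cast Nat.factorial_pos _
    simp only [mul_eq_zero, hpos.ne', false_or] at hz
    exact hne (by simpa using hz)
  · intro a _
    have hpos : 0 < ∏ i, ((a i).factorial : ℝ) :=
      Finset.prod_pos fun i _ => by exact_mod_cast Nat.factorial_pos _
    have := mul_self_nonneg (MvPolynomial.coeff a p)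
    have := mul_nonneg hpos.le this
    linarith

/-- Harmonic homogeneous polynomials of degree `k`. -/
noncomputable def harmonicSubmodule (N k : ℕ) : Submodule ℝ (MvPolynomial (Fin N) ℝ) :=
  homogeneousSubmodule (Fin N) ℝ k ⊓ LinearMap.ker lap

instance (k : ℕ) : FiniteDimensional ℝ (homogeneousSubmodule (Fin N) ℝ k) :=
  Module.Finite.iff_fg.2 (homogeneousSubmodule_fg _ _ k)

instance (k : ℕ) : FiniteDimensional ℝ (harmonicSubmodule N k) :=
  Submodule.finiteDimensional_inf_left _ _

/-- The Laplacian between spaces of homogeneous polynomials. -/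
noncomputable def lapHom (N k : ℕ) :
    homogeneousSubmodule (Fin N) ℝ (k + 2) →ₗ[ℝ] homogeneousSubmodule (Fin N) ℝ k :=
  lap.restrict fun _ hp => isHomogeneous_lap hp

/-- Multiplication by `|x|²` between spaces of homogeneous polynomials. -/
noncomputable def normSqHom (N k : ℕ) :
    homogeneousSubmodule (Fin N) ℝ k →ₗ[ℝ] homogeneousSubmodule (Fin N) ℝ (k + 2) :=
  (LinearMap.mulLeft ℝ (normSqPoly N)).restrict fun p hp => by
    have : (normSqPoly N * p).IsHomogeneous (2 + k) := isHomogeneous_normSqPoly.mul hp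
    rwa [add_comm] at this

theorem normSqPoly_ne_zero (hN : 0 < N) : normSqPoly N ≠ 0 := by
  intro h
  have := congrArg (eval fun _ => (1 : ℝ)) h
  simp [normSqPoly] at this
  omega

/-- If $\Delta(|x|^2p)=0$, then $\langle |x|^2p,|x|^2p\rangle=\langle p,\Delta(|x|^2p)\rangle=0$,
whence $p=0$. An injective endomorphism in finite dimension is bijective; this yields both the
surjectivity of $\Delta$ and the decomposition into a harmonic part and a multiple of $|x|^2$. -/
theorem lapHom_comp_normSqHom_bijective (hN : 0 < N) (k : ℕ) :
    Function.Bijective (lapHom N k ∘ₗ normSqHom N k) := by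
  have hinj : Function.Injective (lapHom N k ∘ₗ normSqHom N k) := by
    rw [← LinearMap.ker_eq_bot, LinearMap.ker_eq_bot']
    intro p hp
    have h1 : lap (normSqPoly N * p.1) = 0 := congrArg Subtype.val hp
    have h2 : fischer (normSqPoly N * p.1) (normSqPoly N * p.1) = 0 := by
      rw [fischer_normSq_mul, h1, map_zero]
    have h3 := eq_zero_of_fischer_self h2
    exact Subtype.ext ((mul_eq_zero.1 h3).resolve_left (normSqPoly_ne_zero hN))
  exact ⟨hinj, LinearMap.surjective_of_injective hinj⟩

/-- Every homogeneous polynomial is the sum of a harmonic one and a multiple of `|x|²`. -/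
theorem exists_harmonic_add (hN : 0 < N) {k : ℕ} {p : MvPolynomial (Fin N) ℝ}
    (hp : p.IsHomogeneous (k + 2)) :
    ∃ h ∈ harmonicSubmodule N (k + 2), ∃ q : MvPolynomial (Fin N) ℝ, q.IsHomogeneous k ∧
      p = h + normSqPoly N * q := by
  obtain ⟨q, hq⟩ := (lapHom_comp_normSqHom_bijective hN k).2 (lapHom N k ⟨p, hp⟩)
  have hq' : lap (normSqPoly N * q.1) = lap p := congrArg Subtype.val hq
  refine ⟨p - normSqPoly N * q.1, ⟨?_, ?_⟩, q.1, q.2, by ring⟩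
  · exact sub_mem (show p ∈ homogeneousSubmodule (Fin N) ℝ (k + 2) from hp) (normSqHom N k q).2
  · simp [hq']

theorem harmonicSubmodule_eq_homogeneous {k : ℕ} (hk : k < 2) :
    harmonicSubmodule N k = homogeneousSubmodule (Fin N) ℝ k := by
  refine inf_eq_left.2 fun p hp => ?_
  have hp' : p.IsHomogeneous k := hp
  rw [LinearMap.mem_ker, lap_apply]
  refine Finset.sum_eq_zero fun i _ => ?_
  have h1 : (pderiv i p).IsHomogeneous 0 := by
    have := hp'.pderiv (i := i)
    rwa [show k - 1 = 0 by omega] at this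
  rw [← totalDegree_zero_iff_isHomogeneous, totalDegree_eq_zero_iff_eq_C] at h1
  rw [h1, pderiv_C]

theorem finrank_homogeneousSubmodule (N k : ℕ) :
    Module.finrank ℝ (homogeneousSubmodule (Fin N) ℝ k) = (N + k - 1).choose k := by
  rw [homogeneousSubmodule_eq_finsupp_supported,
    (AddMonoidAlgebra.supportedEquivFinsupp (R := ℝ) (S := ℝ) _).finrank_eq]
  have hset : {d : Fin N →₀ ℕ | d.degree = k} =
      ((Finset.univ.finsuppAntidiag k : Finset (Fin N →₀ ℕ)) : Set (Fin N →₀ ℕ)) := by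
    ext d
    simp [Finset.mem_finsuppAntidiag, Finsupp.degree_eq_sum]
  rw [hset, Module.finrank_finsupp_self]
  simp [Finset.card_finsuppAntidiag_nat_eq_choose]

/-- Rank–nullity for the surjective Laplacian from degree $k+2$ to degree $k$, written as an
addition to avoid truncated subtraction of the two binomials. -/
theorem finrank_harmonicSubmodule_add (hN : 0 < N) (k : ℕ) :
    Module.finrank ℝ (harmonicSubmodule N (k + 2)) + (N + k - 1).choose k
      = (N + (k + 2) - 1).choose (k + 2) := by
  rw [← finrank_homogeneousSubmodule, ← finrank_homogeneousSubmodule,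
    ← LinearMap.finrank_range_add_finrank_ker (lapHom N k), add_comm]
  have hs : Function.Surjective (lapHom N k) :=
    Function.Surjective.of_comp (g := normSqHom N k) (lapHom_comp_normSqHom_bijective hN k).2
  rw [LinearMap.range_eq_top.2 hs, finrank_top]
  congr 1
  have e : harmonicSubmodule N (k + 2) = (LinearMap.ker (lapHom N k)).map
      (homogeneousSubmodule (Fin N) ℝ (k + 2)).subtype := by
    ext p
    simp only [harmonicSubmodule, Submodule.mem_inf, LinearMap.mem_ker, Submodule.mem_map,
      Submodule.subtype_apply, Subtype.exists, exists_and_right, exists_eq_right]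
    refine ⟨fun h => ⟨h.1, Subtype.ext h.2⟩, fun ⟨h1, h2⟩ => ⟨h1, congrArg Subtype.val h2⟩⟩
  rw [e]
  exact (Submodule.equivMapOfInjective _ (Submodule.injective_subtype _) _).finrank_eq.symm

/-- The dimension of the space of harmonic homogeneous polynomials. -/
theorem finrank_harmonicSubmodule (hN : 3 ≤ N) (k : ℕ) :
    (Module.finrank ℝ (harmonicSubmodule N k) : ℝ) = multiplicity N k := by
  obtain ⟨n, rfl⟩ := Nat.exists_eq_add_of_le' hN
  rcases k with _ | _ | k
  · rw [harmonicSubmodule_eq_homogeneous (by norm_num), finrank_homogeneousSubmodule]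
    have : ((n + 1).factorial : ℝ) = (n + 1) * n.factorial := by
      rw [Nat.factorial_succ]; push_cast; ring
    have h0 : (n.factorial : ℝ) ≠ 0 := by exact_mod_cast n.factorial_ne_zero
    have h1 : (n : ℝ) + 1 ≠ 0 := by positivity
    simp only [multiplicity, show n + 3 + 0 - 3 = n by omega, show n + 3 - 2 = n + 1 by omega, this]
    simp
    field_simp
    ring_nf
  · rw [harmonicSubmodule_eq_homogeneous (by norm_num), finrank_homogeneousSubmodule]
    have h0 : ((n + 1).factorial : ℝ) ≠ 0 := by exact_mod_cast (n + 1).factorial_ne_zero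
    simp only [multiplicity, show n + 3 + (0 + 1) - 3 = n + 1 by omega,
      show n + 3 - 2 = n + 1 by omega]
    simp
    field_simp
  · have h := finrank_harmonicSubmodule_add (N := n + 3) (by omega) k
    have h' : (Module.finrank ℝ (harmonicSubmodule (n + 3) (k + 2)) : ℝ)
        = ((n + k + 4).choose (k + 2) : ℝ) - ((n + k + 2).choose k : ℝ) := by
      rw [eq_sub_iff_add_eq]
      have e1 : n + 3 + k - 1 = n + k + 2 := by omega
      have e2 : n + 3 + (k + 2) - 1 = n + k + 4 := by omega
      rw [e1, e2] at h
      exact_mod_cast h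
    rw [h', Nat.cast_choose ℝ (show k + 2 ≤ n + k + 4 by omega),
      Nat.cast_choose ℝ (show k ≤ n + k + 2 by omega)]
    simp only [multiplicity, show n + 3 + (k + 1 + 1) - 3 = n + k + 2 by omega,
      show n + 3 - 2 = n + 1 by omega, show n + k + 4 - (k + 2) = n + 2 by omega,
      show n + k + 2 - k = n + 2 by omega]
    have f1 : ((n + k + 4).factorial : ℝ) = (n + k + 4) * ((n + k + 3) * (n + k + 2).factorial) := by
      rw [Nat.factorial_succ, Nat.factorial_succ]; push_cast; ring
    have f2 : ((k + 1 + 1).factorial : ℝ) = (k + 2) * ((k + 1) * k.factorial) := by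
      rw [Nat.factorial_succ, Nat.factorial_succ]; push_cast; ring
    have f3 : ((n + 2).factorial : ℝ) = (n + 2) * (n + 1).factorial := by
      rw [Nat.factorial_succ]; push_cast; ring
    rw [f1, show k + 2 = k + 1 + 1 from rfl, f2, f3]
    have g1 : (k.factorial : ℝ) ≠ 0 := by exact_mod_cast k.factorial_ne_zero
    have g2 : ((n + 1).factorial : ℝ) ≠ 0 := by exact_mod_cast (n + 1).factorial_ne_zero
    have g3 : ((n + k + 2).factorial : ℝ) ≠ 0 := by exact_mod_cast (n + k + 2).factorial_ne_zero
    have g4 : (n : ℝ) + 2 ≠ 0 := by positivity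
    have g5 : (k : ℝ) + 2 ≠ 0 := by positivity
    have g6 : (k : ℝ) + 1 ≠ 0 := by positivity
    push_cast
    field_simp
    ring

/-! ### The Casimir operator, and polynomials as functions -/

/-- The rotational derivative of polynomials. -/
noncomputable def rotPoly (i j : Fin N) (p : MvPolynomial (Fin N) ℝ) : MvPolynomial (Fin N) ℝ :=
  X i * pderiv j p - X j * pderiv i p

/-- The Casimir operator acts on harmonic homogeneous polynomials by a scalar. -/
theorem sum_rotPoly_rotPoly {k : ℕ} {p : MvPolynomial (Fin N) ℝ}
    (hp : p ∈ harmonicSubmodule N k) :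
    ∑ i, ∑ j, rotPoly i j (rotPoly i j p) = C (-2 * (k * (k + (N - 2)) : ℝ)) * p := by
  -- Euler's identity. Applied twice it gives the second-order identity with constant $k^2-k$ below;
  -- together with harmonicity these evaluate every sum that occurs.
  have hE : ∑ i : Fin N, X i * pderiv i p = C (k : ℝ) * p := by
    have := IsHomogeneous.sum_X_mul_pderiv (φ := p) (n := k) hp.1
    rw [this, nsmul_eq_mul]; simp
  have hL : ∑ i : Fin N, pderiv i (pderiv i p) = 0 := by
    rw [← lap_apply]; exact hp.2
  have hEE : ∑ i : Fin N, ∑ j : Fin N, X i * (X j * pderiv i (pderiv j p))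
      = C ((k : ℝ) * k - k) * p := by
    have h1 : ∀ i : Fin N, X i * pderiv i (∑ j : Fin N, X j * pderiv j p)
        = X i * pderiv i p + ∑ j : Fin N, X i * (X j * pderiv i (pderiv j p)) := by
      intro i
      rw [map_sum, Finset.mul_sum]
      simp only [Derivation.leibniz, smul_eq_mul, pderiv_X, mul_add, Finset.sum_add_distrib]
      rw [add_comm]
      congr 1
      rw [Finset.sum_eq_single i]
      · simp
      · intro j _ hj; simp [hj]
      · simp
    have h2 : ∑ i : Fin N, X i * pderiv i (∑ j : Fin N, X j * pderiv j p)
        = C (k : ℝ) * (C (k : ℝ) * p) := by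
      rw [hE, ← hE, Finset.mul_sum]
      refine Finset.sum_congr rfl fun i _ => ?_
      rw [hE, Derivation.leibniz]
      simp
      ring
    simp_rw [h1] at h2
    rw [Finset.sum_add_distrib, hE] at h2
    rw [map_sub, map_mul]
    linear_combination h2
  -- The last summand corrects the diagonal, where the rotation field is zero. The sum runs over
  -- ordered pairs, so each coordinate plane counts twice; hence the factor $2$ in the eigenvalue.
  have hexp : ∀ i j : Fin N, rotPoly i j (rotPoly i j p) =
      X i ^ 2 * pderiv j (pderiv j p) + X j ^ 2 * pderiv i (pderiv i p)
        - X i * pderiv i p - X j * pderiv j p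
        - X i * (X j * pderiv i (pderiv j p)) - X i * (X j * pderiv i (pderiv j p))
        + (if i = j then 2 * (X i * pderiv i p) else 0) := by
    intro i j
    simp only [rotPoly, map_sub, Derivation.leibniz, smul_eq_mul, pderiv_X, Pi.single_apply]
    rw [pderiv_comm j i]
    by_cases hij : i = j
    · subst hij; simp; ring
    · simp [hij, Ne.symm hij]; ring
  simp_rw [hexp, Finset.sum_add_distrib, Finset.sum_sub_distrib, Finset.sum_add_distrib, hEE]
  simp only [Finset.sum_ite_eq, Finset.mem_univ, if_true]
  have e1 : ∑ i : Fin N, ∑ j : Fin N, X i ^ 2 * pderiv j (pderiv j p) = 0 := by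
    simp_rw [← Finset.mul_sum, hL]; simp
  have e2 : ∑ i : Fin N, ∑ j : Fin N, X j ^ 2 * pderiv i (pderiv i p) = 0 := by
    rw [Finset.sum_comm]; exact e1
  have e3 : ∑ i : Fin N, ∑ _j : Fin N, X i * pderiv i p = C (N : ℝ) * (C (k : ℝ) * p) := by
    rw [Finset.sum_comm, hE]; simp
  have e4 : ∑ _i : Fin N, ∑ j : Fin N, X j * pderiv j p = C (N : ℝ) * (C (k : ℝ) * p) := by
    rw [hE]; simp
  rw [e1, e2, e3, e4, ← Finset.mul_sum, hE]
  simp only [map_sub, map_mul, map_add, map_neg]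
  have : (C (2 : ℝ) : MvPolynomial (Fin N) ℝ) = 2 := map_ofNat C 2
  rw [this]
  ring

/-- A polynomial as a function on `ℝ^N`. -/
noncomputable def pfun (p : MvPolynomial (Fin N) ℝ) (x : Space N) : ℝ := eval (fun i => x i) p

theorem pfun_add (p q : MvPolynomial (Fin N) ℝ) (x : Space N) :
    pfun (p + q) x = pfun p x + pfun q x := by simp [pfun]

theorem pfun_mul (p q : MvPolynomial (Fin N) ℝ) (x : Space N) :
    pfun (p * q) x = pfun p x * pfun q x := by simp [pfun]

theorem pfun_C (c : ℝ) (x : Space N) : pfun (C c : MvPolynomial (Fin N) ℝ) x = c := by simp [pfun]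

theorem pfun_sum {ι : Type*} (s : Finset ι) (f : ι → MvPolynomial (Fin N) ℝ) (x : Space N) :
    pfun (∑ a ∈ s, f a) x = ∑ a ∈ s, pfun (f a) x := by simp [pfun]

theorem hasFDerivAt_pfun (p : MvPolynomial (Fin N) ℝ) (x : Space N) :
    HasFDerivAt (pfun p) (∑ i, pfun (pderiv i p) x • (EuclideanSpace.proj i : Space N →L[ℝ] ℝ)) x := by
  induction p using MvPolynomial.induction_on with
  | C a =>
    have : (pfun (C a) : Space N → ℝ) = fun _ => a := by funext y; simp [pfun]
    rw [this]
    refine (hasFDerivAt_const a x).congr_fderiv ?_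
    simp [pfun]
  | add p q hp hq =>
    have : (pfun (p + q) : Space N → ℝ) = fun y => pfun p y + pfun q y :=
      by funext y; simp [pfun]
    rw [this]
    refine (hp.fun_add hq).congr_fderiv ?_
    simp only [map_add, pfun_add, add_smul, Finset.sum_add_distrib]
  | mul_X p j hp =>
    have : (pfun (p * X j) : Space N → ℝ) = fun y => pfun p y * y j := by
      funext y; simp [pfun]
    rw [this]
    have hj : HasFDerivAt (fun y : Space N => y j) (EuclideanSpace.proj j : Space N →L[ℝ] ℝ) x :=
      (EuclideanSpace.proj j : Space N →L[ℝ] ℝ).hasFDerivAt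
    refine (hp.fun_mul hj).congr_fderiv ?_
    simp only [Derivation.leibniz, smul_eq_mul, pderiv_X, pfun_add, pfun_mul, add_smul,
      Finset.sum_add_distrib]
    congr 1
    · rw [Finset.sum_eq_single j]
      · simp [pfun]
      · intro i _ hi; simp [Ne.symm hi, pfun]
      · simp
    · rw [Finset.smul_sum]
      refine Finset.sum_congr rfl fun i _ => ?_
      rw [smul_smul]; simp [pfun]

theorem contDiff_pfun (p : MvPolynomial (Fin N) ℝ) : ContDiff ℝ ∞ (pfun p) := by
  induction p using MvPolynomial.induction_on with
  | C a =>
    have : (pfun (C a) : Space N → ℝ) = fun _ => a := by funext y; simp [pfun]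
    rw [this]; exact contDiff_const
  | add p q hp hq =>
    have : (pfun (p + q) : Space N → ℝ) = fun y => pfun p y + pfun q y :=
      by funext y; simp [pfun]
    rw [this]; exact ContDiff.add hp hq
  | mul_X p j hp =>
    have : (pfun (p * X j) : Space N → ℝ) = fun y => pfun p y * y j := by
      funext y; simp [pfun]
    rw [this]
    exact hp.mul (EuclideanSpace.proj j : Space N →L[ℝ] ℝ).contDiff

theorem fderiv_pfun_rot (i j : Fin N) (p : MvPolynomial (Fin N) ℝ) (x : Space N) :
    fderiv ℝ (pfun p) x (rot i j x) = pfun (rotPoly i j p) x := by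
  have hs : ∀ l : Fin N, ∑ a, pfun (pderiv a p) x * (if a = l then 1 else 0) = pfun (pderiv l p) x := by
    intro l; simp
  rw [(hasFDerivAt_pfun p x).fderiv]
  simp only [rot, map_sub, map_smul, smul_eq_mul, sum_apply, smul_apply, PiLp.proj_apply,
    PiLp.single_apply, hs]
  simp [rotPoly, pfun]

theorem pfun_smul_of_isHomogeneous {k : ℕ} {p : MvPolynomial (Fin N) ℝ} (hp : p.IsHomogeneous k)
    (c : ℝ) (x : Space N) : pfun p (c • x) = c ^ k * pfun p x := by
  simp only [pfun, MvPolynomial.eval_eq']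
  rw [Finset.mul_sum]
  refine Finset.sum_congr rfl fun d hd => ?_
  have hdeg : ∑ i, d i = k := by
    have := hp (mem_support_iff.1 hd)
    rw [Finsupp.weight_apply, Finsupp.sum_fintype _ _ (by simp)] at this
    simpa using this
  simp only [PiLp.smul_apply, smul_eq_mul, mul_pow, Finset.prod_mul_distrib,
    Finset.prod_pow_eq_pow_sum, hdeg]
  ring

theorem eq_zero_of_pfun_eq_zero {p : MvPolynomial (Fin N) ℝ} (h : ∀ x : Space N, pfun p x = 0) :
    p = 0 := by
  refine MvPolynomial.funext fun v => ?_
  have := h (WithLp.toLp 2 v)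
  simpa [pfun] using this

end Polynomials

end Henon

/-! ### Spherical harmonics and the spectral gap of the sphere -/

namespace Henon

variable {N : ℕ}

/-- The scalar product of `L²` of the unit sphere. -/
noncomputable def sphInner (f g : Space N → ℝ) : ℝ := ∫ θ : Sph N, f θ * g θ ∂(sphMeasure N)

/-- Twice the Dirichlet form of the unit sphere. -/
noncomputable def sphDirichlet (f g : Space N → ℝ) : ℝ :=
  ∫ θ : Sph N, ∑ i, ∑ j, fderiv ℝ f θ (rot i j (θ : Space N)) * fderiv ℝ g θ (rot i j (θ : Space N))
    ∂(sphMeasure N)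

/-- The eigenvalue of the Laplacian of the sphere on harmonics of (real) degree `κ`. -/
noncomputable def sphEigenvalue (N : ℕ) (κ : ℝ) : ℝ := κ * (κ + ((N : ℝ) - 2))

theorem sphEigenvalue_strictMonoOn (hN : 3 ≤ N) : StrictMonoOn (sphEigenvalue N) (Set.Ici 0) := by
  intro a ha b _ hab
  have h3 : (3 : ℝ) ≤ N := by exact_mod_cast hN
  have ha' : 0 ≤ a := ha
  unfold sphEigenvalue
  nlinarith

theorem sphEigenvalue_nonneg (hN : 3 ≤ N) {κ : ℝ} (hκ : 0 ≤ κ) : 0 ≤ sphEigenvalue N κ := by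
  have h3 : (3 : ℝ) ≤ N := by exact_mod_cast hN
  unfold sphEigenvalue
  exact mul_nonneg hκ (by linarith)

theorem continuous_rot (i j : Fin N) : Continuous (rot i j : Space N → Space N) := by
  unfold rot; fun_prop

theorem integrable_sphere {f : Space N → ℝ} (hf : Continuous f) :
    Integrable (fun θ : Sph N => f θ) (sphMeasure N) :=
  (hf.comp continuous_subtype_val).integrable_of_hasCompactSupport
    (HasCompactSupport.of_compactSpace _)

theorem continuous_fderiv_rot {f : Space N → ℝ} (hf : ContDiff ℝ ∞ f) (i j : Fin N) :
    Continuous fun x => fderiv ℝ f x (rot i j x) :=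
  (hf.continuous_fderiv (by simp)).clm_apply (continuous_rot i j)

/-- Green's formula on the sphere, against a harmonic polynomial. -/
theorem sphDirichlet_harmonic (hN : 0 < N) {f : Space N → ℝ} (hf : ContDiff ℝ ∞ f) {k : ℕ}
    {p : MvPolynomial (Fin N) ℝ} (hp : p ∈ harmonicSubmodule N k) :
    sphDirichlet f (pfun p) = 2 * sphEigenvalue N k * sphInner f (pfun p) := by
  have h1 : ∀ i j : Fin N, ∫ θ : Sph N, (fderiv ℝ f θ (rot i j (θ : Space N)) *
      fderiv ℝ (pfun p) θ (rot i j (θ : Space N)) + f θ * pfun (rotPoly i j (rotPoly i j p)) θ)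
      ∂(sphMeasure N) = 0 := by
    intro i j
    have := integral_sphere_fderiv_rot hN i j (hf.mul (contDiff_pfun (rotPoly i j p)))
    rw [← this]
    refine integral_congr_ae (Eventually.of_forall fun θ => ?_)
    have hm := ((hf.differentiable (by simp)) (θ : Space N)).hasFDerivAt.fun_mul
      (((contDiff_pfun (rotPoly i j p)).differentiable (by simp)) (θ : Space N)).hasFDerivAt
    simp only
    rw [hm.fderiv]
    simp only [add_apply, smul_apply, smul_eq_mul, fderiv_pfun_rot]
    ring
  have hc1 : ∀ i j : Fin N, Integrable (fun θ : Sph N => fderiv ℝ f θ (rot i j (θ : Space N)) *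
      fderiv ℝ (pfun p) θ (rot i j (θ : Space N))) (sphMeasure N) := fun i j =>
    integrable_sphere ((continuous_fderiv_rot hf i j).mul (continuous_fderiv_rot (contDiff_pfun p) i j))
  have hc2 : ∀ i j : Fin N, Integrable (fun θ : Sph N =>
      f θ * pfun (rotPoly i j (rotPoly i j p)) θ) (sphMeasure N) := fun i j =>
    integrable_sphere (hf.continuous.mul (contDiff_pfun _).continuous)
  have h2 : sphDirichlet f (pfun p) =
      - ∑ i, ∑ j, ∫ θ : Sph N, f θ * pfun (rotPoly i j (rotPoly i j p)) θ ∂(sphMeasure N) := by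
    rw [sphDirichlet, integral_finsetSum _ fun i _ => integrable_finsetSum _ fun j _ => hc1 i j,
      ← Finset.sum_neg_distrib]
    refine Finset.sum_congr rfl fun i _ => ?_
    rw [integral_finsetSum _ fun j _ => hc1 i j, ← Finset.sum_neg_distrib]
    refine Finset.sum_congr rfl fun j _ => ?_
    have := h1 i j
    rw [integral_add (hc1 i j) (hc2 i j)] at this
    linarith
  have h3 : ∑ i, ∑ j, ∫ θ : Sph N, f θ * pfun (rotPoly i j (rotPoly i j p)) θ ∂(sphMeasure N)
      = ∫ θ : Sph N, f θ * pfun (∑ i, ∑ j, rotPoly i j (rotPoly i j p)) θ ∂(sphMeasure N) := by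
    simp_rw [pfun_sum, Finset.mul_sum]
    rw [integral_finsetSum _ fun i _ => integrable_finsetSum _ fun j _ => hc2 i j]
    refine Finset.sum_congr rfl fun i _ => ?_
    rw [integral_finsetSum _ fun j _ => hc2 i j]
  rw [h2, h3, sum_rotPoly_rotPoly hp, sphInner, ← integral_const_mul, ← integral_neg]
  refine integral_congr_ae (Eventually.of_forall fun θ => ?_)
  simp only [pfun_mul, pfun_C, sphEigenvalue]
  ring

theorem sphInner_comm (f g : Space N → ℝ) : sphInner f g = sphInner g f := by
  simp only [sphInner, mul_comm]

theorem sphDirichlet_comm (f g : Space N → ℝ) : sphDirichlet f g = sphDirichlet g f := by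
  simp only [sphDirichlet, mul_comm]

/-- The Dirichlet form is symmetric, so Green's formula used in either argument forces orthogonality
for different eigenvalues. -/
theorem sphInner_harmonic_of_ne (hN : 3 ≤ N) {j k : ℕ} (hjk : j ≠ k)
    {p q : MvPolynomial (Fin N) ℝ} (hp : p ∈ harmonicSubmodule N j)
    (hq : q ∈ harmonicSubmodule N k) : sphInner (pfun p) (pfun q) = 0 := by
  have h1 := sphDirichlet_harmonic (by omega) (contDiff_pfun p) hq
  have h2 := sphDirichlet_harmonic (by omega) (contDiff_pfun q) hp
  rw [sphDirichlet_comm, h1, sphInner_comm (pfun q)] at h2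
  have h3 : sphEigenvalue N j ≠ sphEigenvalue N k := fun h =>
    hjk (Nat.cast_injective (R := ℝ) ((sphEigenvalue_strictMonoOn hN).injOn
      (Set.mem_Ici.2 (Nat.cast_nonneg j)) (Set.mem_Ici.2 (Nat.cast_nonneg k)) h))
  have h4 : (sphEigenvalue N k - sphEigenvalue N j) * sphInner (pfun p) (pfun q) = 0 := by linarith
  exact (mul_eq_zero.1 h4).resolve_left (sub_ne_zero.2 h3.symm)

/-- Restriction to the sphere as an algebra morphism. -/
noncomputable def sphPoly (N : ℕ) : MvPolynomial (Fin N) ℝ →ₐ[ℝ] C(Sph N, ℝ) :=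
  MvPolynomial.aeval fun i => ⟨fun θ => (θ : Space N) i, by fun_prop⟩

theorem sphPoly_apply (p : MvPolynomial (Fin N) ℝ) (θ : Sph N) : sphPoly N p θ = pfun p θ := by
  induction p using MvPolynomial.induction_on with
  | C a => simp [sphPoly, pfun]
  | add p q hp hq => rw [map_add, ContinuousMap.add_apply, hp, hq, pfun_add]
  | mul_X p j hp => rw [map_mul, ContinuousMap.mul_apply, hp, pfun_mul]; simp [sphPoly, pfun]

/-- A continuous function on `ℝ^N` as an element of `L²` of the sphere. -/
noncomputable def sphLp (f : C(Sph N, ℝ)) : Lp ℝ 2 (sphMeasure N) :=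
  ContinuousMap.toLp 2 (sphMeasure N) ℝ f

/-- A polynomial as an element of `L²` of the sphere. -/
noncomputable def polyLp (N : ℕ) : MvPolynomial (Fin N) ℝ →ₗ[ℝ] Lp ℝ 2 (sphMeasure N) :=
  (ContinuousMap.toLp 2 (sphMeasure N) ℝ).toLinearMap ∘ₗ (sphPoly N).toLinearMap

/-- The restriction of a continuous function to the sphere. -/
def sphRestrict (f : Space N → ℝ) (hf : Continuous f) : C(Sph N, ℝ) :=
  ⟨fun θ => f θ, hf.comp continuous_subtype_val⟩

theorem polyLp_eq (p : MvPolynomial (Fin N) ℝ) :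
    polyLp N p = sphLp (sphRestrict (pfun p) (contDiff_pfun p).continuous) := by
  have : sphPoly N p = sphRestrict (pfun p) (contDiff_pfun p).continuous := by
    ext θ; exact sphPoly_apply p θ
  simp [polyLp, sphLp, this]

theorem inner_sphLp {f g : Space N → ℝ} (hf : Continuous f) (hg : Continuous g) :
    inner ℝ (sphLp (sphRestrict f hf)) (sphLp (sphRestrict g hg)) = sphInner f g := by
  rw [sphLp, sphLp, ContinuousMap.inner_toLp, sphInner]
  simp [sphRestrict, mul_comm]

/-- Spherical harmonics of degree less than `n`. -/
noncomputable def sphHarmonics (N n : ℕ) : Submodule ℝ (Lp ℝ 2 (sphMeasure N)) :=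
  ⨆ j ∈ Finset.range n, (harmonicSubmodule N j).map (polyLp N)

theorem sphHarmonics_zero : sphHarmonics N 0 = ⊥ := by
  simp [sphHarmonics]

theorem sphHarmonics_succ (n : ℕ) : sphHarmonics N (n + 1) =
    (harmonicSubmodule N n).map (polyLp N) ⊔ sphHarmonics N n := by
  rw [sphHarmonics, Finset.range_add_one, Finset.iSup_insert]; rfl

theorem sphHarmonics_mono : Monotone (sphHarmonics N) :=
  monotone_nat_of_le_succ fun n => by rw [sphHarmonics_succ]; exact le_sup_right

instance finiteDimensional_sphHarmonics (n : ℕ) : FiniteDimensional ℝ (sphHarmonics N n) := by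
  induction n with
  | zero => rw [sphHarmonics_zero]; infer_instance
  | succ n ih => rw [sphHarmonics_succ]; infer_instance

theorem finrank_sphHarmonics_le (n : ℕ) : Module.finrank ℝ (sphHarmonics N n) ≤
    ∑ j ∈ Finset.range n, Module.finrank ℝ (harmonicSubmodule N j) := by
  induction n with
  | zero => rw [sphHarmonics_zero, finrank_bot]; exact Nat.zero_le _
  | succ n ih =>
    rw [sphHarmonics_succ, Finset.sum_range_succ, add_comm]
    exact (Submodule.finrank_add_le_finrank_add_finrank _ _).trans
      (add_le_add (Submodule.finrank_map_le _ _) ih)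

theorem mem_sphHarmonics {n : ℕ} {x : Lp ℝ 2 (sphMeasure N)} (hx : x ∈ sphHarmonics N n) :
    ∃ Y : ℕ → MvPolynomial (Fin N) ℝ, (∀ j, Y j ∈ harmonicSubmodule N j) ∧
      x = polyLp N (∑ j ∈ Finset.range n, Y j) := by
  obtain ⟨μ, hμ⟩ := (Submodule.mem_iSup_finset_iff_exists_sum _ _).1 hx
  choose Y hY1 hY2 using fun j => (μ j).2
  refine ⟨Y, hY1, ?_⟩
  rw [← hμ, map_sum]
  exact Finset.sum_congr rfl fun j _ => (hY2 j).symm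

theorem polyLp_mem_sphHarmonics {n j : ℕ} (hj : j < n) {p : MvPolynomial (Fin N) ℝ}
    (hp : p ∈ harmonicSubmodule N j) : polyLp N p ∈ sphHarmonics N n :=
  Submodule.mem_iSup_of_mem j (Submodule.mem_iSup_of_mem (Finset.mem_range.2 hj)
    (Submodule.mem_map_of_mem hp))

theorem pfun_normSqPoly (x : Space N) : pfun (normSqPoly N) x = ‖x‖ ^ 2 := by
  rw [EuclideanSpace.norm_sq_eq]
  simp [pfun, normSqPoly]

theorem polyLp_normSq_mul (q : MvPolynomial (Fin N) ℝ) : polyLp N (normSqPoly N * q) = polyLp N q := by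
  have : sphPoly N (normSqPoly N * q) = sphPoly N q := by
    ext θ
    rw [sphPoly_apply, sphPoly_apply, pfun_mul, pfun_normSqPoly, norm_eq_of_mem_sphere]
    ring
  simp [polyLp, this]

/-- Since $|x|^2=1$ on the sphere, the decomposition $p=h+|x|^2q$ replaces $p$ by a harmonic
polynomial and a polynomial of degree lower by two. -/
theorem polyLp_homogeneous_mem (hN : 0 < N) : ∀ (k : ℕ) {p : MvPolynomial (Fin N) ℝ},
    p.IsHomogeneous k → polyLp N p ∈ sphHarmonics N (k + 1) := by
  intro k
  induction k using Nat.strong_induction_on with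
  | _ k ih =>
    intro p hp
    rcases lt_or_ge k 2 with hk | hk
    · refine polyLp_mem_sphHarmonics (j := k) (by omega) ?_
      rw [harmonicSubmodule_eq_homogeneous hk]; exact hp
    · obtain ⟨l, rfl⟩ := Nat.exists_eq_add_of_le' hk
      obtain ⟨h, hh, q, hq, rfl⟩ := exists_harmonic_add hN hp
      rw [map_add, polyLp_normSq_mul]
      exact add_mem (polyLp_mem_sphHarmonics (by omega) hh)
        (sphHarmonics_mono (by omega) (ih l (by omega) hq))

theorem exists_polyLp_mem (hN : 0 < N) (p : MvPolynomial (Fin N) ℝ) :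
    ∃ n, polyLp N p ∈ sphHarmonics N n := by
  refine ⟨p.totalDegree + 1, ?_⟩
  have hp : polyLp N p = ∑ i ∈ Finset.range (p.totalDegree + 1),
      polyLp N (MvPolynomial.homogeneousComponent i p) := by
    rw [← map_sum, MvPolynomial.sum_homogeneousComponent]
  rw [hp]
  exact sum_mem fun k hk => sphHarmonics_mono (Finset.mem_range.1 hk)
    (polyLp_homogeneous_mem hN k (MvPolynomial.homogeneousComponent_isHomogeneous k p))

/-- Spherical harmonics are dense in the continuous functions, with respect to the `L²` norm. -/
theorem exists_sphHarmonics_near (hN : 0 < N) (f : C(Sph N, ℝ)) {ε : ℝ} (hε : 0 < ε) :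
    ∃ n, ∃ q ∈ sphHarmonics N n, ‖sphLp f - q‖ < ε := by
  have hsep : (sphPoly N).range.SeparatesPoints := by
    intro θ φ hne
    have : ∃ i, (θ : Space N) i ≠ (φ : Space N) i := by
      by_contra! h
      exact hne (Subtype.ext (by ext i; exact h i))
    obtain ⟨i, hi⟩ := this
    refine ⟨_, ⟨sphPoly N (MvPolynomial.X i), ⟨_, rfl⟩, rfl⟩, ?_⟩
    simpa [sphPoly] using hi
  set L := ContinuousMap.toLp (E := ℝ) 2 (sphMeasure N) ℝ with hL
  have hδ : 0 < ε / (‖L‖ + 1) := by positivity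
  obtain ⟨⟨g, p, hg⟩, hgf⟩ := ContinuousMap.exists_mem_subalgebra_near_continuousMap_of_separatesPoints
    (sphPoly N).range hsep f _ hδ
  obtain ⟨n, hn⟩ := exists_polyLp_mem hN p
  refine ⟨n, _, hn, ?_⟩
  have e : sphLp f - polyLp N p = L (f - g) := by
    rw [map_sub, ← hg]; rfl
  rw [e]
  have hnorm : ‖f - g‖ < ε / (‖L‖ + 1) := by rw [norm_sub_rev]; exact hgf
  calc ‖L (f - g)‖ ≤ ‖L‖ * ‖f - g‖ := L.le_opNorm _
    _ ≤ (‖L‖ + 1) * ‖f - g‖ := by gcongr; linarith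
    _ < (‖L‖ + 1) * (ε / (‖L‖ + 1)) := by gcongr
    _ = ε := by field_simp

theorem sphInner_sum_right {ι : Type*} (s : Finset ι) {f : Space N → ℝ} (hf : Continuous f)
    (Y : ι → MvPolynomial (Fin N) ℝ) :
    sphInner f (pfun (∑ j ∈ s, Y j)) = ∑ j ∈ s, sphInner f (pfun (Y j)) := by
  simp only [sphInner, pfun_sum, Finset.mul_sum]
  exact integral_finsetSum _ fun j _ => integrable_sphere (hf.mul (contDiff_pfun _).continuous)

theorem sphDirichlet_sum_right {ι : Type*} (s : Finset ι) {f : Space N → ℝ} (hf : ContDiff ℝ ∞ f)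
    (Y : ι → MvPolynomial (Fin N) ℝ) :
    sphDirichlet f (pfun (∑ j ∈ s, Y j)) = ∑ j ∈ s, sphDirichlet f (pfun (Y j)) := by
  simp only [sphDirichlet]
  rw [← integral_finsetSum]
  · refine integral_congr_ae (Eventually.of_forall fun θ => ?_)
    simp only [fderiv_pfun_rot]
    conv_rhs => rw [Finset.sum_comm]
    refine Finset.sum_congr rfl fun i _ => ?_
    conv_rhs => rw [Finset.sum_comm]
    refine Finset.sum_congr rfl fun j _ => ?_
    rw [← Finset.mul_sum, ← pfun_sum]
    have : rotPoly i j (∑ l ∈ s, Y l) = ∑ l ∈ s, rotPoly i j (Y l) := by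
      simp [rotPoly, Finset.mul_sum]
    rw [this]
  · exact fun l _ => integrable_finsetSum _ fun i _ => integrable_finsetSum _ fun j _ =>
      integrable_sphere ((continuous_fderiv_rot hf i j).mul
        (continuous_fderiv_rot (contDiff_pfun _) i j))

theorem sphDirichlet_sum_harmonic (hN : 0 < N) {n : ℕ} {f : Space N → ℝ} (hf : ContDiff ℝ ∞ f)
    {Y : ℕ → MvPolynomial (Fin N) ℝ} (hY : ∀ j, Y j ∈ harmonicSubmodule N j) :
    sphDirichlet f (pfun (∑ j ∈ Finset.range n, Y j)) =
      ∑ j ∈ Finset.range n, 2 * sphEigenvalue N j * sphInner f (pfun (Y j)) := by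
  rw [sphDirichlet_sum_right _ hf]
  exact Finset.sum_congr rfl fun j _ => sphDirichlet_harmonic hN hf (hY j)

theorem sphInner_sum_harmonic (hN : 3 ≤ N) {n l : ℕ} (hl : l < n)
    {Y : ℕ → MvPolynomial (Fin N) ℝ} (hY : ∀ j, Y j ∈ harmonicSubmodule N j) :
    sphInner (pfun (∑ j ∈ Finset.range n, Y j)) (pfun (Y l)) =
      sphInner (pfun (Y l)) (pfun (Y l)) := by
  rw [sphInner_comm, sphInner_sum_right _ (contDiff_pfun _).continuous,
    Finset.sum_eq_single_of_mem l (Finset.mem_range.2 hl)]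
  exact fun j _ hj => sphInner_harmonic_of_ne hN (Ne.symm hj) (hY l) (hY j)

theorem sphInner_sum_harmonic_self (hN : 3 ≤ N) {m n : ℕ} (hmn : m ≤ n)
    {Y : ℕ → MvPolynomial (Fin N) ℝ} (hY : ∀ j, Y j ∈ harmonicSubmodule N j) :
    sphInner (pfun (∑ j ∈ Finset.range n, Y j)) (pfun (∑ j ∈ Finset.range m, Y j)) =
      ∑ j ∈ Finset.range m, sphInner (pfun (Y j)) (pfun (Y j)) := by
  rw [sphInner_sum_right _ (contDiff_pfun _).continuous]
  exact Finset.sum_congr rfl fun j hj => sphInner_sum_harmonic hN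
    (lt_of_lt_of_le (Finset.mem_range.1 hj) hmn) hY

/-- The Dirichlet form of a sum of spherical harmonics. -/
theorem sphDirichlet_sum_harmonic_self (hN : 3 ≤ N) {n : ℕ}
    {Y : ℕ → MvPolynomial (Fin N) ℝ} (hY : ∀ j, Y j ∈ harmonicSubmodule N j) :
    sphDirichlet (pfun (∑ j ∈ Finset.range n, Y j)) (pfun (∑ j ∈ Finset.range n, Y j)) =
      ∑ j ∈ Finset.range n, 2 * sphEigenvalue N j * sphInner (pfun (Y j)) (pfun (Y j)) := by
  rw [sphDirichlet_sum_harmonic (by omega) (contDiff_pfun _) hY]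
  exact Finset.sum_congr rfl fun j hj => by
    rw [sphInner_sum_harmonic hN (Finset.mem_range.1 hj) hY]

theorem sphInner_self_nonneg (f : Space N → ℝ) : 0 ≤ sphInner f f :=
  integral_nonneg fun _ => mul_self_nonneg _

/-- This is $D(f-p,f-p)\ge 0$ expanded. It bounds $D(f,f)$ below by quantities that involve $f$ only
through its pairing with $p$, so no expansion of $f$ in harmonics is differentiated. -/
theorem two_mul_sphDirichlet_sub_le {f : Space N → ℝ} (hf : ContDiff ℝ ∞ f)
    (p : MvPolynomial (Fin N) ℝ) :
    2 * sphDirichlet f (pfun p) - sphDirichlet (pfun p) (pfun p) ≤ sphDirichlet f f := by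
  have hi : ∀ {g h : Space N → ℝ}, ContDiff ℝ ∞ g → ContDiff ℝ ∞ h →
      Integrable (fun θ : Sph N => ∑ i, ∑ j, fderiv ℝ g θ (rot i j (θ : Space N)) *
        fderiv ℝ h θ (rot i j (θ : Space N))) (sphMeasure N) := fun hg hh =>
    integrable_finsetSum _ fun i _ => integrable_finsetSum _ fun j _ =>
      integrable_sphere ((continuous_fderiv_rot hg i j).mul (continuous_fderiv_rot hh i j))
  have hp := contDiff_pfun p
  simp only [sphDirichlet]
  rw [← integral_const_mul, ← integral_sub ((hi hf hp).const_mul 2) (hi hp hp)]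
  refine integral_mono (((hi hf hp).const_mul 2).sub (hi hp hp)) (hi hf hf) fun θ => ?_
  simp only [Finset.mul_sum, ← Finset.sum_sub_distrib]
  refine Finset.sum_le_sum fun i _ => Finset.sum_le_sum fun j _ => ?_
  nlinarith [sq_nonneg (fderiv ℝ f θ (rot i j (θ : Space N)) -
    fderiv ℝ (pfun p) θ (rot i j (θ : Space N)))]

/-- With $p=\sum_{j<n}Y_j$ the projection of $f$, the preceding inequality becomes
$\tfrac12D(f,f)\ge\sum_{j<n}\lambda_j\|Y_j\|^2$. The terms with $j\ge\lceil\kappa\rceil$ have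
$\lambda_j\ge\kappa(\kappa+N-2)$, and the others are dropped. -/
theorem projection_harmonics_le (hN : 3 ≤ N) {κ : ℝ} (hκ : 0 ≤ κ) {f : Space N → ℝ}
    (hf : ContDiff ℝ ∞ f) {n : ℕ} (hn : ⌈κ⌉₊ ≤ n) :
    sphEigenvalue N κ * (‖(sphHarmonics N n).starProjection (sphLp (sphRestrict f hf.continuous))‖ ^ 2
      - ‖(sphHarmonics N ⌈κ⌉₊).starProjection (sphLp (sphRestrict f hf.continuous))‖ ^ 2)
      ≤ 1 / 2 * sphDirichlet f f := by
  set F := sphLp (sphRestrict f hf.continuous) with hF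
  obtain ⟨Y, hY, hYe⟩ := mem_sphHarmonics
    (Submodule.starProjection_apply_mem (sphHarmonics N n) F)
  set K := ⌈κ⌉₊ with hK
  have hFp : ∀ p, inner ℝ F (polyLp N p) = sphInner f (pfun p) := fun p => by
    rw [polyLp_eq, hF, inner_sphLp]
  have hpp : ∀ p q, inner ℝ (polyLp N p) (polyLp N q) = sphInner (pfun p) (pfun q) := fun p q => by
    rw [polyLp_eq, polyLp_eq, inner_sphLp]
  have hproj : ∀ {m : ℕ} {q : MvPolynomial (Fin N) ℝ}, polyLp N q ∈ sphHarmonics N m →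
      inner ℝ ((sphHarmonics N m).starProjection F) (polyLp N q) = sphInner f (pfun q) := by
    intro m q hq
    rw [Submodule.inner_starProjection_left_eq_right,
      Submodule.starProjection_eq_self_iff.2 hq, hFp]
  have hfY : ∀ j < n, sphInner f (pfun (Y j)) = sphInner (pfun (Y j)) (pfun (Y j)) := by
    intro j hj
    rw [← hproj (polyLp_mem_sphHarmonics hj (hY j)), hYe, hpp, sphInner_sum_harmonic hN hj hY]
  set s : ℕ → ℝ := fun j => sphInner (pfun (Y j)) (pfun (Y j)) with hs
  have hs0 : ∀ j, 0 ≤ s j := fun j => sphInner_self_nonneg _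
  have hPn : ‖(sphHarmonics N n).starProjection F‖ ^ 2 = ∑ j ∈ Finset.range n, s j := by
    rw [hYe, ← real_inner_self_eq_norm_sq, hpp, sphInner_sum_harmonic_self hN le_rfl hY]
  -- One inequality is enough here. The low part $y$ of the projection satisfies $\langle
  -- P_KF,y\rangle=\|y\|^2$, and Cauchy–Schwarz gives $\|y\|\le\|P_KF\|$.
  have hPK : ∑ j ∈ Finset.range K, s j ≤ ‖(sphHarmonics N K).starProjection F‖ ^ 2 := by
    set y := polyLp N (∑ j ∈ Finset.range K, Y j) with hy
    have hyK : y ∈ sphHarmonics N K := by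
      rw [hy, map_sum]
      exact sum_mem fun j hj => polyLp_mem_sphHarmonics (Finset.mem_range.1 hj) (hY j)
    have h1 : inner ℝ ((sphHarmonics N K).starProjection F) y = ∑ j ∈ Finset.range K, s j := by
      rw [hproj hyK, sphInner_sum_right _ hf.continuous]
      exact Finset.sum_congr rfl fun j hj =>
        hfY j (lt_of_lt_of_le (Finset.mem_range.1 hj) hn)
    have h2 : ‖y‖ ^ 2 = ∑ j ∈ Finset.range K, s j := by
      rw [← real_inner_self_eq_norm_sq, hpp, sphInner_sum_harmonic_self hN le_rfl hY]
    have h3 := real_inner_le_norm ((sphHarmonics N K).starProjection F) y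
    rw [h1, ← h2] at h3
    rw [← h2]
    rcases (norm_nonneg y).eq_or_lt with h | h
    · rw [← h]; simp
    · have : ‖y‖ ≤ ‖(sphHarmonics N K).starProjection F‖ := by nlinarith
      gcongr
  have hD := two_mul_sphDirichlet_sub_le hf (∑ j ∈ Finset.range n, Y j)
  rw [sphDirichlet_sum_harmonic (by omega) hf hY, sphDirichlet_sum_harmonic_self hN hY] at hD
  have hD' : ∑ j ∈ Finset.range n, sphEigenvalue N j * s j ≤ 1 / 2 * sphDirichlet f f := by
    have e : ∑ j ∈ Finset.range n, 2 * sphEigenvalue N j * sphInner f (pfun (Y j))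
        = 2 * ∑ j ∈ Finset.range n, sphEigenvalue N j * s j := by
      rw [Finset.mul_sum]
      refine Finset.sum_congr rfl fun j hj => ?_
      rw [hfY j (Finset.mem_range.1 hj)]; ring
    have e' : ∑ j ∈ Finset.range n, 2 * sphEigenvalue N j * sphInner (pfun (Y j)) (pfun (Y j))
        = 2 * ∑ j ∈ Finset.range n, sphEigenvalue N j * s j := by
      rw [Finset.mul_sum]
      exact Finset.sum_congr rfl fun j _ => by ring
    rw [e, e'] at hD
    linarith
  refine le_trans ?_ hD'
  have hsplit : ∑ j ∈ Finset.range n, s j - ∑ j ∈ Finset.range K, s j = ∑ j ∈ Finset.Ico K n, s j := by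
    rw [Finset.sum_Ico_eq_sub _ hn]
  have hl0 := sphEigenvalue_nonneg hN hκ
  calc _ ≤ sphEigenvalue N κ * ∑ j ∈ Finset.Ico K n, s j := by
        rw [hPn, ← hsplit]; gcongr
    _ ≤ ∑ j ∈ Finset.Ico K n, sphEigenvalue N j * s j := by
        rw [Finset.mul_sum]
        refine Finset.sum_le_sum fun j hj => mul_le_mul_of_nonneg_right ?_ (hs0 j)
        have hKj : κ ≤ j := (Nat.le_ceil κ).trans (by exact_mod_cast (Finset.mem_Ico.1 hj).1)
        exact (sphEigenvalue_strictMonoOn hN).monotoneOn hκ (hκ.trans hKj) hKj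
    _ ≤ ∑ j ∈ Finset.range n, sphEigenvalue N j * s j := by
        refine Finset.sum_le_sum_of_subset_of_nonneg (fun j hj => ?_) fun j _ _ =>
          mul_nonneg (sphEigenvalue_nonneg hN (Nat.cast_nonneg j)) (hs0 j)
        exact Finset.mem_range.2 (Finset.mem_Ico.1 hj).2

/-- Harmonics are dense in $L^2$ of the sphere, so the projections onto degrees below $n$ exhaust
the norm of $f$, and the finite-degree inequality passes to the limit. -/
theorem sphere_gap (hN : 3 ≤ N) {κ : ℝ} (hκ : 0 ≤ κ) {f : Space N → ℝ} (hf : ContDiff ℝ ∞ f) :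
    sphEigenvalue N κ * (sphInner f f
      - ‖(sphHarmonics N ⌈κ⌉₊).starProjection (sphLp (sphRestrict f hf.continuous))‖ ^ 2)
      ≤ 1 / 2 * sphDirichlet f f := by
  set F := sphLp (sphRestrict f hf.continuous) with hF
  have hl0 := sphEigenvalue_nonneg hN hκ
  refine le_of_forall_pos_le_add fun ε hε => ?_
  have hδ : 0 < ε / (sphEigenvalue N κ + 1) := by positivity
  obtain ⟨n, q, hq, hnq⟩ := exists_sphHarmonics_near (by omega) (sphRestrict f hf.continuous)
    (Real.sqrt_pos.2 hδ)
  rw [← hF] at hnq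
  set m := max n ⌈κ⌉₊ with hm
  have hqm : q ∈ sphHarmonics N m := sphHarmonics_mono (le_max_left _ _) hq
  have h1 := projection_harmonics_le hN hκ hf (le_max_right n ⌈κ⌉₊)
  rw [← hF, ← hm] at h1
  have h2 : ‖F - (sphHarmonics N m).starProjection F‖ ≤ ‖F - q‖ := by
    rw [Submodule.starProjection_minimal]
    exact ciInf_le ⟨0, Set.forall_mem_range.mpr fun _ => norm_nonneg _⟩
      (⟨q, hqm⟩ : sphHarmonics N m)
  have h3 : ‖F‖ ^ 2 = ‖(sphHarmonics N m).starProjection F‖ ^ 2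
      + ‖F - (sphHarmonics N m).starProjection F‖ ^ 2 := by
    rw [Submodule.norm_sq_eq_add_norm_sq_starProjection F (sphHarmonics N m),
      Submodule.starProjection_orthogonal_val]
  have h4 : ‖F‖ ^ 2 = sphInner f f := by
    rw [← real_inner_self_eq_norm_sq, hF, inner_sphLp]
  have h5 : ‖F - (sphHarmonics N m).starProjection F‖ ^ 2 ≤ ε / (sphEigenvalue N κ + 1) := by
    rw [← Real.sq_sqrt hδ.le]
    have := h2.trans hnq.le
    gcongr
  have h6 : sphEigenvalue N κ * ‖F - (sphHarmonics N m).starProjection F‖ ^ 2 ≤ ε := by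
    calc _ ≤ (sphEigenvalue N κ + 1) * (ε / (sphEigenvalue N κ + 1)) := by gcongr; linarith
      _ = ε := by field_simp
  rw [← h4, h3]
  linarith

/-- Up to finitely many harmonic directions, the Dirichlet form of the sphere dominates
`κ (κ + N - 2)` times the `L²` norm; the directions satisfy Bessel's inequality. -/
theorem exists_harmonic_directions (hN : 3 ≤ N) {κ : ℝ} (hκ : 0 ≤ κ) :
    ∃ (d : ℕ) (Z : Fin d → MvPolynomial (Fin N) ℝ),
      d ≤ ∑ j ∈ Finset.range ⌈κ⌉₊, Module.finrank ℝ (harmonicSubmodule N j) ∧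
      (∀ f : Space N → ℝ, Continuous f → ∑ i, sphInner f (pfun (Z i)) ^ 2 ≤ sphInner f f) ∧
      ∀ f : Space N → ℝ, ContDiff ℝ ∞ f →
        sphEigenvalue N κ * (sphInner f f - ∑ i, sphInner f (pfun (Z i)) ^ 2)
          ≤ 1 / 2 * sphDirichlet f f := by
  set K := sphHarmonics N ⌈κ⌉₊ with hK
  -- The directions are polynomial representatives of an orthonormal basis of the harmonics of
  -- degree below $\kappa$; their squared coefficients add up to the squared norm of the projection.
  set b := stdOrthonormalBasis ℝ K with hb
  choose Y hY1 hY2 using fun i => mem_sphHarmonics (b i).2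
  have hproj : ∀ (f : Space N → ℝ) (hf : Continuous f),
      ∑ i, sphInner f (pfun (∑ j ∈ Finset.range ⌈κ⌉₊, Y i j)) ^ 2 =
        ‖K.starProjection (sphLp (sphRestrict f hf))‖ ^ 2 := by
    intro f hf
    have h1 : ∀ i, sphInner f (pfun (∑ j ∈ Finset.range ⌈κ⌉₊, Y i j)) =
        inner ℝ (b i) (K.orthogonalProjectionOnto (sphLp (sphRestrict f hf))) := by
      intro i
      rw [Submodule.inner_orthogonalProjectionOnto_eq_of_mem_left, hY2 i, polyLp_eq, inner_sphLp,
        sphInner_comm]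
    simp_rw [h1]
    have := b.sum_sq_norm_inner_right (K.orthogonalProjectionOnto (sphLp (sphRestrict f hf)))
    simp only [Real.norm_eq_abs, sq_abs] at this
    rw [this, Submodule.starProjection_apply, Submodule.coe_norm]
  refine ⟨_, fun i => ∑ j ∈ Finset.range ⌈κ⌉₊, Y i j, finrank_sphHarmonics_le _, ?_, ?_⟩
  · intro f hf
    rw [hproj f hf, ← inner_sphLp hf hf, real_inner_self_eq_norm_sq]
    have := Submodule.norm_starProjection_apply_le K (sphLp (sphRestrict f hf))
    gcongr
  · intro f hf
    rw [hproj f hf.continuous]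
    exact sphere_gap hN hκ hf

end Henon

/-! ### The potential in logarithmic coordinates -/

namespace Henon

variable {N : ℕ}

/-- The potential `C(α) p_α |x|^α U_α^(p_α - 1)` of the linearized operator. -/
noncomputable def pot (N : ℕ) (α : ℝ) (x : Space N) : ℝ :=
  coeff N α * exponent N α * ‖x‖ ^ α * U N α x ^ (exponent N α - 1)

/-- Since $p_\alpha-1=2(2+\alpha)/(N-2)$, the exponents multiply to exactly $2$. -/
theorem U_rpow {α : ℝ} (hN : 3 ≤ N) (hα : 0 < α) (x : Space N) :
    U N α x ^ (exponent N α - 1) = ((1 + ‖x‖ ^ (2 + α)) ^ 2)⁻¹ := by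
  have h3 : (3 : ℝ) ≤ N := by exact_mod_cast hN
  have hp : 0 < 1 + ‖x‖ ^ (2 + α) := by positivity
  have hN2 : (N : ℝ) - 2 ≠ 0 := by linarith
  have hα2 : 2 + α ≠ 0 := by linarith
  rw [U, one_div, Real.inv_rpow (by positivity), ← Real.rpow_mul hp.le]
  have : ((N : ℝ) - 2) / (2 + α) * (exponent N α - 1) = 2 := by
    rw [exponent]; field_simp; ring
  rw [this]
  norm_cast

theorem pot_eq {α : ℝ} (hN : 3 ≤ N) (hα : 0 < α) (x : Space N) :
    pot N α x = ((N : ℝ) + α) * (N + 2 + 2 * α) * (‖x‖ ^ α / (1 + ‖x‖ ^ (2 + α)) ^ 2) := by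
  have h3 : (3 : ℝ) ≤ N := by exact_mod_cast hN
  have hN2 : (N : ℝ) - 2 ≠ 0 := by linarith
  rw [pot, U_rpow hN hα, coeff, exponent]
  field_simp

theorem continuous_pot {α : ℝ} (hN : 3 ≤ N) (hα : 0 < α) : Continuous (pot N α) := by
  have : pot N α = fun x : Space N =>
      ((N : ℝ) + α) * (N + 2 + 2 * α) * (‖x‖ ^ α / (1 + ‖x‖ ^ (2 + α)) ^ 2) :=
    funext (pot_eq hN hα)
  rw [this]
  refine continuous_const.mul (Continuous.div ?_ ?_ ?_)
  · exact continuous_norm.rpow_const fun x => Or.inr hα.le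
  · exact (continuous_const.add (continuous_norm.rpow_const fun x => Or.inr (by linarith))).pow 2
  · intro x
    have hp : 0 < 1 + ‖x‖ ^ (2 + α) := by positivity
    positivity

theorem pot_nonneg {α : ℝ} (hN : 3 ≤ N) (hα : 0 < α) (x : Space N) : 0 ≤ pot N α x := by
  rw [pot_eq hN hα]; positivity

/-- From $1+e^{2\kappa t}=2e^{\kappa t}\cosh(\kappa t)$ the potential becomes a multiple of
$1/\cosh^2(\kappa t)$. The coefficient is $\nu(\nu+1)\kappa^2$ with $\nu=(\beta+\kappa)/\kappa$,
which is why $\cosh(\kappa t)^{-\nu}$ is the ground state. -/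
theorem exp_mul_pot {α β κ : ℝ} (hN : 3 ≤ N) (hα : 0 < α) (hβ : 2 * β = N - 2)
    (hκ : 2 * κ = 2 + α) (t : ℝ) (θ : Sph N) :
    Real.exp (2 * t) * pot N α (Real.exp t • (θ : Space N)) =
      (β + κ) * (β + 2 * κ) * (1 - Real.tanh (κ * t) ^ 2) := by
  have hc := (Real.cosh_pos (κ * t)).ne'
  have hsq : Real.cosh (κ * t) ^ 2 = Real.sinh (κ * t) ^ 2 + 1 := Real.cosh_sq _
  have e1 : 1 - Real.tanh (κ * t) ^ 2 = (Real.cosh (κ * t) ^ 2)⁻¹ := by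
    rw [Real.tanh_eq_sinh_div_cosh]
    field_simp
    linarith
  have e2 : 1 + Real.exp (t * (2 + α)) = 2 * Real.exp (κ * t) * Real.cosh (κ * t) := by
    rw [Real.cosh_eq, ← hκ]
    have : Real.exp (t * (2 * κ)) = Real.exp (κ * t) * Real.exp (κ * t) := by
      rw [← Real.exp_add]; ring_nf
    have h1 : Real.exp (κ * t) * Real.exp (-(κ * t)) = 1 := by rw [← Real.exp_add]; simp
    rw [this]
    linear_combination -h1
  have e3 : Real.exp (2 * t) * Real.exp (t * α) = Real.exp (κ * t) * Real.exp (κ * t) := by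
    rw [← Real.exp_add, ← Real.exp_add]; congr 1; linear_combination (-t) * hκ
  rw [pot_eq hN hα, norm_exp_smul, ← Real.exp_mul, ← Real.exp_mul, e1, e2]
  have hNa : (N : ℝ) + α = 2 * (β + κ) := by linarith
  have hNb : (N : ℝ) + 2 + 2 * α = 2 * (β + 2 * κ) := by linarith
  rw [hNa, hNb]
  have he := (Real.exp_pos (κ * t)).ne'
  generalize Real.exp (κ * t) = E at *
  field_simp
  linear_combination ((β + κ) * (β + 2 * κ)) * e3

theorem fderiv_eq_sum (L : Space N →L[ℝ] ℝ) (y : Space N) :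
    L y = ∑ i, y i * L (EuclideanSpace.single i 1) := by
  conv_lhs => rw [← (EuclideanSpace.basisFun (Fin N) ℝ).sum_repr y]
  simp [map_sum]

theorem norm_sq_eq_sum (L : Space N →L[ℝ] ℝ) :
    ‖L‖ ^ 2 = ∑ i, L (EuclideanSpace.single i 1) ^ 2 := by
  obtain ⟨y, rfl⟩ := (InnerProductSpace.toDual ℝ (Space N)).surjective L
  rw [LinearIsometryEquiv.norm_map, EuclideanSpace.norm_sq_eq]
  refine Finset.sum_congr rfl fun i _ => ?_
  simp [InnerProductSpace.toDual_apply_apply, EuclideanSpace.inner_single_right]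

/-- Lagrange's identity for the radial and rotational parts of a gradient. -/
theorem sum_rot_sq (L : Space N →L[ℝ] ℝ) (x : Space N) :
    ∑ i, ∑ j, L (rot i j x) * L (rot i j x) = 2 * (‖x‖ ^ 2 * ‖L‖ ^ 2 - L x ^ 2) := by
  set a : Fin N → ℝ := fun i => L (EuclideanSpace.single i 1) with ha
  have h1 : ∀ i j, L (rot i j x) * L (rot i j x) =
      x i ^ 2 * a j ^ 2 + a i ^ 2 * x j ^ 2 - 2 * ((x i * a i) * (x j * a j)) := by
    intro i j
    simp only [rot, map_sub, map_smul, smul_eq_mul, ha]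
    ring
  rw [norm_sq_eq_sum, EuclideanSpace.norm_sq_eq, fderiv_eq_sum L x]
  simp only [Real.norm_eq_abs, sq_abs]
  simp_rw [h1, Finset.sum_sub_distrib, Finset.sum_add_distrib, ← Finset.mul_sum, ← Finset.sum_mul]
  ring

/-! ### The ground state transformation -/

/-- The linearized energy density. -/
noncomputable def density (α : ℝ) (v : Space N → ℝ) (x : Space N) : ℝ :=
  ‖fderiv ℝ v x‖ ^ 2 - pot N α x * v x ^ 2

/-- The transformed energy density `(x·∇w)² + |∇_S w|² - κ(κ+N-2) w²`. -/
noncomputable def cylDensity (κ : ℝ) (w : Space N → ℝ) (x : Space N) : ℝ :=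
  fderiv ℝ w x x ^ 2 + 1 / 2 * ∑ i, ∑ j, fderiv ℝ w x (rot i j x) * fderiv ℝ w x (rot i j x)
    - sphEigenvalue N κ * w x ^ 2

/-- The radial profile of the positive solution used in the ground state transformation. -/
noncomputable def profile (β κ t : ℝ) : ℝ :=
  Real.exp (-β * t) * Real.cosh (κ * t) ^ (-((β + κ) / κ))

theorem profile_pos (β κ t : ℝ) : 0 < profile β κ t :=
  mul_pos (Real.exp_pos _) (Real.rpow_pos_of_pos (Real.cosh_pos _) _)

theorem contDiff_profile (β κ : ℝ) : ContDiff ℝ ∞ (profile β κ) := by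
  unfold profile
  exact (Real.contDiff_exp.comp (contDiff_const.mul contDiff_id)).mul
    ((Real.contDiff_cosh.comp (contDiff_const.mul contDiff_id)).rpow_const_of_ne
      fun t => (Real.cosh_pos _).ne')

theorem hasDerivAt_profile {κ : ℝ} (hκ : κ ≠ 0) (β t : ℝ) :
    HasDerivAt (profile β κ) (-(β + (β + κ) * Real.tanh (κ * t)) * profile β κ t) t := by
  have h1 : HasDerivAt (fun t => Real.exp (-β * t)) (Real.exp (-β * t) * (-β)) t := by
    simpa using ((hasDerivAt_id t).const_mul (-β)).exp
  refine (h1.mul (hasDerivAt_cosh_rpow hκ (β + κ) t)).congr_deriv ?_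
  rw [profile, Real.tanh_eq_sinh_div_cosh]
  ring

theorem exp_mul_profile_sq (β κ t : ℝ) :
    Real.exp (2 * β * t) * profile β κ t ^ 2 = rho β κ t := by
  have hc := Real.cosh_pos (κ * t)
  rw [profile, rho, mul_pow, ← mul_assoc, ← Real.exp_nat_mul, ← Real.exp_add,
    ← Real.rpow_mul_natCast hc.le]
  have : 2 * β * t + (2 : ℕ) * (-β * t) = 0 := by push_cast; ring
  rw [this, Real.exp_zero, one_mul]
  congr 1
  push_cast; ring

theorem IsPuncturedTest.radial_mul {w : Space N → ℝ} (hw : IsPuncturedTest w) {χ : ℝ → ℝ}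
    (hχ : ContDiff ℝ ∞ χ) : IsPuncturedTest fun x => radial χ x * w x := by
  have hsub : tsupport (fun x => radial χ x * w x) ⊆ tsupport w := tsupport_mul_subset_right
  refine ⟨?_, hw.hasCompactSupport.mul_left, fun h => hw.zero_notMem (hsub h)⟩
  rw [contDiff_iff_contDiffAt]
  intro x
  by_cases hx : x = 0
  · subst hx
    refine (contDiffAt_const (c := (0 : ℝ))).congr_of_eventuallyEq ?_
    exact notMem_tsupport_iff_eventuallyEq.1 fun h => hw.zero_notMem (hsub h)
  · exact (contDiffAt_radial hχ hx).mul hw.contDiff.contDiffAt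

theorem hasDerivAt_ray {w : Space N → ℝ} (hw : ContDiff ℝ ∞ w) (θ : Space N) (t : ℝ) :
    HasDerivAt (fun t => w (Real.exp t • θ)) (fderiv ℝ w (Real.exp t • θ) (Real.exp t • θ)) t := by
  have h1 : HasDerivAt (fun t => Real.exp t • θ) (Real.exp t • θ) t :=
    (Real.hasDerivAt_exp t).smul_const θ
  exact ((hw.differentiable (by simp)) _).hasFDerivAt.comp_hasDerivAt t h1

theorem hasDerivAt_tanh_mul (κ t : ℝ) :
    HasDerivAt (fun t => Real.tanh (κ * t)) (κ * (1 - Real.tanh (κ * t) ^ 2)) t := by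
  have hc := (Real.cosh_pos (κ * t)).ne'
  have h1 : HasDerivAt (fun t => Real.cosh (κ * t)) (Real.sinh (κ * t) * κ) t := by
    simpa using ((hasDerivAt_id t).const_mul κ).cosh
  have h2 : HasDerivAt (fun t => Real.sinh (κ * t)) (Real.cosh (κ * t) * κ) t := by
    simpa using ((hasDerivAt_id t).const_mul κ).sinh
  have h3 := h2.div h1 hc
  have : (fun t => Real.tanh (κ * t)) =
      (fun t => Real.sinh (κ * t)) / fun t => Real.cosh (κ * t) := by
    funext s; simp [Real.tanh_eq_sinh_div_cosh]
  rw [this]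
  refine h3.congr_deriv ?_
  rw [Real.tanh_eq_sinh_div_cosh]
  field_simp

/-- The ground state transformation, pointwise on rays. -/
theorem exp_mul_density {α β κ : ℝ} (hN : 3 ≤ N) (hα : 0 < α) (hβ : 2 * β = N - 2)
    (hκ : 2 * κ = 2 + α) {w : Space N → ℝ} (hw : IsPuncturedTest w) (t : ℝ) (θ : Sph N) :
    Real.exp (N * t) * density α (fun x => radial (profile β κ) x * w x)
        (Real.exp t • (θ : Space N)) =
      rho β κ t * cylDensity κ w (Real.exp t • (θ : Space N)) +
        (((2 * (β + κ) * Real.tanh (κ * t) * (β + (β + κ) * Real.tanh (κ * t))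
            - (β + κ) * κ * (1 - Real.tanh (κ * t) ^ 2)) * rho β κ t)
            * w (Real.exp t • (θ : Space N)) ^ 2
          - 2 * (β + (β + κ) * Real.tanh (κ * t)) * rho β κ t * (w (Real.exp t • (θ : Space N)) *
            fderiv ℝ w (Real.exp t • (θ : Space N)) (Real.exp t • (θ : Space N)))) := by
  have hκ0 : κ ≠ 0 := by linarith
  set x := Real.exp t • (θ : Space N) with hx
  have hx0 : x ≠ 0 := exp_smul_ne_zero t θ
  have hnx : ‖x‖ = Real.exp t := norm_exp_smul t θ
  have hlog : Real.log ‖x‖ = t := by rw [hnx, Real.log_exp]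
  have hpr : HasDerivAt (profile β κ) _ (Real.log ‖x‖) := hasDerivAt_profile hκ0 β _
  rw [hlog] at hpr
  have hr : HasFDerivAt (radial (profile β κ)) _ x := hasFDerivAt_radial hx0 (by rw [hlog]; exact hpr)
  have hwx : HasFDerivAt w (fderiv ℝ w x) x := (hw.contDiff.differentiable (by simp) x).hasFDerivAt
  have hv := (hr.fun_mul hwx).fderiv
  set L := fderiv ℝ (fun x => radial (profile β κ) x * w x) x with hL
  set G := profile β κ t with hG
  have hrad : radial (profile β κ) x = G := by rw [hx, radial_exp_smul]
  have hxx : inner ℝ x x = ‖x‖ ^ 2 := real_inner_self_eq_norm_sq x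
  have hn0 : ‖x‖ ^ 2 ≠ 0 := by simpa using hx0
  have hLx : L x = G * (fderiv ℝ w x x - (β + (β + κ) * Real.tanh (κ * t)) * w x) := by
    rw [hv, hrad]
    simp only [add_apply, smul_apply, smul_eq_mul, innerSL_apply_apply, hxx]
    field_simp
    ring
  have hLr : ∀ i j, L (rot i j x) = G * fderiv ℝ w x (rot i j x) := by
    intro i j
    rw [hv, hrad]
    simp [inner_rot]
  have hS := sum_rot_sq L x
  have hS' : ∑ i, ∑ j, L (rot i j x) * L (rot i j x) =
      G ^ 2 * ∑ i, ∑ j, fderiv ℝ w x (rot i j x) * fderiv ℝ w x (rot i j x) := by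
    simp_rw [hLr, Finset.mul_sum]
    exact Finset.sum_congr rfl fun i _ => Finset.sum_congr rfl fun j _ => by ring
  rw [hS', hLx] at hS
  set S := ∑ i, ∑ j, fderiv ℝ w x (rot i j x) * fderiv ℝ w x (rot i j x) with hSdef
  have hpot := exp_mul_pot hN hα hβ hκ t θ
  rw [← hx] at hpot
  have hexp : Real.exp (N * t) = Real.exp (2 * β * t) * Real.exp (2 * t) := by
    rw [← Real.exp_add]; congr 1; linear_combination (-t) * hβ
  have he2 : ‖x‖ ^ 2 = Real.exp (2 * t) := by
    rw [hnx, ← Real.exp_nat_mul]; norm_num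
  rw [he2] at hS
  have hrho := exp_mul_profile_sq β κ t
  rw [← hG] at hrho
  have hlam : sphEigenvalue N κ = κ * (κ + 2 * β) := by rw [sphEigenvalue, hβ]
  simp only [density, cylDensity]
  rw [hexp, ← hL, hrad, ← hSdef, hlam, ← hrho]
  set T := Real.tanh (κ * t)
  set E := Real.exp (2 * β * t)
  set W := fderiv ℝ w x x
  -- `hS` is Lagrange's identity, which splits $|\nabla v|^2$ into its radial and rotational parts;
  -- `hpot` supplies the potential.
  linear_combination (-E / 2) * hS - (E * (G * w x) ^ 2) * hpot

theorem integrable_ray {F : Space N → ℝ} (hc : Continuous F) (hF : HasCompactSupport F)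
    (h0 : (0 : Space N) ∉ tsupport F) {g : ℝ → ℝ} (hg : Continuous g) (θ : Sph N) :
    Integrable fun t => g t * F (Real.exp t • (θ : Space N)) := by
  obtain ⟨T, hT⟩ := exists_support_annulus hF h0
  refine Continuous.integrable_of_hasCompactSupport ?_ ?_
  · exact hg.mul (hc.comp (Real.continuous_exp.smul continuous_const))
  · exact HasCompactSupport.intro (K := Set.Icc (-T) T) isCompact_Icc fun t ht => by
      rw [image_eq_zero_of_notMem_tsupport (hT θ t ht), mul_zero]

theorem continuous_euler {w : Space N → ℝ} (hw : ContDiff ℝ ∞ w) :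
    Continuous fun x => fderiv ℝ w x x :=
  (hw.continuous_fderiv (by simp)).clm_apply continuous_id

/-- The integral along a ray of a total derivative vanishes. -/
theorem integral_ray_total_derivative {β κ : ℝ} (hκ : κ ≠ 0) {w : Space N → ℝ}
    (hw : IsPuncturedTest w) (θ : Sph N) :
    ∫ t, (((2 * (β + κ) * Real.tanh (κ * t) * (β + (β + κ) * Real.tanh (κ * t))
            - (β + κ) * κ * (1 - Real.tanh (κ * t) ^ 2)) * rho β κ t)
            * w (Real.exp t • (θ : Space N)) ^ 2
          - 2 * (β + (β + κ) * Real.tanh (κ * t)) * rho β κ t * (w (Real.exp t • (θ : Space N)) *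
            fderiv ℝ w (Real.exp t • (θ : Space N)) (Real.exp t • (θ : Space N)))) = 0 := by
  have hrho := (contDiff_rho β κ).continuous
  have htanh : Continuous fun t => Real.tanh (κ * t) :=
    continuous_iff_continuousAt.2 fun t => (hasDerivAt_tanh_mul κ t).continuousAt
  have hw2 : HasCompactSupport fun x => w x ^ 2 :=
    hw.hasCompactSupport.comp_left (g := fun y : ℝ => y ^ 2) (by simp)
  have hz2 : (0 : Space N) ∉ tsupport fun x => w x ^ 2 := fun h =>
    hw.zero_notMem (tsupport_comp_subset (g := fun y : ℝ => y ^ 2) (by simp) w h)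
  have hwe : HasCompactSupport fun x => w x * fderiv ℝ w x x := hw.hasCompactSupport.mul_right
  have hze : (0 : Space N) ∉ tsupport fun x => w x * fderiv ℝ w x x := fun h =>
    hw.zero_notMem (tsupport_mul_subset_left h)
  have hwc := hw.contDiff.continuous
  -- The primitive is $(g'/g)\,\rho\,w^2$ with $g$ the profile: the boundary term of the ground
  -- state transformation, of compact support along the ray.
  refine integral_eq_zero_of_hasDerivAt_of_integrable (f := fun t =>
    (-(β + (β + κ) * Real.tanh (κ * t)) * rho β κ t) * w (Real.exp t • (θ : Space N)) ^ 2) ?_ ?_ ?_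
  · intro t
    have h1 := hasDerivAt_rho hκ β t
    have h2 := ((((hasDerivAt_tanh_mul κ t).const_mul (β + κ)).const_add β).fun_neg.fun_mul h1).fun_mul
      ((hasDerivAt_ray hw.contDiff (θ : Space N) t).fun_pow 2)
    refine h2.congr_deriv ?_
    rw [← Real.tanh_eq_sinh_div_cosh]
    push_cast
    ring
  · refine Integrable.sub ?_ ?_
    · exact integrable_ray (hwc.pow 2) hw2 hz2 (g := fun t =>
        ((2 * (β + κ) * Real.tanh (κ * t) * (β + (β + κ) * Real.tanh (κ * t))
            - (β + κ) * κ * (1 - Real.tanh (κ * t) ^ 2)) * rho β κ t)) (by fun_prop) θ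
    · exact integrable_ray (hwc.mul (continuous_euler hw.contDiff)) hwe hze (g := fun t =>
        2 * (β + (β + κ) * Real.tanh (κ * t)) * rho β κ t) (by fun_prop) θ
  · exact integrable_ray (hwc.pow 2) hw2 hz2 (g := fun t =>
        (-(β + (β + κ) * Real.tanh (κ * t)) * rho β κ t)) (by fun_prop) θ

theorem fderiv_eq_zero_of_notMem_tsupport {w : Space N → ℝ} {x : Space N} (hx : x ∉ tsupport w) :
    fderiv ℝ w x = 0 := by
  by_contra h
  exact hx (support_fderiv_subset ℝ h)

theorem hasCompactSupport_of_vanishing {w : Space N → ℝ} (hw : IsPuncturedTest w)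
    {F : Space N → ℝ} (hF : ∀ x ∉ tsupport w, F x = 0) :
    HasCompactSupport F ∧ (0 : Space N) ∉ tsupport F := by
  have hsub : tsupport F ⊆ tsupport w := by
    refine closure_minimal (fun x hx => ?_) (isClosed_tsupport w)
    by_contra h
    exact hx (hF x h)
  exact ⟨hw.hasCompactSupport.of_isClosed_subset (isClosed_tsupport _) hsub,
    fun h => hw.zero_notMem (hsub h)⟩

theorem continuous_density {α : ℝ} (hN : 3 ≤ N) (hα : 0 < α) {v : Space N → ℝ}
    (hv : ContDiff ℝ ∞ v) : Continuous (density α v) :=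
  ((hv.continuous_fderiv (by simp)).norm.pow 2).sub
    ((continuous_pot hN hα).mul (hv.continuous.pow 2))

theorem continuous_cylDensity {κ : ℝ} {w : Space N → ℝ} (hw : ContDiff ℝ ∞ w) :
    Continuous (cylDensity κ w) := by
  have h1 := continuous_euler hw
  have h2 := hw.continuous
  have h3 : Continuous fun x => ∑ i, ∑ j, fderiv ℝ w x (rot i j x) * fderiv ℝ w x (rot i j x) :=
    continuous_finsetSum _ fun i _ => continuous_finsetSum _ fun j _ =>
      (continuous_fderiv_rot hw i j).mul (continuous_fderiv_rot hw i j)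
  unfold cylDensity
  fun_prop

theorem density_support {α : ℝ} {v : Space N → ℝ} (hv : IsPuncturedTest v) :
    HasCompactSupport (density α v) ∧ (0 : Space N) ∉ tsupport (density α v) :=
  hasCompactSupport_of_vanishing hv fun x hx => by
    simp [density, fderiv_eq_zero_of_notMem_tsupport hx, image_eq_zero_of_notMem_tsupport hx]

theorem cylDensity_support {κ : ℝ} {w : Space N → ℝ} (hw : IsPuncturedTest w) :
    HasCompactSupport (cylDensity κ w) ∧ (0 : Space N) ∉ tsupport (cylDensity κ w) :=
  hasCompactSupport_of_vanishing hw fun x hx => by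
    simp [cylDensity, fderiv_eq_zero_of_notMem_tsupport hx, image_eq_zero_of_notMem_tsupport hx]

/-- The ground state transformation of the linearized energy. -/
theorem integral_density {α β κ : ℝ} (hN : 3 ≤ N) (hα : 0 < α) (hβ : 2 * β = N - 2)
    (hκ : 2 * κ = 2 + α) {w : Space N → ℝ} (hw : IsPuncturedTest w) :
    ∫ x, density α (fun x => radial (profile β κ) x * w x) x =
      ∫ p : Sph N × ℝ, rho β κ p.2 * cylDensity κ w (Real.exp p.2 • (p.1 : Space N))
        ∂((sphMeasure N).prod volume) := by
  have hκ0 : κ ≠ 0 := by linarith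
  have hv := hw.radial_mul (contDiff_profile β κ)
  have hds := density_support (α := α) hv
  have hcs := cylDensity_support (κ := κ) hw
  have hdc := continuous_density hN hα hv.contDiff
  have hi1 := integrable_polar hdc hds.1 hds.2 (g := fun t => Real.exp (N * t)) (by fun_prop)
  have hi2 := integrable_polar (continuous_cylDensity hw.contDiff) hcs.1 hcs.2
    (contDiff_rho β κ).continuous
  have hprod := integral_prod _ (hi1.sub hi2)
  simp only [Pi.sub_apply] at hprod
  rw [integral_eq_integral_polar (by omega) hdc hds.1 hds.2, ← sub_eq_zero,
    ← integral_sub hi1 hi2, hprod]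
  refine integral_eq_zero_of_ae (Eventually.of_forall fun θ => ?_)
  have := integral_ray_total_derivative (β := β) hκ0 hw θ
  simp only [Pi.zero_apply]
  rw [← this]
  refine integral_congr_ae (Eventually.of_forall fun t => ?_)
  simp only
  rw [exp_mul_density hN hα hβ hκ hw t θ]
  ring

end Henon

/-! ### Nonnegativity under finitely many orthogonality conditions -/

namespace Henon

variable {N : ℕ}

theorem fderiv_comp_smul {w : Space N → ℝ} (hw : ContDiff ℝ ∞ w) (c : ℝ) (x h : Space N) :
    fderiv ℝ (fun x => w (c • x)) x h = fderiv ℝ w (c • x) (c • h) := by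
  have h1 : HasFDerivAt (fun x : Space N => c • x) (c • ContinuousLinearMap.id ℝ (Space N)) x :=
    (hasFDerivAt_id x).const_smul c
  have h2 := ((hw.differentiable (by simp)) (c • x)).hasFDerivAt.comp x h1
  have h3 : HasFDerivAt (fun x => w (c • x)) _ x := h2
  rw [h3.fderiv]
  simp

theorem contDiff_comp_smul {w : Space N → ℝ} (hw : ContDiff ℝ ∞ w) (c : ℝ) :
    ContDiff ℝ ∞ fun x => w (c • x) := hw.comp (contDiff_const_smul c)

/-- The integral of the transformed energy density over a sphere. -/
theorem integral_sphere_cylDensity {κ : ℝ} {w : Space N → ℝ} (hw : ContDiff ℝ ∞ w) (t : ℝ) :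
    ∫ θ : Sph N, cylDensity κ w (Real.exp t • (θ : Space N)) ∂(sphMeasure N) =
      sphInner (fun x => fderiv ℝ w (Real.exp t • x) (Real.exp t • x))
          (fun x => fderiv ℝ w (Real.exp t • x) (Real.exp t • x))
        + 1 / 2 * sphDirichlet (fun x => w (Real.exp t • x)) (fun x => w (Real.exp t • x))
        - sphEigenvalue N κ * sphInner (fun x => w (Real.exp t • x)) (fun x => w (Real.exp t • x)) := by
  have hs : Continuous fun x : Space N => Real.exp t • x := continuous_const_smul _
  have hE : Continuous fun x : Space N => fderiv ℝ w (Real.exp t • x) (Real.exp t • x) :=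
    (continuous_euler hw).comp hs
  have hf := contDiff_comp_smul hw (Real.exp t)
  have i1 : Integrable (fun θ : Sph N =>
      fderiv ℝ w (Real.exp t • (θ : Space N)) (Real.exp t • (θ : Space N)) *
        fderiv ℝ w (Real.exp t • (θ : Space N)) (Real.exp t • (θ : Space N))) (sphMeasure N) :=
    integrable_sphere (hE.mul hE)
  have i2 : Integrable (fun θ : Sph N =>
      w (Real.exp t • (θ : Space N)) * w (Real.exp t • (θ : Space N))) (sphMeasure N) :=
    integrable_sphere (hf.continuous.mul hf.continuous)
  have i3 : Integrable (fun θ : Sph N => ∑ i, ∑ j,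
      fderiv ℝ (fun x => w (Real.exp t • x)) θ (rot i j (θ : Space N)) *
        fderiv ℝ (fun x => w (Real.exp t • x)) θ (rot i j (θ : Space N))) (sphMeasure N) :=
    integrable_finsetSum _ fun i _ => integrable_finsetSum _ fun j _ =>
      integrable_sphere ((continuous_fderiv_rot hf i j).mul (continuous_fderiv_rot hf i j))
  have e1 := integral_add i1 (i3.const_mul (1 / 2))
  have e2 := integral_sub (i1.add (i3.const_mul (1 / 2))) (i2.const_mul (sphEigenvalue N κ))
  simp only [Pi.add_apply] at e2
  rw [sphInner, sphInner, sphDirichlet, ← integral_const_mul, ← integral_const_mul, ← e1, ← e2]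
  refine integral_congr_ae (Eventually.of_forall fun θ => ?_)
  simp only [cylDensity, fderiv_comp_smul hw, ← rot_smul]
  ring

/-- Differentiation under the integral: the derivative along rays is $x\cdot\nabla w$, which is
bounded because it is continuous with compact support. -/
theorem hasDerivAt_integral_sphere {w g : Space N → ℝ} (hw : IsPuncturedTest w)
    (hg : Continuous g) (t : ℝ) :
    HasDerivAt (fun t => sphInner (fun x => w (Real.exp t • x)) g)
      (sphInner (fun x => fderiv ℝ w (Real.exp t • x) (Real.exp t • x)) g) t := by
  have hEc := continuous_euler hw.contDiff
  have hEs : HasCompactSupport fun x => fderiv ℝ w x x :=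
    (hasCompactSupport_of_vanishing hw fun x hx => by
      simp [fderiv_eq_zero_of_notMem_tsupport hx]).1
  obtain ⟨C, hC⟩ := hEs.exists_bound_of_continuous hEc
  have hs : ∀ t, Continuous fun x : Space N => Real.exp t • x := fun t => continuous_const_smul _
  have hF : ∀ t, Continuous fun x : Space N => w (Real.exp t • x) * g x :=
    fun t => (hw.contDiff.continuous.comp (hs t)).mul hg
  have hF' : ∀ t, Continuous fun x : Space N =>
      fderiv ℝ w (Real.exp t • x) (Real.exp t • x) * g x := fun t => (hEc.comp (hs t)).mul hg
  refine (hasDerivAt_integral_of_dominated_loc_of_deriv_le (s := Set.univ)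
    (F' := fun t (θ : Sph N) => fderiv ℝ w (Real.exp t • (θ : Space N)) (Real.exp t • (θ : Space N))
      * g θ) (bound := fun θ : Sph N => C * ‖g θ‖) Filter.univ_mem
    (Eventually.of_forall fun t => (integrable_sphere (hF t)).aestronglyMeasurable)
    (integrable_sphere (hF t)) (integrable_sphere (hF' t)).aestronglyMeasurable ?_
    (integrable_sphere (continuous_const.mul hg.norm)) ?_).2
  · refine Eventually.of_forall fun θ s _ => ?_
    rw [norm_mul]
    exact mul_le_mul_of_nonneg_right (hC _) (norm_nonneg _)
  · exact Eventually.of_forall fun θ s _ => (hasDerivAt_ray hw.contDiff (θ : Space N) s).mul_const _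

theorem continuous_integral_sphere {F g : Space N → ℝ} (hF : Continuous F)
    (hg : Continuous g) : Continuous fun t => sphInner (fun x => F (Real.exp t • x)) g := by
  have h : Continuous (Function.uncurry fun (t : ℝ) (θ : Sph N) =>
      F (Real.exp t • (θ : Space N)) * g θ) := by
    refine (hF.comp ?_).mul (hg.comp (continuous_subtype_val.comp continuous_snd))
    exact (Real.continuous_exp.comp continuous_fst).smul
      (continuous_subtype_val.comp continuous_snd)
  have := continuous_parametric_integral_of_continuous (μ := sphMeasure N) h isCompact_univ
  simpa [sphInner] using this

theorem hasCompactSupport_mul_sq {f : ℝ → ℝ} (hs : HasCompactSupport f) (g : ℝ → ℝ) :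
    HasCompactSupport fun t => g t * f t ^ 2 :=
  HasCompactSupport.intro hs fun t ht => by
    rw [image_eq_zero_of_notMem_tsupport ht, zero_pow two_ne_zero, mul_zero]

theorem integrable_mul_sq {g f : ℝ → ℝ} (hg : Continuous g) (hf : Continuous f)
    (hs : HasCompactSupport f) : Integrable fun t => g t * f t ^ 2 :=
  (hg.mul (hf.pow 2)).integrable_of_hasCompactSupport (hasCompactSupport_mul_sq hs g)

/-- The linearized energy is nonnegative on functions which are orthogonal to finitely many
harmonics on the unit sphere. -/
theorem integral_density_nonneg {α κ : ℝ} (hN : 3 ≤ N) (hα : 0 < α)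
    (hκ : 2 * κ = 2 + α) {d : ℕ} {Z : Fin d → MvPolynomial (Fin N) ℝ}
    (hZ1 : ∀ f : Space N → ℝ, Continuous f → ∑ i, sphInner f (pfun (Z i)) ^ 2 ≤ sphInner f f)
    (hZ2 : ∀ f : Space N → ℝ, ContDiff ℝ ∞ f →
        sphEigenvalue N κ * (sphInner f f - ∑ i, sphInner f (pfun (Z i)) ^ 2)
          ≤ 1 / 2 * sphDirichlet f f)
    {v : Space N → ℝ} (hv : IsPuncturedTest v) (hvZ : ∀ i, sphInner v (pfun (Z i)) = 0) :
    0 ≤ ∫ x, density α v x := by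
  set β : ℝ := (N - 2) / 2 with hβd
  have hβ : 2 * β = N - 2 := by rw [hβd]; ring
  have hκ0 : 0 < κ := by linarith
  have hpinv : ContDiff ℝ ∞ fun t => (profile β κ t)⁻¹ :=
    (contDiff_profile β κ).inv fun t => (profile_pos β κ t).ne'
  -- Division by the ground state is harmless, since $v$ vanishes near the origin and the profile is
  -- positive.
  set w : Space N → ℝ := fun x => radial (fun t => (profile β κ t)⁻¹) x * v x with hwd
  have hw : IsPuncturedTest w := hv.radial_mul hpinv
  have hvw : v = fun x => radial (profile β κ) x * w x := by
    funext x
    by_cases hx : x = 0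
    · subst hx
      simp [radial, image_eq_zero_of_notMem_tsupport hv.zero_notMem]
    · rw [hwd]
      simp only [radial_of_ne _ hx]
      rw [← mul_assoc, mul_inv_cancel₀ (profile_pos _ _ _).ne', one_mul]
  rw [hvw, integral_density hN hα hβ hκ hw]
  have hcs := cylDensity_support (κ := κ) hw
  have hint := integrable_polar (continuous_cylDensity hw.contDiff) hcs.1 hcs.2
    (contDiff_rho β κ).continuous
  rw [integral_prod_symm _ hint]
  have hq : ∀ i, Continuous (pfun (Z i)) := fun i => (contDiff_pfun _).continuous
  set a : Fin d → ℝ → ℝ := fun i t => sphInner (fun x => w (Real.exp t • x)) (pfun (Z i)) with ha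
  set a' : Fin d → ℝ → ℝ := fun i t =>
    sphInner (fun x => fderiv ℝ w (Real.exp t • x) (Real.exp t • x)) (pfun (Z i)) with ha'
  have hda : ∀ i t, HasDerivAt (a i) (a' i t) t := fun i t => hasDerivAt_integral_sphere hw (hq i) t
  have hderiv : ∀ i, deriv (a i) = a' i := fun i => funext fun t => (hda i t).deriv
  have haC : ∀ i, ContDiff ℝ 1 (a i) := fun i => by
    rw [contDiff_one_iff_deriv]
    refine ⟨fun t => (hda i t).differentiableAt, ?_⟩
    rw [hderiv]
    exact continuous_integral_sphere (continuous_euler hw.contDiff) (hq i)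
  have has : ∀ i, HasCompactSupport (a i) := fun i => by
    obtain ⟨T, hT⟩ := exists_support_annulus hw.hasCompactSupport hw.zero_notMem
    refine HasCompactSupport.intro (K := Set.Icc (-T) T) isCompact_Icc fun t ht => ?_
    simp only [ha, sphInner]
    refine integral_eq_zero_of_ae (Eventually.of_forall fun θ => ?_)
    simp [image_eq_zero_of_notMem_tsupport (hT θ t ht)]
  -- The unit sphere is $t=0$, where the profile is a constant. So the orthogonality conditions on
  -- $v$ say that each coefficient vanishes at the zero of $\sinh(\kappa t)$.
  have ha0 : ∀ i, a i 0 = 0 := fun i => by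
    have : a i 0 = (profile β κ 0)⁻¹ * sphInner v (pfun (Z i)) := by
      simp only [ha, sphInner]
      rw [← integral_const_mul]
      refine integral_congr_ae (Eventually.of_forall fun θ => ?_)
      simp only [hwd]
      rw [radial_exp_smul, Real.exp_zero, one_smul]
      ring
    rw [this, hvZ, mul_zero]
  have hP : ∀ i, 0 ≤ ∫ t, rho β κ t * (deriv (a i) t ^ 2 - κ * (κ + 2 * β) * a i t ^ 2) := fun i =>
    weighted_poincare hκ0 (haC i) (ha0 i) (has i)
  have hPi : ∀ i, Integrable fun t =>
      rho β κ t * (deriv (a i) t ^ 2 - κ * (κ + 2 * β) * a i t ^ 2) := fun i => by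
    have h1 := (contDiff_rho β κ).continuous
    have h2 := (haC i).continuous_deriv le_rfl
    have h3 := (haC i).continuous
    refine Continuous.integrable_of_hasCompactSupport (by fun_prop) ?_
    refine HasCompactSupport.mul_left ?_
    refine HasCompactSupport.sub ((has i).deriv.comp_left (g := fun y : ℝ => y ^ 2) (by simp)) ?_
    exact ((has i).comp_left (g := fun y : ℝ => y ^ 2) (by simp)).mul_left
  calc (0 : ℝ) ≤ ∑ i, ∫ t, rho β κ t * (deriv (a i) t ^ 2 - κ * (κ + 2 * β) * a i t ^ 2) :=
        Finset.sum_nonneg fun i _ => hP i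
    _ = ∫ t, ∑ i, rho β κ t * (deriv (a i) t ^ 2 - κ * (κ + 2 * β) * a i t ^ 2) :=
        (integral_finsetSum _ fun i _ => hPi i).symm
    _ ≤ _ := by
        refine integral_mono (integrable_finsetSum _ fun i _ => hPi i) hint.integral_prod_right
          fun t => ?_
        simp only
        rw [integral_const_mul, integral_sphere_cylDensity hw.contDiff, ← Finset.mul_sum]
        refine mul_le_mul_of_nonneg_left ?_ (rho_pos β κ t).le
        -- At fixed $t$, Bessel's inequality bounds $\|w_t\|^2$ below by the squares of the $a_i'$,
        -- and the spectral gap absorbs everything in $w$ except the $a_i^2$.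
        have h1 := hZ1 _ ((continuous_euler hw.contDiff).comp
          (continuous_const_smul (Real.exp t)))
        have h2 := hZ2 _ (contDiff_comp_smul hw.contDiff (Real.exp t))
        have hlam : κ * (κ + 2 * β) = sphEigenvalue N κ := by rw [sphEigenvalue, hβ]
        rw [Finset.sum_sub_distrib, ← Finset.mul_sum, hlam]
        simp only [hderiv]
        simp only [ha, ha']
        simp only [Function.comp_def] at h1
        linarith

/-! ### Energy of separated functions, and cutoffs in the radial variable -/

theorem integral_polar_mul_add {g₁ g₂ : ℝ → ℝ} {f₁ f₂ : Sph N → ℝ} (hg₁ : Integrable g₁)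
    (hg₂ : Integrable g₂) (hf₁ : Integrable f₁ (sphMeasure N))
    (hf₂ : Integrable f₂ (sphMeasure N)) :
    ∫ p : Sph N × ℝ, (g₁ p.2 * f₁ p.1 + g₂ p.2 * f₂ p.1) ∂((sphMeasure N).prod volume) =
      (∫ t, g₁ t) * ∫ θ, f₁ θ ∂(sphMeasure N) + (∫ t, g₂ t) * ∫ θ, f₂ θ ∂(sphMeasure N) := by
  rw [integral_add, integral_polar_mul, integral_polar_mul]
  · exact (hf₁.mul_prod hg₁).congr (Eventually.of_forall fun p => mul_comm _ _)
  · exact (hf₂.mul_prod hg₂).congr (Eventually.of_forall fun p => mul_comm _ _)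

/-- The linearized energy of a function with separated variables. -/
theorem integral_density_separated {α β κ : ℝ} (hN : 3 ≤ N) (hα : 0 < α) (hβ : 2 * β = N - 2)
    (hκ : 2 * κ = 2 + α) {χ : ℝ → ℝ} (hχ : ContDiff ℝ ∞ χ) (hχs : HasCompactSupport χ)
    {y : Space N → ℝ} (hy : ContDiff ℝ ∞ y) :
    IsPuncturedTest (fun x => radial (profile β κ) x * (radial χ x * y (‖x‖⁻¹ • x))) ∧
    ∫ x, density α (fun x => radial (profile β κ) x * (radial χ x * y (‖x‖⁻¹ • x))) x =
      (∫ t, rho β κ t * deriv χ t ^ 2) * sphInner y y + (∫ t, rho β κ t * χ t ^ 2) *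
        (1 / 2 * sphDirichlet y y - sphEigenvalue N κ * sphInner y y) := by
  have hw : IsPuncturedTest fun x : Space N => radial χ x * y (‖x‖⁻¹ • x) :=
    isPuncturedTest_radial_mul hχ hχs fun x hx => contDiffAt_comp_normalize hy hx
  refine ⟨hw.radial_mul (contDiff_profile β κ), ?_⟩
  rw [integral_density hN hα hβ hκ hw]
  set w := fun x : Space N => radial χ x * y (‖x‖⁻¹ • x) with hwd
  have hray : ∀ (θ : Sph N) (t : ℝ), w (Real.exp t • (θ : Space N)) = χ t * y θ := fun θ t => by
    simp only [hwd]; rw [radial_exp_smul, inv_norm_smul_exp_smul]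
  have hE : ∀ (θ : Sph N) (t : ℝ), fderiv ℝ w (Real.exp t • (θ : Space N))
      (Real.exp t • (θ : Space N)) = deriv χ t * y θ := fun θ t => by
    have h1 := hasDerivAt_ray hw.contDiff (θ : Space N) t
    have h2 := ((hχ.differentiable (by simp)) t).hasDerivAt.mul_const (y θ)
    simp_rw [hray] at h1
    exact h1.unique h2
  have hR : ∀ (θ : Sph N) (t : ℝ) (i j : Fin N), fderiv ℝ w (Real.exp t • (θ : Space N))
      (rot i j (Real.exp t • (θ : Space N))) = χ t * fderiv ℝ y θ (rot i j (θ : Space N)) :=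
    fun θ t i j => fderiv_radial_mul_normalize_rot (hχ.differentiable (by simp))
      (hy.differentiable (by simp)) i j t θ
  have hpt : ∀ p : Sph N × ℝ, rho β κ p.2 * cylDensity κ w (Real.exp p.2 • (p.1 : Space N)) =
      (rho β κ p.2 * deriv χ p.2 ^ 2) * (y p.1 * y p.1) + (rho β κ p.2 * χ p.2 ^ 2) *
        (1 / 2 * ∑ i, ∑ j, fderiv ℝ y p.1 (rot i j (p.1 : Space N)) *
          fderiv ℝ y p.1 (rot i j (p.1 : Space N)) - sphEigenvalue N κ * (y p.1 * y p.1)) := by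
    intro p
    simp only [cylDensity, hE, hR, hray]
    have : ∑ i, ∑ j, χ p.2 * fderiv ℝ y p.1 (rot i j (p.1 : Space N)) *
        (χ p.2 * fderiv ℝ y p.1 (rot i j (p.1 : Space N))) = χ p.2 ^ 2 *
        ∑ i, ∑ j, fderiv ℝ y p.1 (rot i j (p.1 : Space N)) *
          fderiv ℝ y p.1 (rot i j (p.1 : Space N)) := by
      simp_rw [Finset.mul_sum]
      exact Finset.sum_congr rfl fun i _ => Finset.sum_congr rfl fun j _ => by ring
    rw [this]
    ring
  have hrho := (contDiff_rho β κ).continuous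
  have i1 : Integrable (fun θ : Sph N => y θ * y θ) (sphMeasure N) :=
    integrable_sphere (hy.continuous.mul hy.continuous)
  have i2 : Integrable (fun θ : Sph N => ∑ i, ∑ j, fderiv ℝ y θ (rot i j (θ : Space N)) *
      fderiv ℝ y θ (rot i j (θ : Space N))) (sphMeasure N) :=
    integrable_finsetSum _ fun i _ => integrable_finsetSum _ fun j _ =>
      integrable_sphere ((continuous_fderiv_rot hy i j).mul (continuous_fderiv_rot hy i j))
  have j1 : Integrable fun t => rho β κ t * deriv χ t ^ 2 :=
    integrable_mul_sq hrho (hχ.continuous_deriv (by simp)) hχs.deriv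
  have j2 : Integrable fun t => rho β κ t * χ t ^ 2 :=
    integrable_mul_sq hrho hχ.continuous hχs
  have e := integral_polar_mul_add j1 j2 i1
    ((i2.const_mul (1 / 2)).sub (i1.const_mul (sphEigenvalue N κ)))
  have e2 := integral_sub (i2.const_mul (1 / 2)) (i1.const_mul (sphEigenvalue N κ))
  rw [integral_const_mul, integral_const_mul] at e2
  simp only [Pi.sub_apply] at e
  rw [e2] at e
  rw [sphInner, sphDirichlet, ← e]
  exact integral_congr_ae (Eventually.of_forall hpt)

theorem exists_bump {r R : ℝ} (hr : 0 < r) (hR : r < R) :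
    ∃ η : ℝ → ℝ, ContDiff ℝ ∞ η ∧ HasCompactSupport η ∧ (∀ t, |t| ≤ r → η t = 1) ∧
      (∀ t, R ≤ |t| → η t = 0) ∧ (∀ t, 0 ≤ η t) ∧ ∀ t, η t ≤ 1 := by
  let η : ContDiffBump (0 : ℝ) := ⟨r, R, hr, hR⟩
  refine ⟨η, η.contDiff, η.hasCompactSupport, fun t ht => ?_, fun t ht => ?_, fun t => η.nonneg,
    fun t => η.le_one⟩
  · exact η.one_of_mem_closedBall (by simpa using ht)
  · exact η.zero_of_le_dist (by simpa using ht)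

/-- Cutoffs for which the derivative has small weighted norm. -/
theorem exists_cutoff {β κ : ℝ} (hβ : 0 ≤ β) (hκ : 0 < κ) {δ : ℝ} (hδ : 0 < δ) :
    ∃ χ : ℝ → ℝ, ContDiff ℝ ∞ χ ∧ HasCompactSupport χ ∧ 0 < ∫ t, rho β κ t * χ t ^ 2 ∧
      ∫ t, rho β κ t * deriv χ t ^ 2 < δ * ∫ t, rho β κ t * χ t ^ 2 := by
  -- The cutoff is a dilation of `η`. The fixed bump `η₂`, supported where every dilation by a
  -- factor at least $1$ equals $1$, gives a lower bound for the weighted mass that does not depend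
  -- on the dilation.
  obtain ⟨η, hη, hηs, hη1, -, -, -⟩ := exists_bump one_pos one_lt_two
  obtain ⟨η₂, hη₂, hη₂s, hη₂1, hη₂0, hη₂p, hη₂l⟩ := exists_bump (r := 1 / 2) (R := 1)
    (by norm_num) (by norm_num)
  have hrho := (contDiff_rho β κ).continuous
  have hrho1 : ∀ t, rho β κ t ≤ 1 := fun t => by
    refine Real.rpow_le_one_of_one_le_of_nonpos (Real.one_le_cosh _) ?_
    rw [neg_nonpos]; positivity
  have hd : Continuous (deriv η) := hη.continuous_deriv (by simp)
  set D := ∫ t, deriv η t ^ 2 with hD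
  set c := ∫ t, rho β κ t * η₂ t ^ 2 with hc
  have hηi : ∀ {f : ℝ → ℝ}, Continuous f → HasCompactSupport f → ∀ n : ℝ, 0 < n →
      Integrable fun t => rho β κ t * f (n⁻¹ * t) ^ 2 := by
    intro f hf hfs n hn
    have h1 : HasCompactSupport fun t => f (n⁻¹ * t) :=
      hfs.comp_homeomorph (Homeomorph.mulLeft₀ n⁻¹ (inv_pos.2 hn).ne')
    exact integrable_mul_sq hrho (by fun_prop) h1
  have hc0 : 0 < c := by
    refine Continuous.integral_pos_of_hasCompactSupport_nonneg_nonzero (x := 0) ?_ ?_ ?_ ?_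
    · exact hrho.mul (hη₂.continuous.pow 2)
    · exact hasCompactSupport_mul_sq hη₂s _
    · exact fun t => mul_nonneg (rho_pos β κ t).le (sq_nonneg _)
    · have : η₂ 0 = 1 := hη₂1 0 (by simp)
      simp [this, (rho_pos β κ 0).ne']
  have hD0 : 0 ≤ D := integral_nonneg fun t => sq_nonneg _
  have hdc : 0 < δ * c := by positivity
  -- As $\rho\le1$, the weighted energy of the cutoff is at most $D/n$; this choice gives $\delta
  -- c\,n=D+\delta c>D$, and the summand $1$ ensures $n\ge1$.
  set n : ℝ := D / (δ * c) + 1 with hn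
  have hn1 : 1 ≤ n := by rw [hn]; linarith [div_nonneg hD0 hdc.le]
  have hn0 : 0 < n := by linarith
  have hχ : ContDiff ℝ ∞ fun t => η (n⁻¹ * t) := hη.comp (contDiff_const.mul contDiff_id)
  have hχd : ∀ t, deriv (fun t => η (n⁻¹ * t)) t = n⁻¹ * deriv η (n⁻¹ * t) := fun t => by
    rw [deriv_comp_mul_left, smul_eq_mul]
  have hlow : c ≤ ∫ t, rho β κ t * η (n⁻¹ * t) ^ 2 := by
    refine integral_mono ?_ (hηi hη.continuous hηs n hn0) fun t => ?_
    · exact integrable_mul_sq hrho hη₂.continuous hη₂s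
    · refine mul_le_mul_of_nonneg_left ?_ (rho_pos β κ t).le
      rcases le_total 1 |t| with ht | ht
      · rw [hη₂0 t ht, zero_pow two_ne_zero]
        exact sq_nonneg _
      · have h1 : η (n⁻¹ * t) = 1 := by
          refine hη1 _ ?_
          rw [abs_mul, abs_inv, abs_of_pos hn0]
          have h2 : n⁻¹ ≤ 1 := inv_le_one_of_one_le₀ hn1
          exact mul_le_one₀ h2 (abs_nonneg t) ht
        rw [h1, one_pow]
        exact pow_le_one₀ (hη₂p t) (hη₂l t)
  refine ⟨fun t => η (n⁻¹ * t), hχ, hηs.comp_homeomorph (Homeomorph.mulLeft₀ n⁻¹ (inv_pos.2 hn0).ne'),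
    hc0.trans_le hlow, ?_⟩
  have hup : ∫ t, rho β κ t * deriv (fun t => η (n⁻¹ * t)) t ^ 2 ≤ D / n := by
    have e : ∫ t, n⁻¹ ^ 2 * deriv η (n⁻¹ * t) ^ 2 = D / n := by
      rw [integral_const_mul, Measure.integral_comp_mul_left (fun t => deriv η t ^ 2), inv_inv,
        abs_of_pos hn0, smul_eq_mul, ← hD]
      field_simp
    rw [← e]
    have hi2 : Integrable fun t => deriv η t ^ 2 :=
      by simpa using integrable_mul_sq (continuous_const (y := (1 : ℝ))) hd hηs.deriv
    refine integral_mono ?_ ((hi2.comp_mul_left' (inv_pos.2 hn0).ne').const_mul _) fun t => ?_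
    · have e' : (fun t => rho β κ t * deriv (fun t => η (n⁻¹ * t)) t ^ 2) =
          fun t => n⁻¹ ^ 2 * (rho β κ t * deriv η (n⁻¹ * t) ^ 2) := by
        funext t; rw [hχd]; ring
      rw [e']
      exact (hηi hd hηs.deriv n hn0).const_mul _
    · simp only [hχd, mul_pow]
      have h1 := hrho1 t
      have h2 : 0 ≤ n⁻¹ ^ 2 * deriv η (n⁻¹ * t) ^ 2 := by positivity
      nlinarith
  refine hup.trans_lt ?_
  have : D / n < δ * c := by
    rw [div_lt_iff₀ hn0, hn]
    have : δ * c * (D / (δ * c) + 1) = D + δ * c := by field_simp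
    rw [this]
    linarith
  exact this.trans_le (mul_le_mul_of_nonneg_left hlow hδ.le)

end Henon

/-! ### Weak gradients and the space $D^{1,2}$ -/

namespace Henon

variable {N : ℕ}

theorem _root_.MeasureTheory.LocallyIntegrable.coord {g : Space N → Space N}
    (hg : LocallyIntegrable g volume) (i : Fin N) : LocallyIntegrable (fun x => g x i) volume := by
  intro x
  obtain ⟨s, hs, hi⟩ := hg x
  exact ⟨s, hs, (EuclideanSpace.proj (𝕜 := ℝ) i).integrable_comp hi⟩

theorem integrable_locallyIntegrable_mul {f φ : Space N → ℝ} (hf : LocallyIntegrable f volume)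
    (hφ : Continuous φ) (hc : HasCompactSupport φ) : Integrable (fun x => f x * φ x) := by
  simpa [mul_comm] using hf.integrable_smul_left_of_hasCompactSupport hφ hc

/-- Coordinatewise, two weak gradients have the same integrals against all test functions. Hence the
choice made in `weakGradient` does not affect the energy. -/
theorem HasWeakGradient.ae_eq {u : Space N → ℝ} {g g' : Space N → Space N}
    (h : HasWeakGradient u g) (h' : HasWeakGradient u g') : g =ᵐ[volume] g' := by
  have : ∀ i : Fin N, (fun x => g x i) =ᵐ[volume] fun x => g' x i := by
    intro i
    refine ae_eq_of_integral_contDiff_smul_eq (h.2.1.coord i) (h'.2.1.coord i) fun φ hφ hc => ?_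
    have e := (h.2.2 φ hφ hc i).symm.trans (h'.2.2 φ hφ hc i)
    simpa [mul_comm] using e
  filter_upwards [ae_all_iff.2 this] with x hx
  ext i
  exact hx i

theorem HasWeakGradient.weakGradient_ae_eq {u : Space N → ℝ} {g : Space N → Space N}
    (h : HasWeakGradient u g) : weakGradient u =ᵐ[volume] g := by
  have hex : ∃ g, HasWeakGradient u g := ⟨g, h⟩
  rw [weakGradient, dif_pos hex]
  exact hex.choose_spec.ae_eq h

theorem HasWeakGradient.add {u v : Space N → ℝ} {g h : Space N → Space N}
    (hu : HasWeakGradient u g) (hv : HasWeakGradient v h) :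
    HasWeakGradient (u + v) (g + h) := by
  refine ⟨hu.1.add hv.1, hu.2.1.add hv.2.1, fun φ hφ hc i => ?_⟩
  have hd : Continuous fun x => fderiv ℝ φ x (EuclideanSpace.single i 1) :=
    (hφ.continuous_fderiv (by simp)).clm_apply continuous_const
  have hdc : HasCompactSupport fun x => fderiv ℝ φ x (EuclideanSpace.single i 1) :=
    hc.fderiv_apply ℝ _
  have e1 := integral_add (integrable_locallyIntegrable_mul hu.1 hd hdc)
    (integrable_locallyIntegrable_mul hv.1 hd hdc)
  have e2 := integral_add (integrable_locallyIntegrable_mul (hu.2.1.coord i) hφ.continuous hc)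
    (integrable_locallyIntegrable_mul (hv.2.1.coord i) hφ.continuous hc)
  simp only [Pi.add_apply, PiLp.add_apply, add_mul]
  rw [e1, e2, hu.2.2 φ hφ hc i, hv.2.2 φ hφ hc i]
  ring

theorem HasWeakGradient.smul {u : Space N → ℝ} {g : Space N → Space N}
    (hu : HasWeakGradient u g) (c : ℝ) : HasWeakGradient (c • u) (c • g) := by
  refine ⟨hu.1.smul c, hu.2.1.smul c, fun φ hφ hc i => ?_⟩
  simp only [Pi.smul_apply, PiLp.smul_apply, smul_eq_mul, mul_assoc, integral_const_mul]
  rw [hu.2.2 φ hφ hc i]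
  ring

theorem hasWeakGradient_zero : HasWeakGradient (0 : Space N → ℝ) 0 := by
  refine ⟨locallyIntegrable_zero, locallyIntegrable_zero, fun φ _ _ i => ?_⟩
  simp

/-- The space `D^{1,2}(ℝ^N)`, as a space of functions. -/
noncomputable def d12 (N : ℕ) : Submodule ℝ (Space N → ℝ) where
  carrier := {u | MemD12 u}
  zero_mem' := ⟨MemLp.zero, 0, hasWeakGradient_zero, MemLp.zero⟩
  add_mem' := by
    rintro u v ⟨hu, g, hg, hg2⟩ ⟨hv, h, hh, hh2⟩
    exact ⟨hu.add hv, g + h, hg.add hh, hg2.add hh2⟩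
  smul_mem' := by
    rintro c u ⟨hu, g, hg, hg2⟩
    exact ⟨hu.const_smul c, c • g, hg.smul c, hg2.const_smul c⟩

theorem MemD12.hasWeakGradient {u : Space N → ℝ} (hu : MemD12 u) :
    HasWeakGradient u (weakGradient u) := by
  obtain ⟨_, g, hg, _⟩ := hu
  have hex : ∃ g, HasWeakGradient u g := ⟨g, hg⟩
  rw [weakGradient, dif_pos hex]
  exact hex.choose_spec

theorem MemD12.memLp_weakGradient {u : Space N → ℝ} (hu : MemD12 u) :
    MemLp (weakGradient u) 2 volume := by
  obtain ⟨_, g, hg, hg2⟩ := hu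
  exact hg2.ae_eq hg.weakGradient_ae_eq.symm

/-- The classical gradient. -/
noncomputable def grad (w : Space N → ℝ) (x : Space N) : Space N :=
  (InnerProductSpace.toDual ℝ (Space N)).symm (fderiv ℝ w x)

theorem norm_grad (w : Space N → ℝ) (x : Space N) : ‖grad w x‖ = ‖fderiv ℝ w x‖ := by
  simp [grad]

theorem grad_apply (w : Space N → ℝ) (x : Space N) (i : Fin N) :
    grad w x i = fderiv ℝ w x (EuclideanSpace.single i 1) := by
  have : inner ℝ (grad w x) (EuclideanSpace.single i 1) =
      fderiv ℝ w x (EuclideanSpace.single i 1) := by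
    rw [grad, InnerProductSpace.toDual_symm_apply]
  rw [← this]
  simp [EuclideanSpace.inner_single_right]

theorem continuous_grad {w : Space N → ℝ} (hw : ContDiff ℝ ∞ w) : Continuous (grad w) :=
  (InnerProductSpace.toDual ℝ (Space N)).symm.continuous.comp (hw.continuous_fderiv (by simp))

theorem hasCompactSupport_grad {w : Space N → ℝ} (hw : HasCompactSupport w) :
    HasCompactSupport (grad w) :=
  (hw.fderiv (𝕜 := ℝ)).comp_left (map_zero _)

theorem hasWeakGradient_grad {w : Space N → ℝ} (hw : ContDiff ℝ ∞ w) :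
    HasWeakGradient w (grad w) := by
  refine ⟨hw.continuous.locallyIntegrable, (continuous_grad hw).locallyIntegrable,
    fun φ hφ hc i => ?_⟩
  simp only [grad_apply]
  have hd : Continuous fun x => fderiv ℝ φ x (EuclideanSpace.single i 1) :=
    (hφ.continuous_fderiv (by simp)).clm_apply continuous_const
  have hdw : Continuous fun x => fderiv ℝ w x (EuclideanSpace.single i 1) :=
    (hw.continuous_fderiv (by simp)).clm_apply continuous_const
  refine integral_mul_fderiv_eq_neg_fderiv_mul_of_integrable ?_ ?_ ?_
    (fun x _ => hw.differentiable (by simp) x) (fun x _ => hφ.differentiable (by simp) x)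
  · exact integrable_locallyIntegrable_mul hdw.locallyIntegrable hφ.continuous hc
  · exact integrable_locallyIntegrable_mul hw.continuous.locallyIntegrable hd (hc.fderiv_apply ℝ _)
  · exact integrable_locallyIntegrable_mul hw.continuous.locallyIntegrable hφ.continuous hc

theorem IsPuncturedTest.memD12 {w : Space N → ℝ} (hw : IsPuncturedTest w) : MemD12 w :=
  ⟨hw.contDiff.continuous.memLp_of_hasCompactSupport hw.hasCompactSupport, grad w,
    hasWeakGradient_grad hw.contDiff,
    (continuous_grad hw.contDiff).memLp_of_hasCompactSupport
      (hasCompactSupport_grad hw.hasCompactSupport)⟩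

theorem IsPuncturedTest.secondVariation_eq {α : ℝ} (hN : 3 ≤ N) (hα : 0 < α) {w : Space N → ℝ}
    (hw : IsPuncturedTest w) :
    secondVariation N α (U N α) w = ∫ x, density α w x := by
  have h1 : ∫ x, ‖weakGradient w x‖ ^ 2 = ∫ x, ‖fderiv ℝ w x‖ ^ 2 := by
    refine integral_congr_ae ?_
    filter_upwards [(hasWeakGradient_grad hw.contDiff).weakGradient_ae_eq] with x hx
    rw [hx, norm_grad]
  have hc := hw.contDiff.continuous_fderiv (n := ∞) (by simp)
  have i1 : Integrable fun x => ‖fderiv ℝ w x‖ ^ 2 := by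
    refine (hc.norm.pow 2).integrable_of_hasCompactSupport
      (hasCompactSupport_of_vanishing hw fun x hx => ?_).1
    simp [fderiv_eq_zero_of_notMem_tsupport hx]
  have i2 : Integrable fun x => pot N α x * w x ^ 2 :=
    integrable_locallyIntegrable_mul (continuous_pot hN hα).locallyIntegrable
      (hw.contDiff.continuous.pow 2)
      (hw.hasCompactSupport.comp_left (g := fun t : ℝ => t ^ 2) (by simp))
  have e := integral_sub i1 i2
  rw [secondVariation, h1]
  exact e.symm

/-- The space of smooth functions with compact support in `ℝ^N ∖ {0}`. -/
def puncturedTest (N : ℕ) : Submodule ℝ (Space N → ℝ) where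
  carrier := {w | IsPuncturedTest w}
  zero_mem' := ⟨contDiff_const, HasCompactSupport.zero, by simp [tsupport]⟩
  add_mem' := by
    rintro u v hu hv
    refine ⟨hu.contDiff.add hv.contDiff, hu.hasCompactSupport.add hv.hasCompactSupport, fun h => ?_⟩
    rcases tsupport_add u v h with h | h
    exacts [hu.zero_notMem h, hv.zero_notMem h]
  smul_mem' := by
    rintro c u hu
    refine ⟨contDiff_const.smul hu.contDiff, hu.hasCompactSupport.smul_left (f := fun _ => c),
      fun h => hu.zero_notMem ?_⟩
    exact tsupport_smul_subset_right (fun _ => c) u h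

end Henon

/-! ### The energy as a continuous form on $L^2\times L^2$ -/

namespace Henon

variable {N : ℕ}

/-- The relation $\frac1N+\frac{N-2}{2N}=\frac12$. It is used with $\sqrt V\in L^N$ for the
potential term and with $\nabla\psi\in L^N$ for cutoffs, so no Sobolev inequality is needed beyond
the membership $u\in L^{2^*}$. -/
theorem holderTriple_criticalExponent (hN : 3 ≤ N) :
    ENNReal.HolderTriple (N : ENNReal) (criticalExponent N) 2 := by
  have h3 : (3 : ℝ) ≤ N := by exact_mod_cast hN
  have hp : (0 : ℝ) < 2 * N / (N - 2) := div_pos (by linarith) (by linarith)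
  constructor
  rw [criticalExponent, ← ENNReal.ofReal_natCast N, ← ENNReal.ofReal_inv_of_pos (by linarith),
    ← ENNReal.ofReal_inv_of_pos hp, ← ENNReal.ofReal_add (by positivity) (by positivity)]
  rw [show (2 : ENNReal) = ENNReal.ofReal 2 by simp, ← ENNReal.ofReal_inv_of_pos (by norm_num)]
  congr 1
  have : (N : ℝ) - 2 ≠ 0 := by linarith
  field_simp
  ring

/-- The potential is bounded near $0$ and $O(|x|^{-4-\alpha})$ at infinity. The decay $(1+|x|)^{-2}$
of its root suffices, because its $N$-th power is integrable; the $16=2^4$ comes from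
$1+r\le2\max(1,r)$. -/
theorem pot_le {α : ℝ} (hN : 3 ≤ N) (hα : 0 < α) :
    ∃ C : ℝ, 0 ≤ C ∧ ∀ x : Space N, √(pot N α x) ≤ C * (1 + ‖x‖) ^ (-2 : ℝ) := by
  refine ⟨√(((N : ℝ) + α) * (N + 2 + 2 * α) * 16), Real.sqrt_nonneg _, fun x => ?_⟩
  have hr := norm_nonneg x
  set r := ‖x‖ with hrd
  have e : (1 + r) ^ (-2 : ℝ) = √(((1 + r) ^ 4)⁻¹) := by
    have : ((1 + r) ^ 4)⁻¹ = (((1 + r) ^ 2)⁻¹) ^ 2 := by rw [inv_pow]; ring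
    rw [this, Real.sqrt_sq (by positivity), Real.rpow_neg (by positivity)]
    norm_cast
  rw [e, ← Real.sqrt_mul (by positivity), pot_eq hN hα, ← hrd]
  refine Real.sqrt_le_sqrt ?_
  rw [mul_assoc (((N : ℝ) + α) * _)]
  refine mul_le_mul_of_nonneg_left ?_ (by positivity)
  rw [div_le_iff₀ (by positivity), mul_assoc, ← div_eq_inv_mul, mul_div_assoc',
    le_div_iff₀ (by positivity)]
  have hs : 0 ≤ r ^ (2 + α) := by positivity
  rcases le_total r 1 with h | h
  · have h1 : r ^ α ≤ 1 := Real.rpow_le_one hr h hα.le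
    have h2 : (1 + r) ^ 4 ≤ 16 := by
      calc (1 + r) ^ 4 ≤ (1 + 1) ^ 4 := by gcongr
        _ = 16 := by norm_num
    have h3 : r ^ α * (1 + r) ^ 4 ≤ 1 * 16 := by gcongr
    nlinarith
  · have h2 : (1 + r) ^ 4 ≤ 16 * r ^ 4 := by
      calc (1 + r) ^ 4 ≤ (r + r) ^ 4 := by gcongr
        _ = 16 * r ^ 4 := by ring
    have h1 : r ^ α ≤ r ^ (2 * α) := Real.rpow_le_rpow_of_exponent_le h (by linarith)
    have h4 : r ^ (2 * α) * r ^ 4 = (r ^ (2 + α)) ^ 2 := by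
      have h0 : 0 < r := by linarith
      rw [← Real.rpow_natCast r 4, ← Real.rpow_add h0, ← Real.rpow_natCast _ 2,
        ← Real.rpow_mul hr]
      congr 1
      push_cast
      ring
    have h5 : r ^ α * (1 + r) ^ 4 ≤ r ^ (2 * α) * (16 * r ^ 4) := by gcongr
    nlinarith

theorem continuous_sqrt_pot {α : ℝ} (hN : 3 ≤ N) (hα : 0 < α) :
    Continuous fun x : Space N => √(pot N α x) :=
  (continuous_pot hN hα).sqrt

theorem memLp_sqrt_pot {α : ℝ} (hN : 3 ≤ N) (hα : 0 < α) :
    MemLp (fun x : Space N => √(pot N α x)) N volume := by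
  obtain ⟨C, hC, hle⟩ := pot_le hN hα
  have hc : Continuous fun x : Space N => (1 + ‖x‖) ^ (-2 : ℝ) :=
    (continuous_const.add continuous_norm).rpow_const fun x => Or.inl (add_pos_of_pos_of_nonneg one_pos (norm_nonneg x)).ne'
  have h1 : MemLp (fun x : Space N => (1 + ‖x‖) ^ (-2 : ℝ)) N volume := by
    rw [← integrable_norm_rpow_iff hc.aestronglyMeasurable (by simp; omega) (by simp)]
    have h2 : Integrable fun x : Space N => (1 + ‖x‖) ^ (-(2 * (N : ℝ))) := by
      refine integrable_one_add_norm ?_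
      have : (3 : ℝ) ≤ N := by exact_mod_cast hN
      simp
      linarith
    refine h2.congr (Eventually.of_forall fun x => ?_)
    have hx : 0 ≤ 1 + ‖x‖ := by positivity
    simp only [ENNReal.toReal_natCast]
    rw [Real.norm_of_nonneg (by positivity), ← Real.rpow_mul hx]
    ring_nf
  refine (h1.const_mul C).of_le (continuous_sqrt_pot hN hα).aestronglyMeasurable
    (Eventually.of_forall fun x => ?_)
  rw [Real.norm_of_nonneg (Real.sqrt_nonneg _)]
  exact (hle x).trans (le_abs_self _)

theorem exists_sqrt_pot_le {α : ℝ} (hN : 3 ≤ N) (hα : 0 < α) :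
    ∃ C : ℝ, 0 ≤ C ∧ ∀ x : Space N, √(pot N α x) ≤ C := by
  obtain ⟨C, hC, hle⟩ := pot_le (N := N) hN hα
  refine ⟨C, hC, fun x => (hle x).trans ?_⟩
  have : (1 + ‖x‖) ^ (-2 : ℝ) ≤ 1 :=
    Real.rpow_le_one_of_one_le_of_nonpos (by linarith [norm_nonneg x]) (by norm_num)
  nlinarith

theorem memLp_sqrt_pot_mul {α : ℝ} (hN : 3 ≤ N) (hα : 0 < α) {v : Space N → ℝ}
    (hv : MemLp v (criticalExponent N) volume) :
    MemLp (fun x => √(pot N α x) * v x) 2 volume := by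
  have := holderTriple_criticalExponent hN
  exact hv.smul (memLp_sqrt_pot hN hα)

theorem norm_toLp_sq {F : Type*} [NormedAddCommGroup F] [InnerProductSpace ℝ F]
    {f : Space N → F} (hf : MemLp f 2 volume) : ‖hf.toLp f‖ ^ 2 = ∫ x, ‖f x‖ ^ 2 := by
  rw [← real_inner_self_eq_norm_sq, L2.inner_def]
  refine integral_congr_ae ?_
  filter_upwards [hf.coeFn_toLp] with x hx
  rw [hx, real_inner_self_eq_norm_sq]

/-- The target of `energyMap`. -/
abbrev EnergySpace (N : ℕ) : Type := Lp (Space N) 2 (volume : Measure (Space N)) ×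
  Lp ℝ 2 (volume : Measure (Space N))

/-- The map `v ↦ (∇v, √V v)` from `D^{1,2}` to `L^2 × L^2`, where `V` is the potential of the
linearized operator. -/
noncomputable def energyMap {α : ℝ} (hN : 3 ≤ N) (hα : 0 < α) : d12 N →ₗ[ℝ] EnergySpace N where
  toFun v := (v.2.memLp_weakGradient.toLp _, (memLp_sqrt_pot_mul hN hα v.2.1).toLp _)
  map_add' u v := by
    refine Prod.ext ?_ ?_
    · rw [Prod.fst_add, ← MemLp.toLp_add, MemLp.toLp_eq_toLp_iff]
      exact (u.2.hasWeakGradient.add v.2.hasWeakGradient).weakGradient_ae_eq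
    · rw [Prod.snd_add, ← MemLp.toLp_add, MemLp.toLp_eq_toLp_iff]
      exact Eventually.of_forall fun x => by simp [mul_add]
  map_smul' c u := by
    refine Prod.ext ?_ ?_
    · simp only [RingHom.id_apply, Prod.smul_fst]
      rw [← MemLp.toLp_const_smul, MemLp.toLp_eq_toLp_iff]
      exact (u.2.hasWeakGradient.smul c).weakGradient_ae_eq
    · simp only [RingHom.id_apply, Prod.smul_snd]
      rw [← MemLp.toLp_const_smul, MemLp.toLp_eq_toLp_iff]
      exact Eventually.of_forall fun x => by simp [mul_left_comm]

/-- The indefinite form `‖X‖² - ‖z‖²`. -/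
noncomputable def energyForm (p : EnergySpace N) : ℝ := ‖p.1‖ ^ 2 - ‖p.2‖ ^ 2

theorem continuous_energyForm : Continuous (energyForm (N := N)) := by
  unfold energyForm
  fun_prop

theorem energyForm_energyMap {α : ℝ} (hN : 3 ≤ N) (hα : 0 < α) (v : d12 N) :
    energyForm (energyMap hN hα v) = secondVariation N α (U N α) v := by
  have h1 := norm_toLp_sq v.2.memLp_weakGradient
  have h2 := norm_toLp_sq (memLp_sqrt_pot_mul hN hα v.2.1)
  have e : energyForm (energyMap hN hα v) =
    ‖v.2.memLp_weakGradient.toLp _‖ ^ 2 - ‖(memLp_sqrt_pot_mul hN hα v.2.1).toLp _‖ ^ 2 := rfl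
  rw [e, h1, h2, secondVariation]
  congr 1
  refine integral_congr_ae (Eventually.of_forall fun x => ?_)
  simp only [Real.norm_eq_abs, sq_abs, mul_pow, Real.sq_sqrt (pot_nonneg hN hα x)]
  rfl

/-- Convergence in the energy may be tested with any explicit weak gradients instead of the chosen
ones. -/
theorem tendsto_energyMap {α : ℝ} (hN : 3 ≤ N) (hα : 0 < α) {ι : Type*} {l : Filter ι}
    {u : ι → d12 N} {v : d12 N} {g : ι → Space N → Space N} {h : Space N → Space N}
    (hu : ∀ i, HasWeakGradient (u i : Space N → ℝ) (g i))
    (hv : HasWeakGradient (v : Space N → ℝ) h)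
    (h1 : Tendsto (fun i => eLpNorm (g i - h) 2 volume) l (𝓝 0))
    (h2 : Tendsto (fun i => eLpNorm (fun x => √(pot N α x) * ((u i : Space N → ℝ) x -
      (v : Space N → ℝ) x)) 2 volume) l (𝓝 0)) :
    Tendsto (fun i => energyMap hN hα (u i)) l (𝓝 (energyMap hN hα v)) := by
  refine Tendsto.prodMk_nhds ?_ ?_
  · rw [Lp.tendsto_Lp_iff_tendsto_eLpNorm'']
    refine h1.congr fun i => eLpNorm_congr_ae ?_
    exact ((hu i).weakGradient_ae_eq.sub hv.weakGradient_ae_eq).symm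
  · rw [Lp.tendsto_Lp_iff_tendsto_eLpNorm'']
    refine h2.congr fun i => ?_
    congr 1
    ext x
    simp [mul_sub]

end Henon

/-! ### Mollification in $L^2$ -/

namespace Henon

variable {N : ℕ}

/-- The mollification `∫ φ(y) f(x - y) dy`. -/
noncomputable def mollify {F : Type*} [NormedAddCommGroup F] [NormedSpace ℝ F]
    (φ : Space N → ℝ) (f : Space N → F) : Space N → F :=
  convolution φ f (ContinuousLinearMap.lsmul ℝ ℝ) volume

theorem mollify_apply {F : Type*} [NormedAddCommGroup F] [NormedSpace ℝ F]
    (φ : Space N → ℝ) (f : Space N → F) (x : Space N) :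
    mollify φ f x = ∫ y, φ y • f (x - y) := rfl

theorem mollify_congr {F : Type*} [NormedAddCommGroup F] [NormedSpace ℝ F]
    (φ : Space N → ℝ) {f f' : Space N → F} (h : f =ᵐ[volume] f') : mollify φ f = mollify φ f' := by
  ext1 x
  rw [mollify_apply, mollify_apply]
  refine integral_congr_ae ?_
  filter_upwards [(volume.measurePreserving_sub_left x).quasiMeasurePreserving.ae_eq_comp h]
    with y hy
  have : f (x - y) = f' (x - y) := hy
  rw [this]

theorem integrable_mollify {F : Type*} [NormedAddCommGroup F] [NormedSpace ℝ F]
    {φ : Space N → ℝ} (hφ : Continuous φ) (hc : HasCompactSupport φ) {f : Space N → F}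
    (hf : LocallyIntegrable f volume) (x : Space N) : Integrable fun y => φ y • f (x - y) :=
  hc.convolutionExists_left (ContinuousLinearMap.lsmul ℝ ℝ) hφ hf x

/-- The mollification is an average of translates with respect to the probability density $\varphi$.
Its squared error is at most the average of the squared errors, and Tonelli's theorem exchanges the
integrals. -/
theorem lintegral_mollify_sub_le {F : Type*} [NormedAddCommGroup F] [NormedSpace ℝ F]
    [CompleteSpace F] {φ : Space N → ℝ} (hφ : Continuous φ) (hc : HasCompactSupport φ)
    (h0 : ∀ x, 0 ≤ φ x) (h1 : ∫ x, φ x = 1) {f : Space N → F} (hf : LocallyIntegrable f volume)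
    (hm : StronglyMeasurable f) {δ : ENNReal}
    (hδ : ∀ y ∈ Function.support φ, ∫⁻ x, ‖f (x - y) - f x‖ₑ ^ 2 ≤ δ) :
    ∫⁻ x, ‖mollify φ f x - f x‖ₑ ^ 2 ≤ δ := by
  have hφi : Integrable φ := hφ.integrable_of_hasCompactSupport hc
  have hmass : ∫⁻ y, ‖φ y‖ₑ = 1 := by
    have e := ofReal_integral_eq_lintegral_ofReal hφi
      (Eventually.of_forall h0)
    rw [h1, ENNReal.ofReal_one] at e
    rw [e]
    exact lintegral_congr fun y => (Real.enorm_of_nonneg (h0 y))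
  have hmeas : Measurable fun p : Space N × Space N => ‖f (p.1 - p.2) - f p.1‖ₑ := by
    have e1 : StronglyMeasurable fun p : Space N × Space N => f (p.1 - p.2) :=
      hm.comp_measurable (measurable_fst.sub measurable_snd)
    have e2 : StronglyMeasurable fun p : Space N × Space N => f p.1 :=
      hm.comp_measurable measurable_fst
    exact (e1.sub e2).enorm
  have hφm : Measurable fun y => ‖φ y‖ₑ := hφ.enorm.measurable
  have key : ∀ x, ‖mollify φ f x - f x‖ₑ ^ 2 ≤ ∫⁻ y, ‖φ y‖ₑ * ‖f (x - y) - f x‖ₑ ^ 2 := by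
    intro x
    have hx : Measurable fun y => ‖f (x - y) - f x‖ₑ := hmeas.comp measurable_prodMk_left
    have e1 : mollify φ f x - f x = ∫ y, φ y • (f (x - y) - f x) := by
      simp only [smul_sub]
      rw [integral_sub (integrable_mollify hφ hc hf x)
        (hφi.smul_const _), integral_smul_const, h1, one_smul,
        mollify_apply]
    have e2 : ‖mollify φ f x - f x‖ₑ ≤ ∫⁻ y, ‖φ y‖ₑ * ‖f (x - y) - f x‖ₑ := by
      rw [e1]
      refine (enorm_integral_le_lintegral_enorm _).trans_eq (lintegral_congr fun y => ?_)
      rw [enorm_smul]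
    -- Cauchy–Schwarz with the weight split as $\varphi=\varphi^{1/2}\varphi^{1/2}$; the first
    -- factor has total mass one.
    have e3 : ∫⁻ y, ‖φ y‖ₑ * ‖f (x - y) - f x‖ₑ ≤
        (∫⁻ y, ‖φ y‖ₑ) ^ (1 / 2 : ℝ) *
          (∫⁻ y, ‖φ y‖ₑ * ‖f (x - y) - f x‖ₑ ^ 2) ^ (1 / 2 : ℝ) := by
      have h2 : (2 : ℝ).HolderConjugate 2 := Real.HolderConjugate.two_two
      have := ENNReal.lintegral_mul_le_Lp_mul_Lq volume h2
        (f := fun y => ‖φ y‖ₑ ^ (1 / 2 : ℝ))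
        (g := fun y => ‖φ y‖ₑ ^ (1 / 2 : ℝ) * ‖f (x - y) - f x‖ₑ)
        (hφm.pow_const _).aemeasurable ((hφm.pow_const _).mul hx).aemeasurable
      simp only [Pi.mul_apply, ← mul_assoc, ← ENNReal.rpow_add_of_nonneg (1 / 2) (1 / 2 : ℝ)
        (by norm_num) (by norm_num), ENNReal.mul_rpow_of_nonneg _ _ (zero_le_two (α := ℝ)),
        ← ENNReal.rpow_mul] at this
      norm_num at this
      simpa using this
    calc ‖mollify φ f x - f x‖ₑ ^ 2
        ≤ ((∫⁻ y, ‖φ y‖ₑ) ^ (1 / 2 : ℝ) *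
          (∫⁻ y, ‖φ y‖ₑ * ‖f (x - y) - f x‖ₑ ^ 2) ^ (1 / 2 : ℝ)) ^ 2 := by
            gcongr; exact e2.trans e3
      _ = ∫⁻ y, ‖φ y‖ₑ * ‖f (x - y) - f x‖ₑ ^ 2 := by
            rw [hmass, ENNReal.one_rpow, one_mul, ← ENNReal.rpow_natCast, ← ENNReal.rpow_mul]
            norm_num
  calc ∫⁻ x, ‖mollify φ f x - f x‖ₑ ^ 2
      ≤ ∫⁻ x, ∫⁻ y, ‖φ y‖ₑ * ‖f (x - y) - f x‖ₑ ^ 2 := lintegral_mono key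
    _ = ∫⁻ y, ∫⁻ x, ‖φ y‖ₑ * ‖f (x - y) - f x‖ₑ ^ 2 := by
        refine lintegral_lintegral_swap (Measurable.aemeasurable ?_)
        exact (hφm.comp measurable_snd).mul (hmeas.pow_const 2)
    _ = ∫⁻ y, ‖φ y‖ₑ * ∫⁻ x, ‖f (x - y) - f x‖ₑ ^ 2 := by
        refine lintegral_congr fun y => ?_
        rw [lintegral_const_mul' _ _ (by simp)]
    _ ≤ ∫⁻ y, ‖φ y‖ₑ * δ := by
        refine lintegral_mono fun y => ?_
        by_cases hy : y ∈ Function.support φ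
        · gcongr
          exact hδ y hy
        · simp [Function.notMem_support.1 hy]
    _ = δ := by rw [lintegral_mul_const _ hφm, hmass, one_mul]

theorem eLpNorm_two_eq {F : Type*} [NormedAddCommGroup F] (f : Space N → F) :
    eLpNorm f 2 volume = (∫⁻ x, ‖f x‖ₑ ^ 2) ^ (1 / 2 : ℝ) := by
  rw [eLpNorm_eq_lintegral_rpow_enorm_toReal (by simp) (by simp)]
  norm_num

theorem eLpNorm_two_le_iff {F : Type*} [NormedAddCommGroup F] (f : Space N → F) (δ : ENNReal) :
    eLpNorm f 2 volume ≤ δ ↔ ∫⁻ x, ‖f x‖ₑ ^ 2 ≤ δ ^ 2 := by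
  rw [eLpNorm_two_eq, one_div, ENNReal.rpow_inv_le_iff (by norm_num)]
  norm_num

/-- Tonelli's theorem requires joint measurability, so $f$ is replaced by a strongly measurable
representative; the mollification depends only on the class. -/
theorem eLpNorm_mollify_sub_le {F : Type*} [NormedAddCommGroup F] [NormedSpace ℝ F]
    [CompleteSpace F] {φ : Space N → ℝ} (hφ : Continuous φ) (hc : HasCompactSupport φ)
    (h0 : ∀ x, 0 ≤ φ x) (h1 : ∫ x, φ x = 1) {f : Space N → F} (hf : MemLp f 2 volume)
    {δ : ENNReal}
    (hδ : ∀ y ∈ Function.support φ, eLpNorm (fun x => f (x - y) - f x) 2 volume ≤ δ) :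
    eLpNorm (mollify φ f - f) 2 volume ≤ δ := by
  have hae := hf.1.ae_eq_mk
  have hf' : MemLp (hf.1.mk f) 2 volume := hf.ae_eq hae
  have e : mollify φ f - f =ᵐ[volume] fun x => mollify φ (hf.1.mk f) x - hf.1.mk f x := by
    rw [mollify_congr φ hae]
    filter_upwards [hae] with x hx
    simp [← hx]
  rw [eLpNorm_congr_ae e, eLpNorm_two_le_iff]
  refine lintegral_mollify_sub_le hφ hc h0 h1 (hf'.locallyIntegrable (by norm_num))
    hf.1.stronglyMeasurable_mk fun y hy => ?_
  rw [← eLpNorm_two_le_iff (fun x => hf.1.mk f (x - y) - hf.1.mk f x)]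
  refine (eLpNorm_congr_ae ?_).trans_le (hδ y hy)
  filter_upwards [hae, (measurePreserving_sub_right volume y).quasiMeasurePreserving.ae_eq_comp hae]
    with x hx hy
  have : f (x - y) = hf.1.mk f (x - y) := hy
  rw [this, hx]

/-- Continuity of translations in $L^2$, as an instance of continuity of composition with
measure-preserving maps. -/
theorem eventually_eLpNorm_translate_le {F : Type*} [NormedAddCommGroup F]
    {f : Space N → F} (hf : MemLp f 2 volume) {ε : ENNReal} (hε : 0 < ε) :
    ∀ᶠ y in 𝓝 (0 : Space N), eLpNorm (fun x => f (x - y) - f x) 2 volume ≤ ε := by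
  set g : Space N → C(Space N, Space N) := fun y => ⟨fun x => x - y, by fun_prop⟩ with hg
  have hgc : Continuous g :=
    (ContinuousMap.curry ⟨fun p : Space N × Space N => p.2 - p.1, by fun_prop⟩).continuous
  have hmp : ∀ y, MeasurePreserving (g y) volume volume := fun y =>
    measurePreserving_sub_right volume y
  have ht := (tendsto_const_nhds (x := hf.toLp f) (f := 𝓝 (0 : Space N))).compMeasurePreservingLp
    (hgc.tendsto 0) hmp (hmp 0) (by simp)
  have := (EMetric.tendsto_nhds.1 ht) ε hε
  filter_upwards [this] with y hy
  refine le_of_eq_of_le ?_ hy.le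
  rw [Lp.edist_def]
  refine eLpNorm_congr_ae ?_
  have a1 := Lp.coeFn_compMeasurePreserving (hf.toLp f) (hmp y)
  have a2 := Lp.coeFn_compMeasurePreserving (hf.toLp f) (hmp 0)
  have a3 := (hmp y).quasiMeasurePreserving.ae_eq_comp hf.coeFn_toLp
  have a4 := (hmp 0).quasiMeasurePreserving.ae_eq_comp hf.coeFn_toLp
  filter_upwards [a1, a2, a3, a4] with x h1 h2 h3 h4
  simp only [Pi.sub_apply]
  rw [h1, h2, h3, h4]
  simp [hg]

/-- The derivative falls on $\varphi$, and $y\mapsto\varphi(x-y)$ is a test function for the weak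
gradient of $u$. The sign from the reflection cancels the one from the integration by parts. -/
theorem grad_mollify {φ : Space N → ℝ} (hφ : ContDiff ℝ ∞ φ) (hc : HasCompactSupport φ)
    {u : Space N → ℝ} {g : Space N → Space N} (hu : HasWeakGradient u g) :
    grad (mollify φ u) = mollify φ g := by
  ext x i
  have hd := hc.hasFDerivAt_convolution_left (ContinuousLinearMap.lsmul ℝ ℝ)
    (hφ.of_le (by simp)) hu.1 x
  have hfd : Continuous (fderiv ℝ φ) := hφ.continuous_fderiv (by simp)
  have hprec : convolution (fderiv ℝ φ) u
      ((ContinuousLinearMap.lsmul ℝ ℝ).precompL (Space N)) volume x (EuclideanSpace.single i 1) =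
      ∫ y, fderiv ℝ φ y (EuclideanSpace.single i 1) * u (x - y) := by
    have := (hc.fderiv (𝕜 := ℝ)).convolutionExists_left
      ((ContinuousLinearMap.lsmul ℝ ℝ).precompL (Space N)) hfd hu.1 x
    rw [convolution_def, ContinuousLinearMap.integral_apply this]
    rfl
  rw [grad_apply, mollify, hd.fderiv, hprec, mollify_apply]
  have e1 : (∫ y, φ y • g (x - y)) i = ∫ y, φ y * g (x - y) i := by
    have := ((EuclideanSpace.proj (𝕜 := ℝ) i).integral_comp_comm
      (integrable_mollify hφ.continuous hc hu.2.1 x)).symm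
    simpa using this
  rw [e1]
  have hψ : ContDiff ℝ ∞ fun s => φ (x - s) := hφ.comp (contDiff_const.sub contDiff_id)
  have hψc : HasCompactSupport fun s => φ (x - s) :=
    hc.comp_homeomorph (Homeomorph.subLeft x)
  have key := hu.2.2 _ hψ hψc i
  have hfs : ∀ s, fderiv ℝ (fun s => φ (x - s)) s (EuclideanSpace.single i 1) =
      - fderiv ℝ φ (x - s) (EuclideanSpace.single i 1) := by
    intro s
    have h1 : HasFDerivAt (fun s : Space N => x - s) (-ContinuousLinearMap.id ℝ (Space N)) s :=
      (hasFDerivAt_id s).const_sub x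
    have h2 := ((hφ.differentiable (by simp)) (x - s)).hasFDerivAt.comp s h1
    rw [show (fun s => φ (x - s)) = φ ∘ fun s => x - s from rfl, h2.fderiv]
    simp
  simp only [hfs, mul_neg, integral_neg, neg_inj] at key
  rw [← integral_sub_left_eq_self (fun y => fderiv ℝ φ y (EuclideanSpace.single i 1) * u (x - y))
    volume x, ← integral_sub_left_eq_self (fun y => φ y * g (x - y) i) volume x]
  simpa only [sub_sub_cancel, mul_comm] using key

theorem contDiff_mollify {φ : Space N → ℝ} (hφ : ContDiff ℝ ∞ φ) (hc : HasCompactSupport φ)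
    {u : Space N → ℝ} (hu : LocallyIntegrable u volume) : ContDiff ℝ ∞ (mollify φ u) :=
  hc.contDiff_convolution_left _ hφ hu

open scoped Pointwise in
theorem isPuncturedTest_mollify {φ : Space N → ℝ} (hφ : ContDiff ℝ ∞ φ) (hc : HasCompactSupport φ)
    {u : Space N → ℝ} (hu : LocallyIntegrable u volume) (huc : HasCompactSupport u) {r : ℝ}
    (hφr : tsupport φ ⊆ Metric.closedBall 0 r) (hur : ∀ x ∈ tsupport u, r < ‖x‖) :
    IsPuncturedTest (mollify φ u) := by
  have hK : IsCompact (tsupport u + tsupport φ) := IsCompact.add huc hc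
  have hsub : tsupport (mollify φ u) ⊆ tsupport u + tsupport φ := by
    refine closure_minimal ?_ hK.isClosed
    exact (support_convolution_subset_swap _).trans
      (Set.add_subset_add subset_closure subset_closure)
  refine ⟨contDiff_mollify hφ hc hu, hK.of_isClosed_subset (isClosed_tsupport _) hsub, fun h => ?_⟩
  obtain ⟨a, ha, b, hb, hab⟩ := Set.mem_add.1 (hsub h)
  have h1 := hur a ha
  have h2 := hφr hb
  rw [mem_closedBall_zero_iff] at h2
  have : a = -b := eq_neg_of_add_eq_zero_left hab
  rw [this, norm_neg] at h1
  linarith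

end Henon

/-! ### Density of test functions: smoothing -/

namespace Henon

variable {N : ℕ}

theorem two_le_criticalExponent (hN : 3 ≤ N) : 2 ≤ criticalExponent N := by
  have h3 : (3 : ℝ) ≤ N := by exact_mod_cast hN
  rw [criticalExponent, show (2 : ENNReal) = ENNReal.ofReal 2 by simp]
  refine ENNReal.ofReal_le_ofReal ?_
  rw [le_div_iff₀ (by linarith)]
  linarith

/-- On a set of finite measure the larger exponent $2^*$ controls the exponent $2$. Compact support
is what brings $u$ itself into $L^2$. -/
theorem memLp_two_of_hasCompactSupport (hN : 3 ≤ N) {u : Space N → ℝ}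
    (hu : MemLp u (criticalExponent N) volume) (huc : HasCompactSupport u) :
    MemLp u 2 volume := by
  have hK : IsCompact (tsupport u) := huc
  have : IsFiniteMeasure (volume.restrict (tsupport u)) :=
    ⟨by simpa using hK.measure_lt_top⟩
  have h1 : MemLp u 2 (volume.restrict (tsupport u)) :=
    (hu.restrict _).mono_exponent (two_le_criticalExponent hN)
  have h2 := (memLp_indicator_iff_restrict (isClosed_tsupport u).measurableSet).2 h1
  have h3 : (tsupport u).indicator u = u := Set.indicator_eq_self.2 (subset_tsupport u)
  rwa [h3] at h2

theorem tendsto_of_le_mul_inv {f : ℕ → ENNReal} {C : ENNReal} (hC : C ≠ ⊤)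
    (h : ∀ n, f n ≤ C * (n : ENNReal)⁻¹) : Tendsto f atTop (𝓝 0) := by
  have h1 : Tendsto (fun n : ℕ => C * (n : ENNReal)⁻¹) atTop (𝓝 (C * 0)) :=
    ENNReal.Tendsto.const_mul ENNReal.tendsto_inv_nat_nhds_zero (Or.inr hC)
  rw [mul_zero] at h1
  exact tendsto_of_tendsto_of_tendsto_of_le_of_le tendsto_const_nhds h1 (fun _ => zero_le) h

/-- Mollification: functions of `D^{1,2}` with compact support in `ℝ^N ∖ {0}` are limits of test
functions. -/
theorem energyMap_mem_closure_of_hasCompactSupport {α : ℝ} (hN : 3 ≤ N) (hα : 0 < α) (v : d12 N)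
    (hc : HasCompactSupport (v : Space N → ℝ)) (h0 : (0 : Space N) ∉ tsupport (v : Space N → ℝ)) :
    energyMap hN hα v ∈
      closure (energyMap hN hα '' {w | IsPuncturedTest (w : Space N → ℝ)}) := by
  obtain ⟨ε, hε, hball⟩ := Metric.isOpen_iff.1 (isClosed_tsupport (v : Space N → ℝ)).isOpen_compl 0 h0
  have hg := v.2.hasWeakGradient
  have hg2 := v.2.memLp_weakGradient
  have hu2 := memLp_two_of_hasCompactSupport hN v.2.1 hc
  set u : Space N → ℝ := v.1 with hu
  set g := weakGradient u with hgd
  have hr : ∀ n : ℕ, ∃ r : ℝ, 0 < r ∧ r < ε ∧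
      ∀ y ∈ Metric.ball (0 : Space N) r,
        eLpNorm (fun x => u (x - y) - u x) 2 volume ≤ (n : ENNReal)⁻¹ ∧
        eLpNorm (fun x => g (x - y) - g x) 2 volume ≤ (n : ENNReal)⁻¹ := by
    intro n
    -- For $n=0$ the inverse is $\infty$ and the bound is void.
    have hn : 0 < (n : ENNReal)⁻¹ := by simp
    obtain ⟨r, hr, hb⟩ := Metric.eventually_nhds_iff_ball.1
      ((eventually_eLpNorm_translate_le hu2 hn).and (eventually_eLpNorm_translate_le hg2 hn))
    -- A radius below the distance $\varepsilon$ from the origin to the support keeps the mollified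
    -- function away from the origin.
    refine ⟨min r (ε / 2), by positivity, by linarith [min_le_right r (ε / 2)], fun y hy => ?_⟩
    exact hb y (Metric.ball_subset_ball (min_le_left _ _) hy)
  choose r hr0 hrε hrt using hr
  let b : ∀ n, ContDiffBump (0 : Space N) := fun n => ⟨r n / 2, r n, by linarith [hr0 n],
    by linarith [hr0 n]⟩
  set φ : ℕ → Space N → ℝ := fun n => (b n).normed volume with hφ
  have hφs : ∀ n, ContDiff ℝ ∞ (φ n) := fun n => (b n).contDiff_normed
  have hφc : ∀ n, HasCompactSupport (φ n) := fun n => (b n).hasCompactSupport_normed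
  have hφt : ∀ n, tsupport (φ n) ⊆ Metric.closedBall 0 (r n) := fun n =>
    ((b n).tsupport_normed_eq (μ := volume)).subset
  have hφsp : ∀ n, Function.support (φ n) = Metric.ball 0 (r n) := fun n =>
    (b n).support_normed_eq
  have hw : ∀ n, IsPuncturedTest (mollify (φ n) u) := fun n => by
    refine isPuncturedTest_mollify (hφs n) (hφc n) hg.1 hc (hφt n) fun x hx => ?_
    by_contra hlt
    refine hball ?_ hx
    rw [mem_ball_zero_iff]
    linarith [hrε n]
  have hest : ∀ n, eLpNorm (mollify (φ n) u - u) 2 volume ≤ (n : ENNReal)⁻¹ ∧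
      eLpNorm (mollify (φ n) g - g) 2 volume ≤ (n : ENNReal)⁻¹ := fun n =>
    ⟨eLpNorm_mollify_sub_le (hφs n).continuous (hφc n) (b n).nonneg_normed (b n).integral_normed
      hu2 fun y hy => (hrt n y (hφsp n ▸ hy)).1,
    eLpNorm_mollify_sub_le (hφs n).continuous (hφc n) (b n).nonneg_normed (b n).integral_normed
      hg2 fun y hy => (hrt n y (hφsp n ▸ hy)).2⟩
  obtain ⟨C, hC, hle⟩ := exists_sqrt_pot_le (N := N) hN hα
  have ht := tendsto_energyMap hN hα (l := atTop)
    (u := fun n => (⟨mollify (φ n) u, (hw n).memD12⟩ : d12 N)) (v := v)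
    (g := fun n => mollify (φ n) g) (h := g)
    (fun n => by
      have := hasWeakGradient_grad (hw n).contDiff
      rwa [grad_mollify (hφs n) (hφc n) hg] at this) hg
    (tendsto_of_le_mul_inv (C := 1) (by simp) fun n => by simpa using (hest n).2)
    (tendsto_of_le_mul_inv (C := ENNReal.ofReal C) (by simp) fun n => by
      refine (eLpNorm_le_mul_eLpNorm_of_ae_le_mul (g := mollify (φ n) u - u)
        (c := C) (Eventually.of_forall fun x => ?_) 2).trans ?_
      · rw [norm_mul, Real.norm_of_nonneg (Real.sqrt_nonneg _)]
        exact mul_le_mul_of_nonneg_right (hle x) (norm_nonneg _)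
      · gcongr
        exact (hest n).1)
  refine mem_closure_of_tendsto ht (Eventually.of_forall fun n => ⟨_, hw n, rfl⟩)

/-! ### Density of test functions: logarithmic cutoffs -/

theorem HasWeakGradient.smooth_mul {u : Space N → ℝ} {g : Space N → Space N}
    (hu : HasWeakGradient u g) {ψ : Space N → ℝ} (hψ : ContDiff ℝ ∞ ψ) :
    HasWeakGradient (fun x => ψ x * u x) fun x => ψ x • g x + u x • grad ψ x := by
  have hl : LocallyIntegrable (fun x => ψ x * u x) volume := by
    simpa using hu.1.continuous_smul hψ.continuous
  refine ⟨hl, (hu.2.1.continuous_smul hψ.continuous).add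
    (hu.1.smul_continuous (continuous_grad hψ)), fun φ hφ hc i => ?_⟩
  have hψd : Continuous fun x => fderiv ℝ ψ x (EuclideanSpace.single i 1) :=
    (hψ.continuous_fderiv (by simp)).clm_apply continuous_const
  have key := hu.2.2 (fun x => ψ x * φ x) (hψ.mul hφ) hc.mul_left i
  have hfd : ∀ x, fderiv ℝ (fun x => ψ x * φ x) x (EuclideanSpace.single i 1) =
      ψ x * fderiv ℝ φ x (EuclideanSpace.single i 1) +
        fderiv ℝ ψ x (EuclideanSpace.single i 1) * φ x := by
    intro x
    have := ((hψ.differentiable (by simp) x).hasFDerivAt.fun_mul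
      (hφ.differentiable (by simp) x).hasFDerivAt).fderiv
    rw [this]
    simp [mul_comm]
  have hd : Continuous fun x => fderiv ℝ φ x (EuclideanSpace.single i 1) :=
    (hφ.continuous_fderiv (by simp)).clm_apply continuous_const
  have i1 : Integrable fun x => u x * (ψ x * fderiv ℝ φ x (EuclideanSpace.single i 1)) :=
    integrable_locallyIntegrable_mul hu.1 (hψ.continuous.mul hd) (hc.fderiv_apply ℝ _).mul_left
  have i2 : Integrable fun x => u x * (fderiv ℝ ψ x (EuclideanSpace.single i 1) * φ x) :=
    integrable_locallyIntegrable_mul hu.1 (hψd.mul hφ.continuous) hc.mul_left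
  have i3 : Integrable fun x => g x i * (ψ x * φ x) :=
    integrable_locallyIntegrable_mul (hu.2.1.coord i) (hψ.continuous.mul hφ.continuous) hc.mul_left
  have e1 := integral_add i1 i2
  have e2 := integral_add i3 i2
  simp only [hfd, mul_add] at key
  rw [e1] at key
  have a1 : ∫ x, ψ x * u x * fderiv ℝ φ x (EuclideanSpace.single i 1) =
      ∫ x, u x * (ψ x * fderiv ℝ φ x (EuclideanSpace.single i 1)) := by
    congr 1; ext x; ring
  have a2 : ∫ x, (ψ x • g x + u x • grad ψ x) i * φ x =
      ∫ x, g x i * (ψ x * φ x) + u x * (fderiv ℝ ψ x (EuclideanSpace.single i 1) * φ x) := by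
    congr 1; ext x
    simp only [PiLp.add_apply, PiLp.smul_apply, grad_apply, smul_eq_mul]
    ring
  rw [a1, a2, e2]
  linarith

theorem norm_grad_radial {χ : ℝ → ℝ} (hχ : ContDiff ℝ ∞ χ) (t : ℝ) (θ : Sph N) :
    ‖grad (radial χ) (Real.exp t • (θ : Space N))‖ = Real.exp (-t) * |deriv χ t| := by
  have hd : HasDerivAt χ (deriv χ t) (Real.log ‖Real.exp t • (θ : Space N)‖) := by
    rw [norm_exp_smul, Real.log_exp]
    exact (hχ.differentiable (by simp) t).hasDerivAt
  rw [norm_grad, (hasFDerivAt_radial (exp_smul_ne_zero t θ) hd).fderiv, norm_smul, norm_smul,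
    innerSL_apply_norm, norm_exp_smul, Real.norm_eq_abs, norm_inv, norm_pow, Real.norm_eq_abs,
    abs_of_pos (Real.exp_pos t), Real.exp_neg]
  field_simp

theorem isPuncturedTest_radial {χ : ℝ → ℝ} (hχ : ContDiff ℝ ∞ χ) (hs : HasCompactSupport χ) :
    IsPuncturedTest (radial χ : Space N → ℝ) := by
  simpa using isPuncturedTest_radial_mul (N := N) hχ hs (h := fun _ => 1)
    fun x _ => contDiffAt_const

/-- Conformal invariance of the $N$-energy: $|\nabla|^N$ contributes $e^{-Nt}$, which cancels the
volume factor $e^{Nt}$. -/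
theorem integral_norm_grad_radial (hN : 3 ≤ N) {χ : ℝ → ℝ} (hχ : ContDiff ℝ ∞ χ)
    (hs : HasCompactSupport χ) :
    ∫ x : Space N, ‖grad (radial χ) x‖ ^ N =
      (∫ t, |deriv χ t| ^ N) * ∫ _ : Sph N, (1 : ℝ) ∂(sphMeasure N) := by
  have hw := isPuncturedTest_radial (N := N) hχ hs
  have hz := hasCompactSupport_of_vanishing hw (F := fun x => ‖grad (radial χ) x‖ ^ N)
    fun x hx => by
      rw [norm_grad, fderiv_eq_zero_of_notMem_tsupport hx, norm_zero, zero_pow (by omega)]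
  have hcont : Continuous fun x : Space N => ‖grad (radial χ) x‖ ^ N :=
    (continuous_grad hw.contDiff).norm.pow N
  rw [integral_eq_integral_polar (by omega) hcont hz.1 hz.2, ← integral_polar_mul]
  congr 1
  ext p
  rw [norm_grad_radial hχ, mul_pow, ← mul_assoc, ← Real.exp_nat_mul, ← Real.exp_add]
  simp

end Henon

namespace Henon

variable {N : ℕ}

theorem tendsto_eLpNorm_cutoff_sub {F : Type*} [NormedAddCommGroup F] [NormedSpace ℝ F]
    {f : Space N → F} (hf : MemLp f 2 volume) {ψ : ℕ → Space N → ℝ} (hc : ∀ n, Continuous (ψ n))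
    (h0 : ∀ n x, 0 ≤ ψ n x) (h1 : ∀ n x, ψ n x ≤ 1)
    (ht : ∀ᵐ x : Space N, ∀ᶠ n in atTop, ψ n x = 1) :
    Tendsto (fun n => eLpNorm (fun x => (ψ n x - 1) • f x) 2 volume) atTop (𝓝 0) := by
  have key : Tendsto (fun n => ∫⁻ x, ‖(ψ n x - 1) • f x‖ₑ ^ 2) atTop
      (𝓝 (∫⁻ _ : Space N, (0 : ENNReal))) := by
    refine tendsto_lintegral_of_dominated_convergence' (fun x => ‖f x‖ₑ ^ 2) (fun n => ?_)
      (fun n => Eventually.of_forall fun x => ?_) ?_ ?_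
    · exact ((((hc n).sub continuous_const).aestronglyMeasurable.smul hf.1).enorm).pow_const 2
    · beta_reduce
      gcongr
      rw [enorm_smul]
      have : ‖ψ n x - 1‖ₑ ≤ 1 := by
        rw [← enorm_one (G := ℝ), enorm_le_iff_norm_le, norm_one, Real.norm_eq_abs, abs_le]
        constructor <;> linarith [h0 n x, h1 n x]
      calc ‖ψ n x - 1‖ₑ * ‖f x‖ₑ ≤ 1 * ‖f x‖ₑ := by gcongr
        _ = ‖f x‖ₑ := one_mul _
    · intro h
      have := hf.2.ne
      rw [eLpNorm_two_eq, h] at this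
      simp at this
    · filter_upwards [ht] with x hx
      refine tendsto_const_nhds.congr' ?_
      filter_upwards [hx] with n hn
      simp [hn]
  rw [lintegral_zero] at key
  simp_rw [eLpNorm_two_eq]
  have := (ENNReal.continuous_rpow_const (y := (1 / 2 : ℝ))).tendsto 0
  rw [ENNReal.zero_rpow_of_pos (by norm_num)] at this
  exact this.comp key

/-- The origin and infinity have zero $N$-capacity. A bump in $\log|x|$ stretched by $n+1$ has
$N$-energy proportional to $(n+1)^{1-N}$, which tends to $0$, while the cutoff eventually equals $1$
at each nonzero point. -/
theorem exists_cutoff_seq (hN : 3 ≤ N) :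
    ∃ ψ : ℕ → Space N → ℝ, (∀ n, IsPuncturedTest (ψ n)) ∧ (∀ n x, 0 ≤ ψ n x) ∧
      (∀ n x, ψ n x ≤ 1) ∧ (∀ᵐ x : Space N, ∀ᶠ n in atTop, ψ n x = 1) ∧
      Tendsto (fun n => eLpNorm (grad (ψ n)) N volume) atTop (𝓝 0) := by
  obtain ⟨η, hη, hηc, hη1, -, hη0, hηle⟩ := exists_bump (r := 1) (R := 2) one_pos one_lt_two
  set χ : ℕ → ℝ → ℝ := fun n t => η (t / (n + 1)) with hχd
  have hpos : ∀ n : ℕ, (0 : ℝ) < n + 1 := fun n => by positivity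
  have hχ : ∀ n, ContDiff ℝ ∞ (χ n) := fun n => hη.comp (contDiff_id.div_const _)
  have hχc : ∀ n, HasCompactSupport (χ n) := fun n =>
    hηc.comp_homeomorph (Homeomorph.mulRight₀ ((n : ℝ) + 1)⁻¹ (inv_ne_zero (hpos n).ne'))
  have hψ : ∀ n, IsPuncturedTest (radial (χ n) : Space N → ℝ) := fun n =>
    isPuncturedTest_radial (hχ n) (hχc n)
  refine ⟨fun n => radial (χ n), hψ, fun n x => ?_, fun n x => ?_, ?_, ?_⟩
  · simp only [radial]
    split_ifs
    exacts [le_rfl, hη0 _]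
  · simp only [radial]
    split_ifs
    exacts [zero_le_one, hηle _]
  · have : Nontrivial (Space N) := by
      have : Nonempty (Fin N) := ⟨⟨0, by omega⟩⟩
      infer_instance
    have h0 : ∀ᵐ x : Space N, x ≠ 0 := by
      rw [ae_iff]
      simp
    filter_upwards [h0] with x hx
    obtain ⟨m, hm⟩ := exists_nat_ge |Real.log ‖x‖|
    filter_upwards [eventually_ge_atTop m] with n hn
    rw [radial_of_ne _ hx]
    refine hη1 _ ?_
    rw [abs_div, abs_of_pos (hpos n), div_le_one (hpos n)]
    have : (m : ℝ) ≤ n := by exact_mod_cast hn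
    linarith
  · set I := (∫ t, |deriv η t| ^ N) * ∫ _ : Sph N, (1 : ℝ) ∂(sphMeasure N) with hI
    have hint : ∀ n : ℕ, ∫ x : Space N, ‖grad (radial (χ n)) x‖ ^ N =
        (((n : ℝ) + 1) ^ (N - 1))⁻¹ * I := by
      intro n
      have hd : ∀ t, deriv (χ n) t = deriv η (t / (n + 1)) / (n + 1) := by
        intro t
        have h1 : HasDerivAt (fun t : ℝ => t / (n + 1)) (1 / ((n : ℝ) + 1)) t :=
          (hasDerivAt_id t).div_const _
        have h2 := ((hη.differentiable (by simp)) (t / (n + 1))).hasDerivAt.comp t h1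
        rw [show χ n = η ∘ fun t => t / (n + 1) from rfl, h2.deriv]
        ring
      rw [integral_norm_grad_radial hN (hχ n) (hχc n), hI, ← mul_assoc]
      congr 1
      simp_rw [hd, abs_div, div_pow]
      rw [integral_div, Measure.integral_comp_div (fun t => |deriv η t| ^ N), abs_of_pos (hpos n),
        smul_eq_mul]
      obtain ⟨M, rfl⟩ : ∃ M, N = M + 1 := ⟨N - 1, by omega⟩
      have := (hpos n).ne'
      rw [Nat.add_sub_cancel, pow_succ ((n : ℝ) + 1)]
      field_simp
    have hnorm : ∀ n : ℕ, eLpNorm (grad (radial (χ n) : Space N → ℝ)) N volume =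
        ENNReal.ofReal (((((n : ℝ) + 1) ^ (N - 1))⁻¹ * I) ^ (N : ℝ)⁻¹) := by
      intro n
      have hm : MemLp (grad (radial (χ n) : Space N → ℝ)) N volume :=
        (continuous_grad (hψ n).contDiff).memLp_of_hasCompactSupport
          (hasCompactSupport_grad (hψ n).hasCompactSupport)
      rw [hm.eLpNorm_eq_integral_rpow_norm (by simp; omega) (by simp), ← hint n]
      simp
    simp_rw [hnorm]
    have h1 : Tendsto (fun n : ℕ => (((n : ℝ) + 1) ^ (N - 1))⁻¹ * I) atTop (𝓝 (0 * I)) := by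
      refine Tendsto.mul_const _ (tendsto_inv_atTop_zero.comp ?_)
      exact (tendsto_pow_atTop (by omega)).comp
        (tendsto_natCast_atTop_atTop.atTop_add tendsto_const_nhds)
    rw [zero_mul] at h1
    have hNi : (0 : ℝ) < (N : ℝ)⁻¹ := by
      have : (3 : ℝ) ≤ N := by exact_mod_cast hN
      positivity
    have h2 := h1.rpow_const (p := (N : ℝ)⁻¹) (Or.inr hNi.le)
    rw [Real.zero_rpow hNi.ne'] at h2
    simpa using ENNReal.tendsto_ofReal h2

/-- Test functions supported away from the origin are dense in `D^{1,2}` for the energy. -/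
theorem energyMap_mem_closure {α : ℝ} (hN : 3 ≤ N) (hα : 0 < α) (v : d12 N) :
    energyMap hN hα v ∈
      closure (energyMap hN hα '' {w | IsPuncturedTest (w : Space N → ℝ)}) := by
  obtain ⟨ψ, hψ, h0, h1, ht, hgrad⟩ := exists_cutoff_seq hN
  have hH := holderTriple_criticalExponent hN
  have hg := v.2.hasWeakGradient
  have hg2 := v.2.memLp_weakGradient
  have hv := v.2.1
  set u : Space N → ℝ := v.1 with hu
  set g := weakGradient u with hgd
  have hgr : ∀ n, MemLp (grad (ψ n)) N volume := fun n =>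
    (continuous_grad (hψ n).contDiff).memLp_of_hasCompactSupport
      (hasCompactSupport_grad (hψ n).hasCompactSupport)
  have hH' : ENNReal.HolderTriple (criticalExponent N) (N : ENNReal) 2 := hH.symm
  have hle1 : ∀ n x, ‖ψ n x‖ ≤ 1 := fun n x => by
    rw [Real.norm_of_nonneg (h0 n x)]
    exact h1 n x
  have hmem : ∀ n, MemD12 fun x => ψ n x * u x := by
    intro n
    refine ⟨?_, _, hg.smooth_mul (hψ n).contDiff, ?_⟩
    · refine hv.of_le ((hψ n).contDiff.continuous.aestronglyMeasurable.mul hv.1)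
        (Eventually.of_forall fun x => ?_)
      rw [norm_mul]
      exact mul_le_of_le_one_left (norm_nonneg _) (hle1 n x)
    · refine MemLp.add ?_ ((hgr n).smul hv)
      refine hg2.of_le ((hψ n).contDiff.continuous.aestronglyMeasurable.smul hg2.1)
        (Eventually.of_forall fun x => ?_)
      rw [norm_smul]
      exact mul_le_of_le_one_left (norm_nonneg _) (hle1 n x)
  have hcl : ∀ n, energyMap hN hα ⟨_, hmem n⟩ ∈
      closure (energyMap hN hα '' {w | IsPuncturedTest (w : Space N → ℝ)}) := by
    intro n
    have := hasCompactSupport_of_vanishing (hψ n) (F := fun x => ψ n x * u x) fun x hx => by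
      rw [image_eq_zero_of_notMem_tsupport hx, zero_mul]
    exact energyMap_mem_closure_of_hasCompactSupport hN hα ⟨_, hmem n⟩ this.1 this.2
  have hlim := tendsto_energyMap hN hα (l := atTop) (u := fun n => ⟨_, hmem n⟩) (v := v)
    (fun n => hg.smooth_mul (hψ n).contDiff) hg ?_ ?_
  -- The truncated functions are themselves only limits of test functions, so the closure is taken
  -- twice.
  · rw [← closure_closure]
    exact mem_closure_of_tendsto hlim (Eventually.of_forall hcl)
  · have a1 := tendsto_eLpNorm_cutoff_sub hg2 (fun n => (hψ n).contDiff.continuous) h0 h1 ht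
    have a2 : Tendsto (fun n => eLpNorm u (criticalExponent N) volume *
        eLpNorm (grad (ψ n)) N volume) atTop (𝓝 0) := by
      have := ENNReal.Tendsto.const_mul hgrad (Or.inr hv.2.ne)
      rwa [mul_zero] at this
    have a3 := a1.add a2
    rw [add_zero] at a3
    refine tendsto_of_tendsto_of_tendsto_of_le_of_le tendsto_const_nhds a3 (fun _ => zero_le)
      fun n => ?_
    -- The error in the gradient is $(\psi_n-1)\nabla u+u\nabla\psi_n$. Dominated convergence treats
    -- the first term, Hölder with exponents $2^*$ and $N$ the second.
    have e : (fun x => ψ n x • g x + u x • grad (ψ n) x) - g =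
        (fun x => (ψ n x - 1) • g x) + u • grad (ψ n) := by
      ext1 x
      simp only [Pi.sub_apply, Pi.add_apply, Pi.smul_apply', sub_smul, one_smul]
      abel
    rw [e]
    refine (eLpNorm_add_le ?_ (hv.1.smul (hgr n).1) (by norm_num)).trans ?_
    · exact ((hψ n).contDiff.continuous.sub continuous_const).aestronglyMeasurable.smul hg2.1
    · gcongr
      exact eLpNorm_smul_le_mul_eLpNorm (hgr n).1 hv.1
  · refine (tendsto_eLpNorm_cutoff_sub (memLp_sqrt_pot_mul hN hα hv)
      (fun n => (hψ n).contDiff.continuous) h0 h1 ht).congr fun n => ?_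
    congr 1
    ext1 x
    simp only [smul_eq_mul]
    ring

end Henon

/-! ### The upper bound for the Morse index -/

namespace Henon

variable {N : ℕ}

/-- A continuous function which is nonnegative on a subspace of codimension `d` of the range of `S` is
negative definite only on subspaces of the closure of that range of dimension at most `d`. -/
theorem finrank_le_of_negative {D E V : Type*} [AddCommGroup D] [Module ℝ D]
    [NormedAddCommGroup E] [NormedSpace ℝ E] [AddCommGroup V] [Module ℝ V] [FiniteDimensional ℝ V]
    (S : D →ₗ[ℝ] E) {d : ℕ} (ℓ : D →ₗ[ℝ] (Fin d → ℝ)) {q : E → ℝ} (hq : Continuous q)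
    (hpos : ∀ p, ℓ p = 0 → 0 ≤ q (S p)) (T : V →ₗ[ℝ] E)
    (hcl : ∀ v, T v ∈ closure (Set.range S)) (hneg : ∀ v, v ≠ 0 → q (T v) < 0) :
    Module.finrank ℝ V ≤ d := by
  by_contra! hd
  set n := Module.finrank ℝ V with hn
  let b : Module.Basis (Fin n) ℝ V := Module.finBasis ℝ V
  have happ : ∀ i, ∃ p : ℕ → D, Tendsto (fun m => S (p m)) atTop (𝓝 (T (b i))) := by
    intro i
    obtain ⟨x, hx, hlim⟩ := mem_closure_iff_seq_limit.1 (hcl (b i))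
    choose p hp using hx
    exact ⟨p, by simpa [hp] using hlim⟩
  choose p hp using happ
  -- The functional `ℓ` need not be continuous, so it cannot be extended to the closure. Instead,
  -- for each $m$ a dimension count gives a unit vector of coefficients whose combination of the
  -- $m$-th approximants lies in the kernel of `ℓ`.
  have hker : ∀ m, ∃ c : EuclideanSpace ℝ (Fin n), ‖c‖ = 1 ∧ ℓ (∑ i, c i • p i m) = 0 := by
    intro m
    let L : EuclideanSpace ℝ (Fin n) →ₗ[ℝ] (Fin d → ℝ) :=
      { toFun := fun c => ℓ (∑ i, c i • p i m)
        map_add' := fun c c' => by simp [add_smul, Finset.sum_add_distrib]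
        map_smul' := fun a c => by simp [mul_smul, Finset.smul_sum] }
    have hL : LinearMap.ker L ≠ ⊥ := LinearMap.ker_ne_bot_of_finrank_lt (by simpa using hd)
    obtain ⟨c, hc, hc0⟩ := Submodule.exists_mem_ne_zero_of_ne_bot hL
    refine ⟨‖c‖⁻¹ • c, norm_smul_inv_norm (𝕜 := ℝ) hc0, ?_⟩
    have : L (‖c‖⁻¹ • c) = 0 := by rw [map_smul, LinearMap.mem_ker.1 hc, smul_zero]
    exact this
  choose c hc1 hc0 using hker
  -- The unit sphere of coefficients is compact: a limit vector gives a nonzero element of `V` where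
  -- `q` is a limit of nonnegative values.
  obtain ⟨a, ha, s, hs, hlim⟩ := (isCompact_sphere (0 : EuclideanSpace ℝ (Fin n)) 1).tendsto_subseq
    (x := c) fun m => by simp [hc1 m]
  have ha1 : ‖a‖ = 1 := by simpa using ha
  have hci : ∀ i, Tendsto (fun m => c (s m) i) atTop (𝓝 (a i)) := fun i =>
    ((EuclideanSpace.proj (𝕜 := ℝ) i).continuous.tendsto a).comp hlim
  have hlimS : Tendsto (fun m => S (∑ i, c (s m) i • p i (s m))) atTop
      (𝓝 (T (∑ i, a i • b i))) := by
    simp only [map_sum, map_smul]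
    exact tendsto_finsetSum _ fun i _ => (hci i).smul ((hp i).comp hs.tendsto_atTop)
  have h1 : 0 ≤ q (T (∑ i, a i • b i)) :=
    ge_of_tendsto ((hq.tendsto _).comp hlimS) (Eventually.of_forall fun m => hpos _ (hc0 (s m)))
  have hne : ∑ i, a i • b i ≠ 0 := by
    intro h0
    have := Fintype.linearIndependent_iff.1 b.linearIndependent (fun i => a i) h0
    have ha0 : a = 0 := by ext i; exact this i
    rw [ha0, norm_zero] at ha1
    exact zero_ne_one ha1
  exact absurd h1 (not_le.2 (hneg _ hne))

theorem sphInner_add_left {f g h : Space N → ℝ} (hf : Continuous f) (hg : Continuous g)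
    (hh : Continuous h) : sphInner (f + g) h = sphInner f h + sphInner g h := by
  have := integral_add (integrable_sphere (hf.mul hh)) (integrable_sphere (hg.mul hh))
  simp only [sphInner, Pi.add_apply, Pi.mul_apply, add_mul] at this ⊢
  exact this

theorem sphInner_smul_left (c : ℝ) (f h : Space N → ℝ) :
    sphInner (c • f) h = c * sphInner f h := by
  simp only [sphInner, Pi.smul_apply, smul_eq_mul, mul_assoc, integral_const_mul]

/-- Negative subspaces have dimension at most the number of spherical harmonics of degree less
than `(2 + α) / 2`. -/
theorem IsNegativeSubspace.finrank_le {α κ : ℝ} (hN : 3 ≤ N) (hα : 0 < α) (hκ : 2 * κ = 2 + α)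
    {V : Submodule ℝ (Space N → ℝ)} (hV : IsNegativeSubspace N α (U N α) V) :
    Module.finrank ℝ V ≤
      ∑ j ∈ Finset.range ⌈κ⌉₊, Module.finrank ℝ (harmonicSubmodule N j) := by
  obtain ⟨hfin, hmem, hneg⟩ := hV
  obtain ⟨d, Z, hd, hZ1, hZ2⟩ := exists_harmonic_directions hN (κ := κ) (by linarith)
  refine le_trans ?_ hd
  have hle : puncturedTest N ≤ d12 N := fun w hw => IsPuncturedTest.memD12 hw
  have hVle : V ≤ d12 N := fun v hv => hmem v hv
  let ℓ : puncturedTest N →ₗ[ℝ] (Fin d → ℝ) :=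
    { toFun := fun w i => sphInner w.1 (pfun (Z i))
      map_add' := fun w w' => by
        ext i
        exact sphInner_add_left w.2.contDiff.continuous w'.2.contDiff.continuous
          (contDiff_pfun _).continuous
      map_smul' := fun c w => by
        ext i
        exact sphInner_smul_left c _ _ }
  refine finrank_le_of_negative ((energyMap hN hα).comp (Submodule.inclusion hle)) ℓ
    continuous_energyForm (fun w hw => ?_) ((energyMap hN hα).comp (Submodule.inclusion hVle))
    (fun v => ?_) fun v hv => ?_
  · rw [LinearMap.comp_apply, energyForm_energyMap]
    have h1 := w.2.secondVariation_eq hN hα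
    have h2 := integral_density_nonneg hN hα hκ hZ1 hZ2 w.2 fun i => congrFun hw i
    exact h2.trans_eq h1.symm
  · have := energyMap_mem_closure hN hα (Submodule.inclusion hVle v)
    refine closure_mono ?_ this
    rintro _ ⟨w, hw, rfl⟩
    exact ⟨⟨w.1, hw⟩, rfl⟩
  · rw [LinearMap.comp_apply, energyForm_energyMap]
    exact hneg v.1 v.2 fun h => hv (Subtype.ext h)

end Henon

/-! ### The lower bound and the value of the Morse index -/

namespace Henon

variable {N : ℕ}

/-- A homogeneous polynomial that vanishes on the sphere vanishes off the origin by scaling, and at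
the origin by continuity. This is what makes restriction to the sphere injective in each degree. -/
theorem sphInner_self_pos_of_harmonic (hN : 3 ≤ N) {k : ℕ} {p : MvPolynomial (Fin N) ℝ}
    (hp : p ∈ harmonicSubmodule N k) (h0 : p ≠ 0) : 0 < sphInner (pfun p) (pfun p) := by
  have hpc : Continuous (pfun p) := (contDiff_pfun p).continuous
  have hc : Continuous fun θ : Sph N => pfun p θ * pfun p θ :=
    (hpc.mul hpc).comp continuous_subtype_val
  refine (sphInner_self_nonneg _).lt_of_ne' fun h => h0 (eq_zero_of_pfun_eq_zero ?_)
  have hz : ∀ θ : Sph N, pfun p θ = 0 := by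
    have h1 := (integral_eq_zero_iff_of_nonneg (fun θ : Sph N => mul_self_nonneg (pfun p θ))
      (integrable_sphere (hpc.mul hpc))).1 h
    have h2 := (hc.ae_eq_iff_eq _ continuous_zero).1 h1
    exact fun θ => mul_self_eq_zero.1 (congrFun h2 θ)
  have : Nontrivial (Space N) := by
    have : Nonempty (Fin N) := ⟨⟨0, by omega⟩⟩
    infer_instance
  refine congrFun (Continuous.ext_on (dense_compl_singleton (0 : Space N)) hpc
    (continuous_const (y := (0 : ℝ))) fun x hx => ?_)
  have hx0 : ‖x‖ ≠ 0 := norm_ne_zero_iff.2 hx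
  have hx1 : ‖‖x‖⁻¹ • x‖ = 1 := by
    rw [norm_smul, norm_inv, norm_norm, inv_mul_cancel₀ hx0]
  have e : x = ‖x‖ • (‖x‖⁻¹ • x) := (smul_inv_smul₀ hx0 x).symm
  have h3 := hz ⟨‖x‖⁻¹ • x, by simpa using hx1⟩
  rw [e, pfun_smul_of_isHomogeneous hp.1]
  simp only at h3
  rw [h3, mul_zero]

/-- The functions `profile · χ · Y`, for `Y` a sum of harmonic polynomials restricted to the sphere. -/
noncomputable def separated (K : ℕ) (β κ : ℝ) (χ : ℝ → ℝ) :
    (∀ j : Fin K, harmonicSubmodule N j) →ₗ[ℝ] (Space N → ℝ) where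
  toFun y x := radial (profile β κ) x *
    (radial χ x * pfun (∑ j, (y j : MvPolynomial (Fin N) ℝ)) (‖x‖⁻¹ • x))
  map_add' y y' := by
    ext x
    simp only [Pi.add_apply, Submodule.coe_add, Finset.sum_add_distrib, pfun_add]
    ring
  map_smul' c y := by
    ext x
    simp only [Pi.smul_apply, Submodule.coe_smul, MvPolynomial.smul_eq_C_mul,
      ← Finset.mul_sum, pfun_mul, pfun_C, RingHom.id_apply, smul_eq_mul]
    ring

/-- The negative directions given by the spherical harmonics of degree less than `(2 + α) / 2`. -/
theorem exists_isNegativeSubspace {α κ : ℝ} (hN : 3 ≤ N) (hα : 0 < α) (hκ : 2 * κ = 2 + α) :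
    ∃ V, IsNegativeSubspace N α (U N α) V ∧
      Module.finrank ℝ V =
        ∑ j ∈ Finset.range ⌈κ⌉₊, Module.finrank ℝ (harmonicSubmodule N j) := by
  have h3 : (3 : ℝ) ≤ N := by exact_mod_cast hN
  have hκ0 : 0 < κ := by linarith
  set β : ℝ := (N - 2) / 2 with hβd
  have hβ : 2 * β = N - 2 := by rw [hβd]; ring
  set K := ⌈κ⌉₊ with hK
  have hK0 : 0 < K := Nat.ceil_pos.2 hκ0
  -- $K-1$ is the largest degree strictly below $\kappa$, and `δ` is the distance from its
  -- eigenvalue to the threshold. The cutoff is chosen so that its radial energy costs less than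
  -- this gap.
  have hKκ : ((K - 1 : ℕ) : ℝ) < κ := Nat.lt_ceil.1 (Nat.sub_lt hK0 one_pos)
  set δ := sphEigenvalue N κ - sphEigenvalue N (K - 1 : ℕ) with hδd
  have hmono := sphEigenvalue_strictMonoOn hN
  have hδ : 0 < δ := sub_pos.2 (hmono (Set.mem_Ici.2 (Nat.cast_nonneg _)) (Set.mem_Ici.2 hκ0.le) hKκ)
  obtain ⟨χ, hχ, hχs, hB, hA⟩ := exists_cutoff (β := β) (by rw [hβd]; linarith) hκ0 hδ
  set A := ∫ t, rho β κ t * deriv χ t ^ 2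
  set B := ∫ t, rho β κ t * χ t ^ 2
  have hneg : ∀ y : ∀ j : Fin K, harmonicSubmodule N j,
      IsPuncturedTest (separated K β κ χ y) ∧
        (y ≠ 0 → secondVariation N α (U N α) (separated K β κ χ y) < 0) := by
    intro y
    set Y : ℕ → MvPolynomial (Fin N) ℝ := fun j => if h : j < K then y ⟨j, h⟩ else 0 with hYd
    have hY : ∀ j, Y j ∈ harmonicSubmodule N j := fun j => by
      simp only [hYd]
      split_ifs with h
      exacts [(y ⟨j, h⟩).2, Submodule.zero_mem _]
    have hsum : ∑ j, (y j : MvPolynomial (Fin N) ℝ) = ∑ j ∈ Finset.range K, Y j := by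
      rw [Finset.sum_range]
      exact Finset.sum_congr rfl fun j _ => by simp [hYd]
    have hform : separated K β κ χ y = fun x => radial (profile β κ) x *
        (radial χ x * pfun (∑ j ∈ Finset.range K, Y j) (‖x‖⁻¹ • x)) := by
      rw [← hsum]
      rfl
    obtain ⟨ht, hint⟩ := integral_density_separated hN hα hβ hκ hχ hχs
      (contDiff_pfun (∑ j ∈ Finset.range K, Y j))
    rw [hform]
    refine ⟨ht, fun hy => ?_⟩
    rw [ht.secondVariation_eq hN hα, hint, sphInner_sum_harmonic_self hN le_rfl hY,
      sphDirichlet_sum_harmonic_self hN hY]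
    set s : ℕ → ℝ := fun j => sphInner (pfun (Y j)) (pfun (Y j)) with hs
    have hs0 : ∀ j, 0 ≤ s j := fun j => sphInner_self_nonneg _
    have hpos : 0 < ∑ j ∈ Finset.range K, s j := by
      obtain ⟨j, hj⟩ := Function.ne_iff.1 hy
      refine Finset.sum_pos' (fun j _ => hs0 j) ⟨j, Finset.mem_range.2 j.2, ?_⟩
      refine sphInner_self_pos_of_harmonic hN (hY j) ?_
      have : Y j = y j := by simp [hYd]
      rw [this]
      exact fun h => hj (Subtype.ext h)
    have hle : 1 / 2 * ∑ j ∈ Finset.range K, 2 * sphEigenvalue N j * s j ≤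
        sphEigenvalue N (K - 1 : ℕ) * ∑ j ∈ Finset.range K, s j := by
      rw [Finset.mul_sum, Finset.mul_sum]
      refine Finset.sum_le_sum fun j hj => ?_
      have hjK : (j : ℝ) ≤ (K - 1 : ℕ) := by
        have := Finset.mem_range.1 hj
        exact_mod_cast (by omega : j ≤ K - 1)
      have := hmono.monotoneOn (Set.mem_Ici.2 (Nat.cast_nonneg _))
        (Set.mem_Ici.2 (Nat.cast_nonneg _)) hjK
      nlinarith [hs0 j]
    set I := ∑ j ∈ Finset.range K, s j
    have h4 : (∫ t, rho β κ t * χ t ^ 2) * (1 / 2 * ∑ j ∈ Finset.range K,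
        2 * sphEigenvalue N j * s j - sphEigenvalue N κ * I) ≤ B * (-δ * I) := by
      refine mul_le_mul_of_nonneg_left ?_ hB.le
      rw [hδd]
      linarith
    have h5 : A * I < δ * B * I := mul_lt_mul_of_pos_right hA hpos
    calc _ ≤ A * I + B * (-δ * I) := by gcongr
      _ < 0 := by linarith
  have hzero : secondVariation N α (U N α) 0 = 0 := by
    rw [((puncturedTest N).zero_mem : IsPuncturedTest _).secondVariation_eq hN hα]
    have : density α (0 : Space N → ℝ) = fun _ => 0 := by
      ext x
      simp [density]
    rw [this, integral_zero]
  -- A nonzero element of the kernel would make the second variation negative at the zero function.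
  have hinj : Function.Injective (separated (N := N) K β κ χ) := by
    rw [← LinearMap.ker_eq_bot, LinearMap.ker_eq_bot']
    intro y hy
    by_contra h
    have := (hneg y).2 h
    rw [hy, hzero] at this
    exact lt_irrefl _ this
  refine ⟨LinearMap.range (separated K β κ χ), ⟨inferInstance, ?_, ?_⟩, ?_⟩
  · rintro _ ⟨y, rfl⟩
    exact (hneg y).1.memD12
  · rintro _ ⟨y, rfl⟩ hne
    exact (hneg y).2 fun h => hne (by rw [h, map_zero])
  · rw [LinearMap.finrank_range_of_inj hinj, Module.finrank_pi_fintype, Finset.sum_range]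

theorem morseIndex_eq {α : ℝ} (hN : 3 ≤ N) (hα : 0 < α) :
    morseIndex N α (U N α) =
      ((∑ j ∈ indexSet α, Module.finrank ℝ (harmonicSubmodule N j) : ℕ) : ℕ∞) := by
  have hκ : 2 * ((α + 2) / 2) = 2 + α := by ring
  refine le_antisymm (iSup₂_le fun V hV => ?_) ?_
  · exact_mod_cast hV.finrank_le hN hα hκ
  · obtain ⟨V, hV, hfin⟩ := exists_isNegativeSubspace hN hα hκ
    rw [indexSet, ← hfin]
    exact le_iSup₂_of_le V hV le_rfl

theorem finrank_harmonicSubmodule_pos (hN : 3 ≤ N) (k : ℕ) :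
    0 < Module.finrank ℝ (harmonicSubmodule N k) := by
  have h3 : (3 : ℝ) ≤ N := by exact_mod_cast hN
  have h : 0 < multiplicity N k := by
    have : (0 : ℝ) ≤ k := Nat.cast_nonneg k
    have h1 : (0 : ℝ) < (N : ℝ) + 2 * k - 2 := by linarith
    rw [multiplicity]
    positivity
  rw [← finrank_harmonicSubmodule hN] at h
  exact_mod_cast h

end Henon



/-! ### Assembly of the three claims -/

theorem corollary1p4 (N : ℕ) (hN : 3 ≤ N) :
    (∀ α : ℝ, 0 < α → ∃ m : ℕ, Henon.morseIndex N α (Henon.U N α) = (m : ℕ∞) ∧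
      (m : ℝ) = ∑ k ∈ Henon.indexSet α, Henon.multiplicity N k) ∧
    (∀ j : ℕ, 1 ≤ j → ∀ α β : ℝ, 0 < α → α ≤ 2 * (j : ℝ) → 2 * (j : ℝ) < β →
      Henon.morseIndex N α (Henon.U N α) < Henon.morseIndex N β (Henon.U N β)) ∧
    Tendsto (fun α : ℝ => Henon.morseIndex N α (Henon.U N α)) atTop (𝓝 (⊤ : ℕ∞)) := by
  have hsub : ∀ {a b : ℕ}, a ≤ b →
      ∑ k ∈ Finset.range a, Module.finrank ℝ (Henon.harmonicSubmodule N k) ≤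
        ∑ k ∈ Finset.range b, Module.finrank ℝ (Henon.harmonicSubmodule N k) := fun h =>
    Finset.sum_le_sum_of_subset (Finset.range_mono h)
  refine ⟨fun α hα => ⟨_, Henon.morseIndex_eq hN hα, ?_⟩, fun j _ α β hα hαj hβ => ?_, ?_⟩
  · push_cast
    exact Finset.sum_congr rfl fun k _ => Henon.finrank_harmonicSubmodule hN k
  · rw [Henon.morseIndex_eq hN hα, Henon.morseIndex_eq hN (by linarith [Nat.cast_nonneg (α := ℝ) j]),
      Nat.cast_lt, Henon.indexSet, Henon.indexSet]
    -- For $\alpha\le2j$ only degrees up to $j$ count, while for $\beta>2j$ degree $j+1$ counts as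
    -- well; its harmonics make the jump strict.
    have h1 : ⌈(α + 2) / 2⌉₊ ≤ j + 1 := Nat.ceil_le.2 (by push_cast; linarith)
    have h2 : j + 1 + 1 ≤ ⌈(β + 2) / 2⌉₊ := Nat.lt_ceil.2 (by push_cast; linarith)
    refine (hsub h1).trans_lt (lt_of_lt_of_le ?_ (hsub h2))
    rw [Finset.sum_range_succ _ (j + 1)]
    exact Nat.lt_add_of_pos_right (Henon.finrank_harmonicSubmodule_pos hN _)
  · rw [ENat.tendsto_nhds_top_iff_natCast_lt]
    intro n
    filter_upwards [eventually_gt_atTop (2 * (n : ℝ))] with α hα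
    have hn : (0 : ℝ) ≤ n := Nat.cast_nonneg n
    rw [Henon.morseIndex_eq hN (by linarith), Nat.cast_lt, Henon.indexSet]
    -- At least $n+1$ degrees count, and each contributes at least one dimension.
    have h2 : n < ⌈(α + 2) / 2⌉₊ := Nat.lt_ceil.2 (by linarith)
    calc n < ∑ _k ∈ Finset.range (n + 1), 1 := by simp
      _ ≤ ∑ k ∈ Finset.range (n + 1), Module.finrank ℝ (Henon.harmonicSubmodule N k) :=
        Finset.sum_le_sum fun k _ => Henon.finrank_harmonicSubmodule_pos hN k
      _ ≤ _ := hsub h2
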